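/- **Circuits.** Let $C$ be a circuit on $n$ qubits, started in $|0\rangle^{\otimes n}$, that consists of $g$ noiseless Clifford gates ($H$, $S$, CNOT) interleaved with $m\ge 1$ noisy gates. Each noisy gate is an arbitrary single-qubit unitary $U$ (typically non-Clifford, such as the $\pi/8$-gate) with a random Pauli $X^{y_2}Z^{y_1}$, $y_1,y_2\in\{0,1\}$, followed by the noise channel $\mathcal E_3\circ\mathcal E_2\circ\mathcal E_1$, placed on its qubit immediately before $U$ or immediately after $U$. Here $\mathcal E_i(\rho)=(1-\epsilon_i)\rho+\epsilon_i\sigma_i\rho\sigma_i$, $(\sigma_1,\sigma_2,\sigma_3)=(Z,X,Y)$, $0\le\epsilon_i\le\frac12$, and $\epsilon>0$ denotes the second largest of $\epsilon_1,\epsilon_2,\epsilon_3$. The $4^m$ choices $\mathbf y$ of the Paulis, taken with equal weight, form the ensemble. Measure $r$ of the qubits in the computational basis, and let $q'_{\mathbf x|\mathbf y}$ be the probability of the outcome $\mathbf x\in\{0,1\}^r$ for the circuit $\mathbf y$. **Theorem.** There is a polynomial $p$ such that, for all constants $r\in\mathbb N$ and $\epsilon,\delta,\eta>0$, there is a classical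 algorithm (a program for a random access machine with unit-cost addition and truncated subtraction of natural numbers, unit-cost ring operations and rational constants for real numbers, and control flow that depends on natural numbers only) with the following property. For all such $C$ (with second largest error rate $\epsilon$) and all choices of $r$ measured qubits, given the circuit with its Pauli choice $\mathbf y$, the error rates, the entries of the unitaries $U$, the measured qubits and an outcome $\mathbf x$, the algorithm halts within $$p(n+g)\cdot(8m)^{l},\qquad l=\left\lceil\frac{\ln\!\big(2^{r}\delta^{-1}(1+\sqrt{\eta^{-1}})\big)}{2\epsilon}\right\rceil$$ steps (with $l=0$ if this number is negative) and outputs a real number $p'_{\mathbf x|\mathbf y}$ such that $$\sum_{\mathbf x\in\{0,1\}^r}\big|p'_{\mathbf x|\mathbf y}-q'_{\mathbf x|\mathbf y}\big|\le\delta$$ for at least a fraction $1-\eta$ of the circuits $\mathbf y$ of the ensemble. In particular, the running time is $\mathrm{poly}(n)\cdot(8m)^{l}$ when the number $g$ of Clifford gates is polynomial in $n$. -/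

import Mathlib

namespace NoisyClifford

noncomputable section

/-! ### States and gates of an `n`-qubit register -/

/-- Computational basis of `n` qubits. -/
abbrev Basis (n : ℕ) : Type := Fin n → Fin 2

/-- Operators on the Hilbert space of `n` qubits, as matrices in the computational basis. -/
abbrev Op (n : ℕ) : Type := Matrix (Basis n) (Basis n) ℂ

/-- The Pauli matrices. -/
def pauliX : Matrix (Fin 2) (Fin 2) ℂ := !![0, 1; 1, 0]

def pauliY : Matrix (Fin 2) (Fin 2) ℂ := !![0, -Complex.I; Complex.I, 0]

def pauliZ : Matrix (Fin 2) (Fin 2) ℂ := !![1, 0; 0, -1]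

/-- The Hadamard gate and the phase gate. -/
def hadamard : Matrix (Fin 2) (Fin 2) ℂ := ((Real.sqrt 2 : ℝ) : ℂ)⁻¹ • !![1, 1; 1, -1]

def phase : Matrix (Fin 2) (Fin 2) ℂ := !![1, 0; 0, Complex.I]

/-- The single-qubit operator `A` acting on qubit `q`, tensored with the identity elsewhere. -/
def onQubit {n : ℕ} (q : Fin n) (A : Matrix (Fin 2) (Fin 2) ℂ) : Op n :=
  Matrix.of fun a b => if ∀ j, j ≠ q → a j = b j then A (a q) (b q) else 0

/-- The controlled-NOT gate with control `c` and target `t`: it maps the basis vector `b` to the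
basis vector with `b t` replaced by `b t + b c` (addition modulo 2). -/
def cnot {n : ℕ} (c t : Fin n) : Op n :=
  Matrix.of fun a b => if a = Function.update b t (b t + b c) then 1 else 0

/-- Elementary Clifford gates; the circuits composed of them are the Clifford circuits. -/
inductive CliffordGate (n : ℕ) : Type
  | H (q : Fin n) : CliffordGate n
  | S (q : Fin n) : CliffordGate n
  | CNOT (c t : Fin n) (hct : c ≠ t) : CliffordGate n

/-- The unitary matrix of an elementary Clifford gate. -/
def CliffordGate.toOp {n : ℕ} : CliffordGate n → Op n
  | .H q => onQubit q hadamard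
  | .S q => onQubit q phase
  | .CNOT c t _ => cnot c t

/-- `ρ ↦ A ρ A†`. -/
def conj {n : ℕ} (A ρ : Op n) : Op n := A * ρ * A.conjTranspose

/-- A noiseless Clifford circuit (first gate first) acting on a density matrix. -/
def runClifford {n : ℕ} (B : List (CliffordGate n)) (ρ : Op n) : Op n :=
  B.foldl (fun σ g => conj g.toOp σ) ρ

/-! ### The noise -/

/-- The single Pauli error `ρ ↦ (1 - e) ρ + e σ ρ σ†` on qubit `q`. -/
def pauliError {n : ℕ} (e : ℝ) (σ : Matrix (Fin 2) (Fin 2) ℂ) (q : Fin n) (ρ : Op n) : Op n :=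
  ((1 - e : ℝ) : ℂ) • ρ + (e : ℂ) • conj (onQubit q σ) ρ

/-- The noise channel `ℰ₃ ∘ ℰ₂ ∘ ℰ₁` with `σ₁ = Z`, `σ₂ = X`, `σ₃ = Y`. The rates are
`e 0`, `e 1`, `e 2`. -/
def noise {n : ℕ} (e : Fin 3 → ℝ) (q : Fin n) (ρ : Op n) : Op n :=
  pauliError (e 2) pauliY q (pauliError (e 1) pauliX q (pauliError (e 0) pauliZ q ρ))

/-- The second largest of three numbers. -/
def secondLargest (e : Fin 3 → ℝ) : ℝ :=
  max (min (e 0) (e 1)) (max (min (e 0) (e 2)) (min (e 1) (e 2)))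

/-! ### The circuit ensemble -/

/-- A noisy gate: an arbitrary single-qubit unitary on one qubit, which has a random Pauli followed
by the noise next to it, either immediately before the unitary (`pauliFirst = true`) or
immediately after it. -/
structure NoisyGate (n : ℕ) where
  qubit : Fin n
  U : Matrix.unitaryGroup (Fin 2) ℂ
  pauliFirst : Bool

/-- A circuit on `n` qubits with `m` noisy gates, separated by blocks of noiseless Clifford gates.
It describes an ensemble; its members are obtained by choosing the `m` Pauli operators. -/
structure Circuit (n m : ℕ) where
  block : Fin (m + 1) → List (CliffordGate n)
  gate : Fin m → NoisyGate n

/-- The number of noiseless Clifford gates. -/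
def Circuit.numClifford {n m : ℕ} (C : Circuit n m) : ℕ := ∑ k, (C.block k).length

/-- A choice `(y₁, y₂)` of the Pauli operator `X ^ y₂ Z ^ y₁` at each of the `m` noisy gates. -/
abbrev PauliChoice (m : ℕ) : Type := Fin m → Fin 2 × Fin 2

/-- The Pauli operator `X ^ y₂ Z ^ y₁`. -/
def pauliXZ (y : Fin 2 × Fin 2) : Matrix (Fin 2) (Fin 2) ℂ :=
  pauliX ^ (y.2 : ℕ) * pauliZ ^ (y.1 : ℕ)

/-- The action of a noisy gate, for a given choice of its Pauli operator. -/
def NoisyGate.apply {n : ℕ} (g : NoisyGate n) (e : Fin 3 → ℝ) (y : Fin 2 × Fin 2) (ρ : Op n) :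
    Op n :=
  if g.pauliFirst then
    conj (onQubit g.qubit g.U.1) (noise e g.qubit (conj (onQubit g.qubit (pauliXZ y)) ρ))
  else
    noise e g.qubit (conj (onQubit g.qubit (pauliXZ y)) (conj (onQubit g.qubit g.U.1) ρ))

/-- The initial state `|0⟩⟨0|` of all qubits. -/
def zeroState (n : ℕ) : Op n := Matrix.diagonal fun b => if b = 0 then 1 else 0

/-- The state right after block number `k` of Clifford gates. -/
def Circuit.stateAfter {n m : ℕ} (C : Circuit n m) (e : Fin 3 → ℝ) (y : PauliChoice m) :
    Fin (m + 1) → Op n :=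
  Fin.induction (runClifford (C.block 0) (zeroState n))
    fun k ρ => runClifford (C.block k.succ) ((C.gate k).apply e (y k) ρ)

/-- The projector onto the outcome `x` of measuring the qubits `μ 0, μ 1, …, μ (r - 1)` in the
computational basis. -/
def outcomeProjector {n r : ℕ} (μ : Fin r ↪ Fin n) (x : Basis r) : Op n :=
  Matrix.diagonal fun b => if ∀ j, b (μ j) = x j then 1 else 0

/-- The probability of the outcome `x` when the qubits `μ` of the output state of the member `y` of
the ensemble are measured. -/
def Circuit.outputProb {n m r : ℕ} (C : Circuit n m) (e : Fin 3 → ℝ) (y : PauliChoice m)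
    (μ : Fin r ↪ Fin n) (x : Basis r) : ℝ :=
  (Matrix.trace (C.stateAfter e y (Fin.last m) * outcomeProjector μ x)).re

/-! ### Classical algorithms

Programs for a random access machine. It has registers and an indirectly addressed memory for
natural numbers (with addition and truncated subtraction), and registers and an indirectly
addressed memory for real numbers (with ring operations and rational constants). Control flow
depends on natural numbers only. Every instruction and every test costs one step. -/

structure State where
  reg : ℕ → ℕ
  mem : ℕ → ℕ
  rreg : ℕ → ℝ
  rmem : ℕ → ℝ

inductive Instr : Type
  | const (a c : ℕ) : Instr
  | add (a b c : ℕ) : Instr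
  | sub (a b c : ℕ) : Instr
  | load (a b : ℕ) : Instr
  | store (a b : ℕ) : Instr
  | rconst (a : ℕ) (q : ℚ) : Instr
  | radd (a b c : ℕ) : Instr
  | rsub (a b c : ℕ) : Instr
  | rmul (a b c : ℕ) : Instr
  | rload (a b : ℕ) : Instr
  | rstore (a b : ℕ) : Instr

/-- The effect of one instruction. -/
def Instr.exec : Instr → State → State
  | .const a c, s => { s with reg := Function.update s.reg a c }
  | .add a b c, s => { s with reg := Function.update s.reg a (s.reg b + s.reg c) }
  | .sub a b c, s => { s with reg := Function.update s.reg a (s.reg b - s.reg c) }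
  | .load a b, s => { s with reg := Function.update s.reg a (s.mem (s.reg b)) }
  | .store a b, s => { s with mem := Function.update s.mem (s.reg a) (s.reg b) }
  | .rconst a q, s => { s with rreg := Function.update s.rreg a (q : ℝ) }
  | .radd a b c, s => { s with rreg := Function.update s.rreg a (s.rreg b + s.rreg c) }
  | .rsub a b c, s => { s with rreg := Function.update s.rreg a (s.rreg b - s.rreg c) }
  | .rmul a b c, s => { s with rreg := Function.update s.rreg a (s.rreg b * s.rreg c) }
  | .rload a b, s => { s with rreg := Function.update s.rreg a (s.rmem (s.reg b)) }
  | .rstore a b, s => { s with rmem := Function.update s.rmem (s.reg a) (s.rreg b) }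

inductive Program : Type
  | skip : Program
  | instr (i : Instr) : Program
  | seq (P Q : Program) : Program
  /-- run `P` if register `a` is nonzero, and `Q` otherwise -/
  | cond (a : ℕ) (P Q : Program) : Program
  /-- run `P` as long as register `a` is nonzero -/
  | loop (a : ℕ) (P : Program) : Program

/-- `Runs P s s' t`: started in state `s`, the program `P` halts in state `s'` after `t` steps. -/
inductive Runs : Program → State → State → ℕ → Prop
  | skip (s : State) : Runs .skip s s 1
  | instr (i : Instr) (s : State) : Runs (.instr i) s (i.exec s) 1
  | seq {P Q : Program} {s s₁ s₂ : State} {t₁ t₂ : ℕ} :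
      Runs P s s₁ t₁ → Runs Q s₁ s₂ t₂ → Runs (.seq P Q) s s₂ (t₁ + t₂)
  | cond_true {a : ℕ} {P Q : Program} {s s' : State} {t : ℕ} :
      s.reg a ≠ 0 → Runs P s s' t → Runs (.cond a P Q) s s' (t + 1)
  | cond_false {a : ℕ} {P Q : Program} {s s' : State} {t : ℕ} :
      s.reg a = 0 → Runs Q s s' t → Runs (.cond a P Q) s s' (t + 1)
  | loop_stop {a : ℕ} {P : Program} {s : State} :
      s.reg a = 0 → Runs (.loop a P) s s 1
  | loop_step {a : ℕ} {P : Program} {s s₁ s₂ : State} {t₁ t₂ : ℕ} :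
      s.reg a ≠ 0 → Runs P s s₁ t₁ → Runs (.loop a P) s₁ s₂ t₂ →
        Runs (.loop a P) s s₂ (t₁ + t₂ + 1)

/-! ### The input of the algorithm -/

/-- Every gate is encoded by four natural numbers. -/
def CliffordGate.encode {n : ℕ} : CliffordGate n → List ℕ
  | .H q => [0, q, 0, 0]
  | .S q => [1, q, 0, 0]
  | .CNOT c t _ => [2, c, t, 0]

def NoisyGate.encode {n : ℕ} (g : NoisyGate n) (y : Fin 2 × Fin 2) : List ℕ :=
  [if g.pauliFirst then 3 else 4, g.qubit, y.1, y.2]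

/-- The discrete part of the description of a member of the ensemble: all gates in order. -/
def Circuit.encode {n m : ℕ} (C : Circuit n m) (y : PauliChoice m) : List ℕ :=
  (C.block 0).flatMap CliffordGate.encode ++
    (List.finRange m).flatMap fun k =>
      (C.gate k).encode (y k) ++ (C.block k.succ).flatMap CliffordGate.encode

/-- The eight real numbers that describe the unitary matrix of a noisy gate. -/
def NoisyGate.encodeReal {n : ℕ} (g : NoisyGate n) : List ℝ :=
  [(g.U.1 0 0).re, (g.U.1 0 0).im, (g.U.1 0 1).re, (g.U.1 0 1).im,
   (g.U.1 1 0).re, (g.U.1 1 0).im, (g.U.1 1 1).re, (g.U.1 1 1).im]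

/-- The real part of the input: the noise rates and the unitary matrices. -/
def Circuit.encodeReal {n m : ℕ} (C : Circuit n m) (e : Fin 3 → ℝ) : List ℝ :=
  [e 0, e 1, e 2] ++ (List.finRange m).flatMap fun k => (C.gate k).encodeReal

/-- The initial state of the machine: the memories hold the sizes, the measured qubits with the
outcome whose probability is asked for, the gates of the circuit, the noise rates and the
unitary matrices; everything else is zero. -/
def inputState {n m r : ℕ} (C : Circuit n m) (e : Fin 3 → ℝ) (y : PauliChoice m)
    (μ : Fin r ↪ Fin n) (x : Basis r) : State where
  reg := fun _ => 0
  mem := fun i =>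
    ([n, m, C.numClifford, r] ++
      ((List.finRange r).flatMap fun j => [(μ j : ℕ), (x j : ℕ)]) ++ C.encode y).getD i 0
  rreg := fun _ => 0
  rmem := fun i => (C.encodeReal e).getD i 0

/-- On every input that belongs to the circuit `C` with noise rates `e` and measured qubits `μ`, the
program `P` halts after at most `T` steps. Its answer, for the member `y` of the ensemble and
the outcome `x`, is `out y x`; it is left in real register `0`. -/
def Computes {n m r : ℕ} (P : Program) (C : Circuit n m) (e : Fin 3 → ℝ) (μ : Fin r ↪ Fin n)
    (out : PauliChoice m → Basis r → ℝ) (T : ℕ) : Prop :=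
  ∀ y x, ∃ (s : State) (t : ℕ),
    Runs P (inputState C e y μ x) s t ∧ t ≤ T ∧ s.rreg 0 = out y x

/-- The exponent `ln (2 ^ r δ⁻¹ (1 + √(η⁻¹))) / (2 ε)`, rounded up to a natural number. -/
def truncationOrder (r : ℕ) (ε δ η : ℝ) : ℕ :=
  ⌈Real.log (2 ^ r * δ⁻¹ * (1 + Real.sqrt η⁻¹)) / (2 * ε)⌉₊

end

end NoisyClifford

open NoisyClifford

/-! The outcome projector is carried backwards through the circuit (Heisenberg picture). At a noisy
gate the operators split into four components, according to the Pauli operator that the randomized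
qubit carries. The random Pauli `y` multiplies the component `s` by the character `sign s y` of
(ℤ/2)², and the noise multiplies it by the eigenvalue `noiseEig e s` (`noise_pconj`). So an output
probability is a sum over one choice of component per noisy gate. A nontrivial Pauli anticommutes
with two of the three errors, and the larger of their rates is at least ε, so each nontrivial
component costs a factor of at most 1 - 2ε (`noiseEig_le`). The algorithm keeps the choices with at
most l - 1 nontrivial components (`Circuit.trunc`); its error is the sum over the others
(`Circuit.tail`).

Error: distinct characters are orthogonal, so no cross terms survive the average over the ensemble
(`sum_sq_sum_sign_apply`). Hence the mean square of the tail is at most (1 - 2ε)^(2l) times the mean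
square of the full sum without noise (`Circuit.sum_sq_tail_le`). The latter is a true outcome
probability, and the squares of the outcome probabilities sum to at most 1. Cauchy–Schwarz over the
2^r outcomes bounds the mean square of the ℓ¹ error by 2^r (1 - 2ε)^(2l)
(`Circuit.sum_sq_error_le`). This is at most δ²η by the choice of l (`error_le`), and Chebyshev's
inequality (`card_le_of_sum_sq_le`) concludes.

Cost: the projector is a combination of 2^r strings of Pauli operators (`outcomeProjector_eq_sum`).
A Clifford gate maps a string to a signed string; a unitary fixes the identity and mixes the three
nontrivial Paulis among themselves. A path is thus determined by its Fourier mode and the list of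
the new Paulis at the noisy gates that it meets nontrivially. Which gates these are need not be
guessed, because it shows on the way. So fewer than 3^l lists suffice, whatever m is
(`Circuit.sum_value_runConfig`). As ε ≤ 1/2, also 2^r ≤ exp (2εl) ≤ 3^l. Up to a constant, all paths
together take time 9^l (l + 1) m (n + g + 1), which fits into (n + g + 1) (8m)^l if m ≥ 2; for m = 1
paths with one digit are enough. This keeps the polynomial independent of r, ε, δ and η.

Since r and l are constants, the paths are hard-wired in the program; loops run over qubits and
gates only. The program is written in a small language with a verified compiler
(`Stmt.compile_runs`), and its loops are treated by Hoare triples with time bounds (`Triple`,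
`triple_path`, `mainProgram_computes`). -/

namespace NoisyClifford
noncomputable section

/-! ### A small language that compiles to the random access machine -/

/-- Natural-number expressions: constants, variables, memory cells. -/
inductive NExpr : Type
  | c (k : ℕ) : NExpr
  | v (a : ℕ) : NExpr
  | add (d e : NExpr) : NExpr
  | sub (d e : NExpr) : NExpr
  | ld (e : NExpr) : NExpr

/-- Real expressions. -/
inductive RExpr : Type
  | c (q : ℚ) : RExpr
  | v (a : ℕ) : RExpr
  | add (d e : RExpr) : RExpr
  | sub (d e : RExpr) : RExpr
  | mul (d e : RExpr) : RExpr
  | ld (e : NExpr) : RExpr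

/-- Loop-free statements. -/
inductive Stmt : Type
  | skip : Stmt
  | nset (a : ℕ) (e : NExpr) : Stmt
  | rset (a : ℕ) (e : RExpr) : Stmt
  | st (d e : NExpr) : Stmt
  | seq (P Q : Stmt) : Stmt
  | ite (e : NExpr) (P Q : Stmt) : Stmt

@[simp] def NExpr.eval (s : State) : NExpr → ℕ
  | .c k => k
  | .v a => s.reg a
  | .add d e => d.eval s + e.eval s
  | .sub d e => d.eval s - e.eval s
  | .ld e => s.mem (e.eval s)

@[simp] def RExpr.eval (s : State) : RExpr → ℝ
  | .c q => q
  | .v a => s.rreg a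
  | .add d e => d.eval s + e.eval s
  | .sub d e => d.eval s - e.eval s
  | .mul d e => d.eval s * e.eval s
  | .ld e => s.rmem (e.eval s)

def Stmt.sem : Stmt → State → State
  | .skip, s => s
  | .nset a e, s => { s with reg := Function.update s.reg a (e.eval s) }
  | .rset a e, s => { s with rreg := Function.update s.rreg a (e.eval s) }
  | .st d e, s => { s with mem := Function.update s.mem (d.eval s) (e.eval s) }
  | .seq P Q, s => Q.sem (P.sem s)
  | .ite e P Q, s => if e.eval s ≠ 0 then P.sem s else Q.sem s

/-- The code of an expression leaves its value in the odd register `2 * k + 1`; odd registers below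
that one and the even registers, which hold the variables, are kept. -/
def NExpr.compile : NExpr → ℕ → Program
  | .c j, k => .instr (.const (2 * k + 1) j)
  | .v a, k => .seq (.instr (.const (2 * k + 1) 0)) (.instr (.add (2 * k + 1) (2 * k + 1) (2 * a)))
  | .add d e, k => .seq (d.compile k) (.seq (e.compile (k + 1))
      (.instr (.add (2 * k + 1) (2 * k + 1) (2 * (k + 1) + 1))))
  | .sub d e, k => .seq (d.compile k) (.seq (e.compile (k + 1))
      (.instr (.sub (2 * k + 1) (2 * k + 1) (2 * (k + 1) + 1))))
  | .ld e, k => .seq (e.compile k) (.instr (.load (2 * k + 1) (2 * k + 1)))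

def NExpr.cost : NExpr → ℕ
  | .c _ => 1
  | .v _ => 2
  | .add d e => d.cost + e.cost + 1
  | .sub d e => d.cost + e.cost + 1
  | .ld e => e.cost + 1

def RExpr.compile : RExpr → ℕ → Program
  | .c q, k => .instr (.rconst (2 * k + 1) q)
  | .v a, k =>
      .seq (.instr (.rconst (2 * k + 1) 0)) (.instr (.radd (2 * k + 1) (2 * k + 1) (2 * a)))
  | .add d e, k => .seq (d.compile k) (.seq (e.compile (k + 1))
      (.instr (.radd (2 * k + 1) (2 * k + 1) (2 * (k + 1) + 1))))
  | .sub d e, k => .seq (d.compile k) (.seq (e.compile (k + 1))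
      (.instr (.rsub (2 * k + 1) (2 * k + 1) (2 * (k + 1) + 1))))
  | .mul d e, k => .seq (d.compile k) (.seq (e.compile (k + 1))
      (.instr (.rmul (2 * k + 1) (2 * k + 1) (2 * (k + 1) + 1))))
  -- Slot `0` is free for the address: a real expression keeps its own intermediate values in real
  -- registers.
  | .ld e, k => .seq (e.compile 0) (.instr (.rload (2 * k + 1) 1))

def RExpr.cost : RExpr → ℕ
  | .c _ => 1
  | .v _ => 2
  | .add d e => d.cost + e.cost + 1
  | .sub d e => d.cost + e.cost + 1
  | .mul d e => d.cost + e.cost + 1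
  | .ld e => e.cost + 1

/-- The machine has no copy instruction. An assignment adds a zero, put into register `3`, to the
value in register `1`. -/
def Stmt.compile : Stmt → Program
  | .skip => .skip
  | .nset a e => .seq (e.compile 0)
      (.seq (.instr (.const 3 0)) (.instr (.add (2 * a) 1 3)))
  | .rset a e => .seq (e.compile 0)
      (.seq (.instr (.rconst 3 0)) (.instr (.radd (2 * a) 1 3)))
  | .st d e => .seq (d.compile 0) (.seq (e.compile 1) (.instr (.store 1 3)))
  | .seq P Q => .seq P.compile Q.compile
  | .ite e P Q => .seq (e.compile 0) (.cond 1 P.compile Q.compile)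

/-- An upper bound only: a conditional is charged for both branches. -/
def Stmt.cost : Stmt → ℕ
  | .skip => 1
  | .nset _ e => e.cost + 2
  | .rset _ e => e.cost + 2
  | .st d e => d.cost + e.cost + 1
  | .seq P Q => P.cost + Q.cost
  | .ite e P Q => e.cost + (P.cost + Q.cost) + 1

/-- The part of a state that the variables of the small language see. -/
def State.view (s : State) : State where
  reg := fun a => s.reg (2 * a)
  mem := s.mem
  rreg := fun a => s.rreg (2 * a)
  rmem := s.rmem

/-- The right operand is compiled one slot higher, and code for slot `k + 1` keeps all lower odd
registers, so the left operand survives in slot `k`. The even registers are kept, so both operands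
are evaluated in the same view. -/
theorem NExpr.compile_runs (e : NExpr) : ∀ (k : ℕ) (s : State), ∃ ρ : ℕ → ℕ,
    Runs (e.compile k) s { s with reg := ρ } e.cost ∧ (∀ a, ρ (2 * a) = s.reg (2 * a)) ∧
      (∀ j < k, ρ (2 * j + 1) = s.reg (2 * j + 1)) ∧ ρ (2 * k + 1) = e.eval s.view := by
  have hbin : ∀ (d e : NExpr) (i : Instr) (f : ℕ → ℕ → ℕ) (k : ℕ)
      (_ : ∀ s : State, i.exec s =
        { s with reg := (Function.update s.reg (2 * k + 1)
          (f (s.reg (2 * k + 1)) (s.reg (2 * (k + 1) + 1)))) })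
      (_ : ∀ (k : ℕ) (s : State), ∃ ρ : ℕ → ℕ,
        Runs (d.compile k) s { s with reg := ρ } d.cost ∧ (∀ a, ρ (2 * a) = s.reg (2 * a)) ∧
        (∀ j < k, ρ (2 * j + 1) = s.reg (2 * j + 1)) ∧ ρ (2 * k + 1) = d.eval s.view)
      (_ : ∀ (k : ℕ) (s : State), ∃ ρ : ℕ → ℕ,
        Runs (e.compile k) s { s with reg := ρ } e.cost ∧ (∀ a, ρ (2 * a) = s.reg (2 * a)) ∧
        (∀ j < k, ρ (2 * j + 1) = s.reg (2 * j + 1)) ∧ ρ (2 * k + 1) = e.eval s.view)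
      (s : State), ∃ ρ : ℕ → ℕ,
        Runs (.seq (d.compile k) (.seq (e.compile (k + 1)) (.instr i))) s { s with reg := ρ }
          (d.cost + e.cost + 1) ∧ (∀ a, ρ (2 * a) = s.reg (2 * a)) ∧
        (∀ j < k, ρ (2 * j + 1) = s.reg (2 * j + 1)) ∧
          ρ (2 * k + 1) = f (d.eval s.view) (e.eval s.view) := by
    intro d e i f k hi hd he s
    obtain ⟨ρ, h1, h2, h3, h4⟩ := hd k s
    obtain ⟨τ, g1, g2, g3, g4⟩ := he (k + 1) { s with reg := ρ }
    have hv : State.view { s with reg := ρ } = s.view := by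
      simp only [State.view, h2]
    refine ⟨Function.update τ (2 * k + 1) (f (τ (2 * k + 1)) (τ (2 * (k + 1) + 1))), ?_, ?_, ?_, ?_⟩
    · rw [add_assoc]
      refine Runs.seq h1 (Runs.seq g1 ?_)
      have := Runs.instr i { s with reg := τ }
      rw [hi] at this
      exact this
    · intro a
      rw [Function.update_of_ne (by omega), g2]
      exact h2 a
    · intro j hj
      rw [Function.update_of_ne (by omega), g3 j (by omega)]
      exact h3 j hj
    · rw [Function.update_self, g4, g3 k (by omega), hv]
      simp [h4]
  induction e with
  | c j =>
    intro k s
    refine ⟨Function.update s.reg (2 * k + 1) j, Runs.instr _ s, ?_, ?_, ?_⟩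
    · intro a; rw [Function.update_of_ne (by omega)]
    · intro i hi; rw [Function.update_of_ne (by omega)]
    · simp
  | v a =>
    intro k s
    refine ⟨_, Runs.seq (Runs.instr _ s) (Runs.instr _ _), ?_, ?_, ?_⟩
    · intro b
      simp only [Instr.exec]
      rw [Function.update_of_ne (by omega), Function.update_of_ne (by omega)]
    · intro i hi
      simp only [Instr.exec]
      rw [Function.update_of_ne (by omega), Function.update_of_ne (by omega)]
    · simp only [Instr.exec, Function.update_self, NExpr.eval, State.view, zero_add]
      rw [Function.update_of_ne (by omega)]
  | add d e hd he => exact fun k => hbin d e _ (· + ·) k (fun _ => rfl) hd he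
  | sub d e hd he => exact fun k => hbin d e _ (· - ·) k (fun _ => rfl) hd he
  | ld e he =>
    intro k s
    obtain ⟨ρ, h1, h2, h3, h4⟩ := he k s
    refine ⟨_, Runs.seq h1 (Runs.instr _ _), ?_, ?_, ?_⟩
    · intro a
      simp only
      rw [Function.update_of_ne (by omega), h2]
    · intro j hj
      simp only
      rw [Function.update_of_ne (by omega), h3 j hj]
    · simp [h4, State.view]

theorem RExpr.compile_runs (e : RExpr) : ∀ (k : ℕ) (s : State), ∃ (ρ : ℕ → ℕ) (θ : ℕ → ℝ),
    Runs (e.compile k) s { s with reg := ρ, rreg := θ } e.cost ∧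
      (∀ a, ρ (2 * a) = s.reg (2 * a)) ∧ (∀ a, θ (2 * a) = s.rreg (2 * a)) ∧
      (∀ j < k, θ (2 * j + 1) = s.rreg (2 * j + 1)) ∧ θ (2 * k + 1) = e.eval s.view := by
  have hbin : ∀ (d e : RExpr) (i : Instr) (f : ℝ → ℝ → ℝ) (k : ℕ)
      (_ : ∀ s : State, i.exec s =
        { s with rreg := (Function.update s.rreg (2 * k + 1)
          (f (s.rreg (2 * k + 1)) (s.rreg (2 * (k + 1) + 1)))) })
      (_ : ∀ (k : ℕ) (s : State), ∃ (ρ : ℕ → ℕ) (θ : ℕ → ℝ),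
        Runs (d.compile k) s { s with reg := ρ, rreg := θ } d.cost ∧
        (∀ a, ρ (2 * a) = s.reg (2 * a)) ∧ (∀ a, θ (2 * a) = s.rreg (2 * a)) ∧
        (∀ j < k, θ (2 * j + 1) = s.rreg (2 * j + 1)) ∧ θ (2 * k + 1) = d.eval s.view)
      (_ : ∀ (k : ℕ) (s : State), ∃ (ρ : ℕ → ℕ) (θ : ℕ → ℝ),
        Runs (e.compile k) s { s with reg := ρ, rreg := θ } e.cost ∧
        (∀ a, ρ (2 * a) = s.reg (2 * a)) ∧ (∀ a, θ (2 * a) = s.rreg (2 * a)) ∧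
        (∀ j < k, θ (2 * j + 1) = s.rreg (2 * j + 1)) ∧ θ (2 * k + 1) = e.eval s.view)
      (s : State), ∃ (ρ : ℕ → ℕ) (θ : ℕ → ℝ),
        Runs (.seq (d.compile k) (.seq (e.compile (k + 1)) (.instr i))) s
          { s with reg := ρ, rreg := θ } (d.cost + e.cost + 1) ∧
        (∀ a, ρ (2 * a) = s.reg (2 * a)) ∧ (∀ a, θ (2 * a) = s.rreg (2 * a)) ∧
        (∀ j < k, θ (2 * j + 1) = s.rreg (2 * j + 1)) ∧
          θ (2 * k + 1) = f (d.eval s.view) (e.eval s.view) := by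
    intro d e i f k hi hd he s
    obtain ⟨ρ, θ, h1, h0, h2, h3, h4⟩ := hd k s
    obtain ⟨ρ', τ, g1, g0, g2, g3, g4⟩ := he (k + 1) { s with reg := ρ, rreg := θ }
    have hv : State.view { s with reg := ρ, rreg := θ } = s.view := by
      simp only [State.view, h0, h2]
    refine ⟨ρ', Function.update τ (2 * k + 1) (f (τ (2 * k + 1)) (τ (2 * (k + 1) + 1))),
      ?_, ?_, ?_, ?_, ?_⟩
    · rw [add_assoc]
      refine Runs.seq h1 (Runs.seq g1 ?_)
      have := Runs.instr i { s with reg := ρ', rreg := τ }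
      rw [hi] at this
      exact this
    · intro a
      rw [g0]
      exact h0 a
    · intro a
      rw [Function.update_of_ne (by omega), g2]
      exact h2 a
    · intro j hj
      rw [Function.update_of_ne (by omega), g3 j (by omega)]
      exact h3 j hj
    · rw [Function.update_self, g4, g3 k (by omega), hv]
      simp [h4]
  induction e with
  | c j =>
    intro k s
    refine ⟨s.reg, Function.update s.rreg (2 * k + 1) j, Runs.instr _ s, fun _ => rfl, ?_, ?_, ?_⟩
    · intro a; rw [Function.update_of_ne (by omega)]
    · intro i hi; rw [Function.update_of_ne (by omega)]
    · simp
  | v a =>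
    intro k s
    refine ⟨s.reg, _, Runs.seq (Runs.instr _ s) (Runs.instr _ _), fun _ => rfl, ?_, ?_, ?_⟩
    · intro b
      simp only [Instr.exec]
      rw [Function.update_of_ne (by omega), Function.update_of_ne (by omega)]
    · intro i hi
      simp only [Instr.exec]
      rw [Function.update_of_ne (by omega), Function.update_of_ne (by omega)]
    · simp only [Instr.exec, Function.update_self, RExpr.eval, State.view, Rat.cast_zero, zero_add]
      rw [Function.update_of_ne (by omega)]
  | add d e hd he => exact fun k => hbin d e _ (· + ·) k (fun _ => rfl) hd he
  | sub d e hd he => exact fun k => hbin d e _ (· - ·) k (fun _ => rfl) hd he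
  | mul d e hd he => exact fun k => hbin d e _ (· * ·) k (fun _ => rfl) hd he
  | ld e =>
    intro k s
    obtain ⟨ρ, h1, h2, h3, h4⟩ := e.compile_runs 0 s
    refine ⟨_, _, Runs.seq h1 (Runs.instr _ _), ?_, ?_, ?_, ?_⟩
    · exact h2
    · intro a
      simp only
      rw [Function.update_of_ne (by omega)]
    · intro j hj
      simp only
      rw [Function.update_of_ne (by omega)]
    · simp only [mul_zero, zero_add] at h4
      simp [h4, State.view]

theorem Stmt.compile_runs (P : Stmt) : ∀ s : State, ∃ (s' : State) (t : ℕ),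
    Runs P.compile s s' t ∧ t ≤ P.cost ∧ s'.view = P.sem s.view := by
  induction P with
  | skip => exact fun s => ⟨s, 1, Runs.skip s, le_rfl, rfl⟩
  | nset a e =>
    intro s
    obtain ⟨ρ, h1, h2, h3, h4⟩ := e.compile_runs 0 s
    refine ⟨_, _, Runs.seq h1 (Runs.seq (Runs.instr _ _) (Runs.instr _ _)), le_rfl, ?_⟩
    simp only [Instr.exec, State.view, Stmt.sem, State.mk.injEq, and_true]
    funext b
    by_cases hb : b = a
    · subst hb
      simp only [mul_zero, zero_add] at h4
      rw [Function.update_self, Function.update_self, Function.update_self,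
        Function.update_of_ne (by omega), h4]
      rfl
    · rw [Function.update_of_ne (by omega), Function.update_of_ne (by omega),
        Function.update_of_ne hb, h2]
  | rset a e =>
    intro s
    obtain ⟨ρ, θ, h1, h0, h2, h3, h4⟩ := e.compile_runs 0 s
    refine ⟨_, _, Runs.seq h1 (Runs.seq (Runs.instr _ _) (Runs.instr _ _)), le_rfl, ?_⟩
    simp only [Instr.exec, State.view, Stmt.sem, State.mk.injEq, and_true, true_and]
    refine ⟨funext h0, ?_⟩
    funext b
    by_cases hb : b = a
    · subst hb
      simp only [mul_zero, zero_add] at h4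
      rw [Function.update_self, Function.update_self, Function.update_self,
        Function.update_of_ne (by omega), h4, Rat.cast_zero, add_zero]
      rfl
    · rw [Function.update_of_ne (by omega), Function.update_of_ne (by omega),
        Function.update_of_ne hb, h2]
  | st d e =>
    intro s
    obtain ⟨ρ, h1, h2, h3, h4⟩ := d.compile_runs 0 s
    obtain ⟨τ, g1, g2, g3, g4⟩ := e.compile_runs 1 { s with reg := ρ }
    refine ⟨_, _, Runs.seq h1 (Runs.seq g1 (Runs.instr _ _)), (add_assoc _ _ _).ge, ?_⟩
    have hv : State.view { s with reg := ρ } = s.view := by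
      simp only [State.view, h2]
    have h5 := g3 0 (by omega)
    simp only [mul_zero, zero_add, mul_one] at h4 g4 h5
    simp only [Instr.exec]
    rw [g4, hv, h5, h4]
    simp only [State.view, Stmt.sem, g2, h2]
  | seq P Q hP hQ =>
    intro s
    obtain ⟨s₁, t₁, h1, h2, h3⟩ := hP s
    obtain ⟨s₂, t₂, g1, g2, g3⟩ := hQ s₁
    exact ⟨s₂, _, Runs.seq h1 g1, add_le_add h2 g2, by rw [g3, h3]; rfl⟩
  | ite e P Q hP hQ =>
    intro s
    obtain ⟨ρ, h1, h2, h3, h4⟩ := e.compile_runs 0 s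
    have hv : State.view { s with reg := ρ } = s.view := by
      simp only [State.view, h2]
    simp only [mul_zero, zero_add] at h4
    by_cases h : e.eval s.view = 0
    · obtain ⟨s₁, t₁, g1, g2, g3⟩ := hQ { s with reg := ρ }
      refine ⟨s₁, _, Runs.seq h1 (Runs.cond_false (h4.trans h) g1), ?_, ?_⟩
      · simp only [Stmt.cost]; omega
      · rw [g3, hv, Stmt.sem, if_neg (not_not.2 h)]
    · obtain ⟨s₁, t₁, g1, g2, g3⟩ := hP { s with reg := ρ }
      refine ⟨s₁, _, Runs.seq h1 (Runs.cond_true (by rw [← h4] at h; exact h) g1), ?_, ?_⟩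
      · simp only [Stmt.cost]; omega
      · rw [g3, hv, Stmt.sem, if_pos h]

/-! ### Hoare triples with time bounds -/

/-- Started in a state whose variables satisfy `A`, the program halts within `K` steps in a state
whose variables satisfy `B`. -/
def Triple (A : State → Prop) (P : Program) (B : State → Prop) (K : ℕ) : Prop :=
  ∀ s : State, A s.view → ∃ (s' : State) (t : ℕ), Runs P s s' t ∧ t ≤ K ∧ B s'.view

theorem Triple.stmt {A B : State → Prop} {P : Stmt} (h : ∀ s, A s → B (P.sem s)) :
    Triple A P.compile B P.cost := by
  intro s hs
  obtain ⟨s', t, h1, h2, h3⟩ := P.compile_runs s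
  exact ⟨s', t, h1, h2, h3 ▸ h _ hs⟩

theorem Triple.seq {A B D : State → Prop} {P Q : Program} {K L : ℕ} (h : Triple A P B K)
    (h' : Triple B Q D L) : Triple A (.seq P Q) D (K + L) := by
  intro s hs
  obtain ⟨s₁, t₁, h1, h2, h3⟩ := h s hs
  obtain ⟨s₂, t₂, g1, g2, g3⟩ := h' s₁ h3
  exact ⟨s₂, _, Runs.seq h1 g1, add_le_add h2 g2, g3⟩

theorem Triple.mono {A A' B B' : State → Prop} {P : Program} {K K' : ℕ} (h : Triple A P B K)
    (hA : ∀ s, A' s → A s) (hB : ∀ s, B s → B' s) (hK : K ≤ K') : Triple A' P B' K' := by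
  intro s hs
  obtain ⟨s', t, h1, h2, h3⟩ := h s (hA _ hs)
  exact ⟨s', t, h1, h2.trans hK, hB _ h3⟩

/-- Variable `a` counts the iterations of the loop down to zero. -/
theorem Triple.loop {I : ℕ → State → Prop} {a : ℕ} {P : Program} {K : ℕ}
    (hcount : ∀ j s, I j s → s.reg a = j)
    (hstep : ∀ j, Triple (I (j + 1)) P (I j) K) (j : ℕ) :
    Triple (I j) (.loop (2 * a) P) (I 0) (j * (K + 1) + 1) := by
  induction j with
  | zero =>
    intro s hs
    exact ⟨s, 1, Runs.loop_stop (hcount 0 _ hs), by omega, hs⟩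
  | succ j ih =>
    intro s hs
    obtain ⟨s₁, t₁, h1, h2, h3⟩ := hstep j s hs
    obtain ⟨s₂, t₂, g1, g2, g3⟩ := ih s₁ h3
    refine ⟨s₂, _, Runs.loop_step ?_ h1 g1, ?_, g3⟩
    · have := hcount _ _ hs
      simp only [State.view] at this
      omega
    · have : (j + 1) * (K + 1) + 1 = j * (K + 1) + 1 + (K + 1) := by ring
      omega

def Program.seqList : List Program → Program
  | [] => .skip
  | P :: l => .seq P (seqList l)

/-- Running one program for each element of a list. -/
theorem Triple.seqList {α : Type*} {f : α → Program} {K : ℕ} {I : List α → State → Prop}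
    (l : List α) (h : ∀ x ∈ l, ∀ d, Triple (I (x :: d)) (f x) (I d) K) :
    Triple (I l) (.seqList (l.map f)) (I []) (l.length * K + 1) := by
  induction l with
  | nil => exact fun s hs => ⟨s, 1, Runs.skip s, by omega, hs⟩
  | cons x l ih =>
    refine Triple.mono (Triple.seq (h x (by simp) l)
      (ih fun z hz => h z (by simp [hz]))) (fun _ h => h) (fun _ h => h) ?_
    rw [List.length_cons]
    have : (l.length + 1) * K + 1 = K + (l.length * K + 1) := by ring
    omega

/-- In contrast to `Stmt.ite`, the branches are arbitrary programs and may contain loops. -/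
theorem Triple.ite {A B : State → Prop} {P Q : Program} {e : NExpr} {K : ℕ}
    (hP : Triple (fun s => A s ∧ e.eval s ≠ 0) P B K)
    (hQ : Triple (fun s => A s ∧ e.eval s = 0) Q B K) :
    Triple A (.seq (e.compile 0) (.cond 1 P Q)) B (e.cost + K + 1) := by
  intro s hs
  obtain ⟨ρ, h1, h2, h3, h4⟩ := e.compile_runs 0 s
  have hv : State.view { s with reg := ρ } = s.view := by
    simp only [State.view, h2]
  simp only [mul_zero, zero_add] at h4
  by_cases h : e.eval s.view = 0
  · obtain ⟨s', t, g1, g2, g3⟩ := hQ { s with reg := ρ } (by rw [hv]; exact ⟨hs, h⟩)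
    exact ⟨s', _, Runs.seq h1 (Runs.cond_false (h4.trans h) g1), by omega, g3⟩
  · obtain ⟨s', t, g1, g2, g3⟩ := hP { s with reg := ρ } (by rw [hv]; exact ⟨hs, h⟩)
    exact ⟨s', _, Runs.seq h1 (Runs.cond_true (by rw [← h4] at h; exact h) g1), by omega, g3⟩

end
end NoisyClifford

namespace NoisyClifford
noncomputable section

/-! ### Tensor products of single-qubit operators -/

/-- The tensor product of single-qubit operators. -/
def tens {n : ℕ} (A : Fin n → Matrix (Fin 2) (Fin 2) ℂ) : Op n :=
  Matrix.of fun a b => ∏ j, A j (a j) (b j)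

theorem tens_mul {n : ℕ} (A B : Fin n → Matrix (Fin 2) (Fin 2) ℂ) :
    tens A * tens B = tens fun j => A j * B j := by
  ext a b
  simp only [tens, Matrix.mul_apply, Matrix.of_apply]
  rw [Finset.prod_univ_sum, Fintype.piFinset_univ]
  simp only [Finset.prod_mul_distrib]

theorem tens_conjTranspose {n : ℕ} (A : Fin n → Matrix (Fin 2) (Fin 2) ℂ) :
    (tens A).conjTranspose = tens fun j => (A j).conjTranspose := by
  ext a b
  simp [tens, Matrix.conjTranspose_apply]

theorem tens_update_apply {n : ℕ} (A : Fin n → Matrix (Fin 2) (Fin 2) ℂ) (q : Fin n)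
    (M : Matrix (Fin 2) (Fin 2) ℂ) (a b : Basis n) :
    tens (Function.update A q M) a b =
      M (a q) (b q) * ∏ j ∈ Finset.univ.erase q, A j (a j) (b j) := by
  rw [tens, Matrix.of_apply, ← Finset.mul_prod_erase _ _ (Finset.mem_univ q), Function.update_self]
  congr 1
  refine Finset.prod_congr rfl fun j hj => ?_
  rw [Function.update_of_ne (Finset.ne_of_mem_erase hj)]

theorem onQubit_eq_tens {n : ℕ} (q : Fin n) (M : Matrix (Fin 2) (Fin 2) ℂ) :
    onQubit q M = tens (Function.update (fun _ => 1) q M) := by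
  ext a b
  rw [tens_update_apply, onQubit, Matrix.of_apply]
  split_ifs with h
  · rw [Finset.prod_eq_one, mul_one]
    intro j hj
    rw [h j (Finset.ne_of_mem_erase hj), Matrix.one_apply_eq]
  · push Not at h
    obtain ⟨j, hj, hab⟩ := h
    have hz : (1 : Matrix (Fin 2) (Fin 2) ℂ) (a j) (b j) = 0 := Matrix.one_apply_ne hab
    exact (mul_eq_zero_of_right _
      (Finset.prod_eq_zero (Finset.mem_erase.2 ⟨hj, Finset.mem_univ j⟩) hz)).symm

theorem onQubit_mul {n : ℕ} (q : Fin n) (M N : Matrix (Fin 2) (Fin 2) ℂ) :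
    onQubit q M * onQubit q N = onQubit q (M * N) := by
  rw [onQubit_eq_tens, onQubit_eq_tens, onQubit_eq_tens, tens_mul]
  congr 1
  funext j
  by_cases h : j = q
  · subst h; simp
  · simp [Function.update_of_ne h]

theorem onQubit_conjTranspose {n : ℕ} (q : Fin n) (M : Matrix (Fin 2) (Fin 2) ℂ) :
    (onQubit q M).conjTranspose = onQubit q M.conjTranspose := by
  rw [onQubit_eq_tens, onQubit_eq_tens, tens_conjTranspose]
  congr 1
  funext j
  by_cases h : j = q
  · subst h; simp
  · simp [Function.update_of_ne h]

theorem onQubit_one {n : ℕ} (q : Fin n) : onQubit q (1 : Matrix (Fin 2) (Fin 2) ℂ) = 1 := by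
  ext a b
  rw [onQubit, Matrix.of_apply, Matrix.one_apply, Matrix.one_apply]
  by_cases h : a = b
  · subst h; simp
  · by_cases h' : ∀ j, j ≠ q → a j = b j
    · rw [if_pos h', if_neg h, if_neg]
      exact fun hq => h (funext fun j => if hj : j = q then hj ▸ hq else h' j hj)
    · rw [if_neg h', if_neg h]

theorem onQubit_smul {n : ℕ} (q : Fin n) (c : ℂ) (M : Matrix (Fin 2) (Fin 2) ℂ) :
    onQubit q (c • M) = c • onQubit q M := by
  ext a b
  simp [onQubit]

/-- Conjugation by a single-qubit operator acts on one tensor factor. -/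
theorem conj_onQubit_tens {n : ℕ} (q : Fin n) (M : Matrix (Fin 2) (Fin 2) ℂ)
    (A : Fin n → Matrix (Fin 2) (Fin 2) ℂ) :
    conj (onQubit q M) (tens A) = tens (Function.update A q (M * A q * M.conjTranspose)) := by
  rw [conj, onQubit_conjTranspose, onQubit_eq_tens, onQubit_eq_tens, tens_mul, tens_mul]
  congr 1
  funext j
  by_cases h : j = q
  · subst h; simp
  · simp [Function.update_of_ne h]

/-! ### Conjugation -/

theorem conj_add {n : ℕ} (A ρ σ : Op n) : conj A (ρ + σ) = conj A ρ + conj A σ := by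
  simp [conj, Matrix.mul_add, Matrix.add_mul]

theorem conj_smul {n : ℕ} (A : Op n) (c : ℂ) (ρ : Op n) : conj A (c • ρ) = c • conj A ρ := by
  simp [conj]

theorem conj_sum {n : ℕ} {ι : Type*} (A : Op n) (s : Finset ι) (f : ι → Op n) :
    conj A (∑ i ∈ s, f i) = ∑ i ∈ s, conj A (f i) := by
  simp [conj, Matrix.mul_sum, Matrix.sum_mul]

theorem conj_conj {n : ℕ} (A B ρ : Op n) : conj A (conj B ρ) = conj (A * B) ρ := by
  simp [conj, Matrix.mul_assoc]

theorem conj_smul_left {n : ℕ} (A : Op n) (c : ℂ) (hc : c * star c = 1) (ρ : Op n) :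
    conj (c • A) ρ = conj A ρ := by
  simp only [conj, Matrix.conjTranspose_smul, Matrix.smul_mul, Matrix.mul_smul, smul_smul]
  rw [mul_comm, hc, one_smul]

theorem trace_conj_mul {n : ℕ} (A ρ O : Op n) :
    (conj A ρ * O).trace = (ρ * conj A.conjTranspose O).trace := by
  simp only [conj, Matrix.conjTranspose_conjTranspose, Matrix.mul_assoc]
  rw [Matrix.trace_mul_comm]
  simp only [Matrix.mul_assoc]

/-! ### Characters and Pauli components -/

/-- The sign by which the Pauli operator with `X`-bit `s.1` and `Z`-bit `s.2` changes under
conjugation with `X ^ z.2 Z ^ z.1`. -/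
def intSign (s z : Fin 2 × Fin 2) : ℤ := if s.1 * z.1 + s.2 * z.2 = 0 then 1 else -1

def sign (s z : Fin 2 × Fin 2) : ℝ := intSign s z

/-- For fixed `s` the sign is a character of (ℤ/2)². The identity is checked case by case in ℤ,
where it is decidable. -/
theorem sign_add (s z w : Fin 2 × Fin 2) : sign s (z + w) = sign s z * sign s w := by
  rw [sign, sign, sign, ← Int.cast_mul]
  congr 1
  revert s z w
  decide

/-- Orthogonality of the four characters; this removes the cross terms in the average over the
ensemble. -/
theorem sum_sign_mul_sign (s t : Fin 2 × Fin 2) :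
    ∑ z, sign s z * sign t z = if s = t then 4 else 0 := by
  have h : ∑ z, intSign s z * intSign t z = if s = t then 4 else 0 := by
    revert s t
    decide
  have h' := congrArg (Int.cast : ℤ → ℝ) h
  push_cast at h'
  exact h'

theorem sum_sign_mul_sign' (y z : Fin 2 × Fin 2) :
    ∑ s, sign s y * sign s z = if y = z then 4 else 0 := by
  have h : ∑ s, intSign s y * intSign s z = if y = z then 4 else 0 := by
    revert y z
    decide
  have h' := congrArg (Int.cast : ℤ → ℝ) h
  push_cast at h'
  exact h'

theorem sign_zero_left (z : Fin 2 × Fin 2) : sign 0 z = 1 := by simp [sign, intSign]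

theorem pauliXZ_mul (z w : Fin 2 × Fin 2) :
    pauliXZ z * pauliXZ w = ((-1 : ℂ) ^ ((z.1 : ℕ) * (w.2 : ℕ))) • pauliXZ (z + w) := by
  obtain ⟨z1, z2⟩ := z
  obtain ⟨w1, w2⟩ := w
  have hX : pauliX * pauliX = 1 := by
    ext i j; fin_cases i <;> fin_cases j <;> simp [pauliX]
  have hZ : pauliZ * pauliZ = 1 := by
    ext i j; fin_cases i <;> fin_cases j <;> simp [pauliZ]
  have hZX : pauliZ * pauliX = -(pauliX * pauliZ) := by
    ext i j; fin_cases i <;> fin_cases j <;> simp [pauliZ, pauliX]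
  have hXX : ∀ M, pauliX * (pauliX * M) = M := fun M => by rw [← Matrix.mul_assoc, hX, one_mul]
  have hZXM : ∀ M, pauliZ * (pauliX * M) = -(pauliX * (pauliZ * M)) := fun M => by
    rw [← Matrix.mul_assoc, hZX, Matrix.neg_mul, Matrix.mul_assoc]
  fin_cases z1 <;> fin_cases z2 <;> fin_cases w1 <;> fin_cases w2 <;>
    simp [pauliXZ, hX, hZ, hZX, Matrix.mul_assoc, hXX, hZXM]

theorem pauliXZ_zero : pauliXZ 0 = 1 := by simp [pauliXZ]

theorem pauliXZ_conjTranspose (z : Fin 2 × Fin 2) :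
    (pauliXZ z).conjTranspose = ((-1 : ℂ) ^ ((z.1 : ℕ) * (z.2 : ℕ))) • pauliXZ z := by
  obtain ⟨z1, z2⟩ := z
  fin_cases z1 <;> fin_cases z2 <;> ext i j <;> fin_cases i <;> fin_cases j <;>
    simp [pauliXZ, pauliX, pauliZ]

/-- Conjugation by `X ^ z.2 Z ^ z.1` on qubit `q`. -/
def pconj {n : ℕ} (q : Fin n) (z : Fin 2 × Fin 2) (O : Op n) : Op n := conj (onQubit q (pauliXZ z)) O

theorem neg_one_pow_mul_star (k : ℕ) : (-1 : ℂ) ^ k * star ((-1 : ℂ) ^ k) = 1 := by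
  simp [← mul_pow]

/-- Products of Paulis close up only to a sign, but conjugation does not see it. So (ℤ/2)² acts on
operators. -/
theorem pconj_pconj {n : ℕ} (q : Fin n) (z w : Fin 2 × Fin 2) (O : Op n) :
    pconj q z (pconj q w O) = pconj q (z + w) O := by
  rw [pconj, pconj, conj_conj, onQubit_mul, pauliXZ_mul, onQubit_smul,
    conj_smul_left _ _ (neg_one_pow_mul_star _), pconj]

theorem trace_pconj_mul {n : ℕ} (q : Fin n) (z : Fin 2 × Fin 2) (ρ O : Op n) :
    (pconj q z ρ * O).trace = (ρ * pconj q z O).trace := by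
  rw [pconj, trace_conj_mul, onQubit_conjTranspose, pauliXZ_conjTranspose, onQubit_smul,
    conj_smul_left _ _ (neg_one_pow_mul_star _), pconj]

/-- The component of an operator on which qubit `q` carries the Pauli operator `s`. -/
def proj {n : ℕ} (q : Fin n) (s : Fin 2 × Fin 2) (O : Op n) : Op n :=
  (1 / 4 : ℂ) • ∑ z, (sign s z : ℂ) • pconj q z O

theorem proj_add {n : ℕ} (q : Fin n) (s : Fin 2 × Fin 2) (O Q : Op n) :
    proj q s (O + Q) = proj q s O + proj q s Q := by
  simp [proj, pconj, conj_add, Finset.sum_add_distrib]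

theorem proj_smul {n : ℕ} (q : Fin n) (s : Fin 2 × Fin 2) (c : ℂ) (O : Op n) :
    proj q s (c • O) = c • proj q s O := by
  simp only [proj, pconj, conj_smul, Finset.smul_sum, smul_smul]
  refine Finset.sum_congr rfl fun z _ => ?_
  congr 1
  ring

theorem trace_proj_mul {n : ℕ} (q : Fin n) (s : Fin 2 × Fin 2) (ρ O : Op n) :
    (proj q s ρ * O).trace = (ρ * proj q s O).trace := by
  simp [proj, Matrix.sum_mul, Matrix.mul_sum, Matrix.trace_sum, trace_pconj_mul]

/-- Fourier inversion on (ℤ/2)². -/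
theorem sum_sign_proj {n : ℕ} (q : Fin n) (y : Fin 2 × Fin 2) (O : Op n) :
    ∑ s, (sign s y : ℂ) • proj q s O = pconj q y O := by
  simp only [proj, Finset.smul_sum, smul_smul]
  rw [Finset.sum_comm]
  have : ∀ z, ∑ s, ((sign s y : ℂ) * (1 / 4) * (sign s z : ℂ)) • pconj q z O =
      if y = z then pconj q z O else 0 := by
    intro z
    rw [← Finset.sum_smul]
    simp only [mul_right_comm _ (1 / 4 : ℂ)]
    rw [← Finset.sum_mul]
    have h := congrArg (Complex.ofReal) (sum_sign_mul_sign' y z)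
    push_cast at h
    rw [h]
    split_ifs <;> simp
  simp only [mul_assoc] at this ⊢
  simp only [this, Finset.sum_ite_eq, Finset.mem_univ, if_true]

theorem pconj_proj {n : ℕ} (q : Fin n) (z s : Fin 2 × Fin 2) (O : Op n) :
    pconj q z (proj q s O) = (sign s z : ℂ) • proj q s O := by
  have h1 : pconj q z (proj q s O) = (1 / 4 : ℂ) • ∑ w, (sign s w : ℂ) • pconj q (z + w) O := by
    simp only [← pconj_pconj]
    simp only [proj, pconj, conj_smul, conj_sum]
  rw [h1, proj, smul_comm (sign s z : ℂ)]
  refine congrArg _ ?_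
  rw [Finset.smul_sum]
  have hz : ∀ z : Fin 2 × Fin 2, z + z = 0 := by decide
  -- Translation by `z` cancels the shift, since `z + z = 0`, and produces the factor `sign s z`.
  rw [← Equiv.sum_comp (Equiv.addLeft z)]
  refine Finset.sum_congr rfl fun w _ => ?_
  rw [Equiv.coe_addLeft, ← add_assoc, hz z, zero_add, sign_add, smul_smul]
  push_cast
  rfl

/-! ### The noise is diagonal in the Pauli basis -/

/-- The eigenvalues of the noise channel. -/
def noiseEig (e : Fin 3 → ℝ) (s : Fin 2 × Fin 2) : ℝ :=
  (if s.1 = 0 then 1 else 1 - 2 * e 0) * (if s.2 = 0 then 1 else 1 - 2 * e 1) *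
    (if s.1 = s.2 then 1 else 1 - 2 * e 2)

theorem conj_pauliZ {n : ℕ} (q : Fin n) (O : Op n) : conj (onQubit q pauliZ) O = pconj q (1, 0) O := by
  simp [pconj, pauliXZ]

theorem conj_pauliX {n : ℕ} (q : Fin n) (O : Op n) : conj (onQubit q pauliX) O = pconj q (0, 1) O := by
  simp [pconj, pauliXZ]

theorem conj_pauliY {n : ℕ} (q : Fin n) (O : Op n) : conj (onQubit q pauliY) O = pconj q (1, 1) O := by
  have : pauliY = Complex.I • pauliXZ (1, 1) := by
    ext i j; fin_cases i <;> fin_cases j <;> simp [pauliY, pauliXZ, pauliX, pauliZ]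
  rw [this, onQubit_smul, conj_smul_left _ _ (by simp), pconj]

/-- On a component the error channel is the scalar (1 - e) ± e, with the minus sign exactly if the
error anticommutes with the Pauli `s`. -/
theorem pauliError_proj {n : ℕ} (e : ℝ) {σ : Matrix (Fin 2) (Fin 2) ℂ} (q : Fin n)
    (z s : Fin 2 × Fin 2) (O : Op n) (hσ : ∀ O : Op n, conj (onQubit q σ) O = pconj q z O) (c : ℝ) :
    pauliError e σ q ((c : ℂ) • proj q s O) =
      ((c * (if s.1 * z.1 + s.2 * z.2 = 0 then 1 else 1 - 2 * e) : ℝ) : ℂ) • proj q s O := by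
  rw [pauliError, hσ, pconj, conj_smul, ← pconj, pconj_proj, smul_smul, smul_smul, smul_smul,
    ← add_smul]
  congr 1
  rw [sign, intSign]
  split_ifs <;> push_cast <;> ring

theorem pauliError_sum {n : ℕ} {ι : Type*} (e : ℝ) (σ : Matrix (Fin 2) (Fin 2) ℂ) (q : Fin n)
    (s : Finset ι) (f : ι → Op n) :
    pauliError e σ q (∑ i ∈ s, f i) = ∑ i ∈ s, pauliError e σ q (f i) := by
  simp only [pauliError, conj_sum, Finset.smul_sum, Finset.sum_add_distrib]

/-- A random Pauli followed by the noise. -/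
theorem noise_pconj {n : ℕ} (e : Fin 3 → ℝ) (q : Fin n) (y : Fin 2 × Fin 2) (O : Op n) :
    noise e q (pconj q y O) = ∑ s, ((noiseEig e s * sign s y : ℝ) : ℂ) • proj q s O := by
  rw [← sum_sign_proj, noise, pauliError_sum, pauliError_sum, pauliError_sum]
  refine Finset.sum_congr rfl fun s _ => ?_
  rw [pauliError_proj _ q (1, 0) s O (conj_pauliZ q), pauliError_proj _ q (0, 1) s O (conj_pauliX q),
    pauliError_proj _ q (1, 1) s O (conj_pauliY q)]
  congr 2
  -- The error `Y` has both bits, so it anticommutes with `s` exactly if the bits of `s` differ.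
  have h : s.1 + s.2 = 0 ↔ s.1 = s.2 := by revert s; decide
  simp only [mul_one, mul_zero, add_zero, zero_add, h, noiseEig]
  ring

/-- The component projections are self-adjoint for the trace pairing, so the random Pauli with its
noise can be moved from the state to the observable unchanged. -/
theorem trace_noise_pconj_mul {n : ℕ} (e : Fin 3 → ℝ) (q : Fin n) (y : Fin 2 × Fin 2) (ρ O : Op n) :
    (noise e q (pconj q y ρ) * O).trace = (ρ * noise e q (pconj q y O)).trace := by
  simp [noise_pconj, Matrix.sum_mul, Matrix.mul_sum, Matrix.trace_sum, trace_proj_mul]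

/-! ### The steps of a circuit -/

/-- A step of a circuit: a Clifford gate, or the noisy gate with a given number. -/
abbrev Step (n m : ℕ) : Type := CliffordGate n ⊕ Fin m

/-- All steps in chronological order. -/
def Circuit.steps {n m : ℕ} (C : Circuit n m) : List (Step n m) :=
  (C.block 0).map Sum.inl ++
    (List.finRange m).flatMap fun k => Sum.inr k :: (C.block k.succ).map Sum.inl

/-- The numbers of the noisy gates in a list of steps. -/
def noisyGates {n m : ℕ} (l : List (Step n m)) : List (Fin m) := l.filterMap Sum.getRight?

/-- The state after the given steps, of which the last one comes first. -/
def Circuit.stateOf {n m : ℕ} (C : Circuit n m) (e : Fin 3 → ℝ) (y : PauliChoice m) :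
    List (Step n m) → Op n
  | [] => zeroState n
  | .inl g :: l => conj g.toOp (C.stateOf e y l)
  | .inr k :: l => (C.gate k).apply e (y k) (C.stateOf e y l)

theorem runClifford_stateOf {n m : ℕ} (C : Circuit n m) (e : Fin 3 → ℝ) (y : PauliChoice m)
    (B : List (CliffordGate n)) : ∀ l : List (Step n m),
    runClifford B (C.stateOf e y l) = C.stateOf e y ((B.map Sum.inl).reverse ++ l) := by
  induction B with
  | nil => intro l; rfl
  | cons g B ih =>
    intro l
    have := ih (.inl g :: l)
    simpa [runClifford, Circuit.stateOf] using this

theorem stateAfter_eq_stateOf {n m : ℕ} (C : Circuit n m) (e : Fin 3 → ℝ) (y : PauliChoice m)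
    (k : ℕ) (hk : k < m + 1) : C.stateAfter e y ⟨k, hk⟩ =
      C.stateOf e y ((C.block 0).map Sum.inl ++ ((List.finRange m).take k).flatMap
        fun k : Fin m => Sum.inr k :: (C.block k.succ).map Sum.inl).reverse := by
  induction k with
  | zero =>
    have := runClifford_stateOf C e y (C.block 0) []
    simpa [Circuit.stateAfter, Circuit.stateOf] using this
  | succ k ih =>
    have hk' : k < m := by omega
    have h1 : C.stateAfter e y ⟨k + 1, hk⟩ = runClifford (C.block (Fin.succ ⟨k, hk'⟩))
        ((C.gate ⟨k, hk'⟩).apply e (y ⟨k, hk'⟩) (C.stateAfter e y ⟨k, by omega⟩)) :=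
      Fin.induction_succ (motive := fun _ => Op n) _ _ (⟨k, hk'⟩ : Fin m)
    rw [h1, ih, List.take_succ_eq_append_getElem (by simpa using hk')]
    have := runClifford_stateOf C e y (C.block (Fin.succ ⟨k, hk'⟩))
      (Sum.inr ⟨k, hk'⟩ :: ((C.block 0).map Sum.inl ++ ((List.finRange m).take k).flatMap
        fun k : Fin m => Sum.inr k :: (C.block k.succ).map Sum.inl).reverse)
    rw [Circuit.stateOf] at this
    rw [this]
    simp [List.flatMap_append]

theorem stateAfter_last {n m : ℕ} (C : Circuit n m) (e : Fin 3 → ℝ) (y : PauliChoice m) :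
    C.stateAfter e y (Fin.last m) = C.stateOf e y C.steps.reverse := by
  have := stateAfter_eq_stateOf C e y m (by omega)
  rw [List.take_of_length_le (by simp)] at this
  exact this

theorem noisyGates_map_inl {n m : ℕ} (B : List (CliffordGate n)) :
    noisyGates (B.map Sum.inl : List (Step n m)) = [] := by
  simp [noisyGates, List.filterMap_map]

theorem noisyGates_steps {n m : ℕ} (C : Circuit n m) : noisyGates C.steps = List.finRange m := by
  rw [noisyGates, Circuit.steps, List.filterMap_append, ← noisyGates, noisyGates_map_inl]
  have : ∀ l : List (Fin m), noisyGates (l.flatMap fun k =>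
      (Sum.inr k :: (C.block k.succ).map Sum.inl : List (Step n m))) = l := by
    intro l
    induction l with
    | nil => rfl
    | cons k l ih =>
      rw [List.flatMap_cons, noisyGates, List.filterMap_append, ← noisyGates, ← noisyGates, ih,
        noisyGates, List.filterMap_cons, ← noisyGates, noisyGates_map_inl]
      rfl
  exact this _

/-! ### Truncation by the number of nontrivial Pauli components -/

/-- The part of a noisy gate, acting on observables, on which the randomized qubit carries the
Pauli operator `s`. -/
def NoisyGate.component {n : ℕ} (g : NoisyGate n) (s : Fin 2 × Fin 2) (O : Op n) : Op n :=
  if g.pauliFirst then proj g.qubit s (conj (onQubit g.qubit g.U.1.conjTranspose) O)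
  else conj (onQubit g.qubit g.U.1.conjTranspose) (proj g.qubit s O)

theorem NoisyGate.component_add {n : ℕ} (g : NoisyGate n) (s : Fin 2 × Fin 2) (O Q : Op n) :
    g.component s (O + Q) = g.component s O + g.component s Q := by
  unfold NoisyGate.component
  split_ifs <;> simp [conj_add, proj_add]

theorem NoisyGate.component_smul {n : ℕ} (g : NoisyGate n) (s : Fin 2 × Fin 2) (c : ℂ) (O : Op n) :
    g.component s (c • O) = c • g.component s O := by
  unfold NoisyGate.component
  split_ifs <;> simp [conj_smul, proj_smul]

theorem NoisyGate.trace_apply_mul {n : ℕ} (g : NoisyGate n) (e : Fin 3 → ℝ) (y : Fin 2 × Fin 2)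
    (ρ O : Op n) : (g.apply e y ρ * O).trace =
      (ρ * ∑ s, ((noiseEig e s * sign s y : ℝ) : ℂ) • g.component s O).trace := by
  unfold NoisyGate.apply NoisyGate.component
  have hp : ∀ Q : Op n, conj (onQubit g.qubit (pauliXZ y)) Q = pconj g.qubit y Q := fun _ => rfl
  simp only [hp]
  split_ifs
  · rw [trace_conj_mul, trace_noise_pconj_mul, noise_pconj, onQubit_conjTranspose]
  · rw [trace_noise_pconj_mul, trace_conj_mul, noise_pconj, onQubit_conjTranspose, conj_sum]
    simp only [conj_smul]

def weight (s : Fin 2 × Fin 2) : ℕ := if s = 0 then 0 else 1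

/-- The expectation value of an observable, restricted to at least `b` nontrivial components. -/
def Circuit.tail {n m : ℕ} (C : Circuit n m) (e : Fin 3 → ℝ) (y : PauliChoice m) :
    List (Step n m) → ℕ → Op n → ℝ
  | [], b, O => if b = 0 then (zeroState n * O).trace.re else 0
  | .inl g :: l, b, O => C.tail e y l b (conj g.toOp.conjTranspose O)
  -- The subtraction is truncated: a requirement that has been met stays met.
  | .inr k :: l, b, O => ∑ s, noiseEig e s * sign s (y k) *
      C.tail e y l (b - weight s) ((C.gate k).component s O)

/-- The expectation value of an observable, restricted to at most `b` nontrivial components. -/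
def Circuit.trunc {n m : ℕ} (C : Circuit n m) (e : Fin 3 → ℝ) (y : PauliChoice m) :
    List (Step n m) → ℕ → Op n → ℝ
  | [], _, O => (zeroState n * O).trace.re
  | .inl g :: l, b, O => C.trunc e y l b (conj g.toOp.conjTranspose O)
  | .inr k :: l, b, O => ∑ s, if b < weight s then 0 else noiseEig e s * sign s (y k) *
      C.trunc e y l (b - weight s) ((C.gate k).component s O)

/-- Every choice of components has either at most `b` or at least `b + 1` nontrivial ones; with
bound `0` the tail is the full sum. -/
theorem Circuit.trunc_add_tail {n m : ℕ} (C : Circuit n m) (e : Fin 3 → ℝ) (y : PauliChoice m)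
    (l : List (Step n m)) : ∀ (b : ℕ) (O : Op n),
    C.trunc e y l b O + C.tail e y l (b + 1) O = C.tail e y l 0 O := by
  induction l with
  | nil => intro b O; simp [Circuit.trunc, Circuit.tail]
  | cons x l ih =>
    intro b O
    cases x with
    | inl g => exact ih b _
    | inr k =>
      simp only [Circuit.trunc, Circuit.tail, ← Finset.sum_add_distrib, Nat.zero_sub]
      refine Finset.sum_congr rfl fun s _ => ?_
      unfold weight
      by_cases hs : s = 0
      · rw [if_pos hs, if_neg (by omega), ← mul_add, Nat.sub_zero, Nat.sub_zero, ih]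
      · rw [if_neg hs]
        by_cases hb : b < 1
        · rw [if_pos hb]
          -- With no budget left, the truncation drops this component, and the tail, which needed
          -- one, now keeps all that follows.
          obtain rfl : b = 0 := by omega
          simp
        · rw [if_neg hb, ← mul_add]
          obtain ⟨c, rfl⟩ : ∃ c, b = c + 1 := ⟨b - 1, by omega⟩
          simp only [Nat.add_sub_cancel]
          rw [ih]

theorem Circuit.trunc_add {n m : ℕ} (C : Circuit n m) (e : Fin 3 → ℝ) (y : PauliChoice m)
    (l : List (Step n m)) : ∀ (b : ℕ) (O Q : Op n),
    C.trunc e y l b (O + Q) = C.trunc e y l b O + C.trunc e y l b Q := by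
  induction l with
  | nil => intro b O Q; simp [Circuit.trunc, Matrix.mul_add]
  | cons x l ih =>
    intro b O Q
    cases x with
    | inl g => simp only [Circuit.trunc, conj_add, ih]
    | inr k =>
      simp only [Circuit.trunc, NoisyGate.component_add, ih, ← Finset.sum_add_distrib]
      refine Finset.sum_congr rfl fun s _ => ?_
      split_ifs
      · simp
      · ring

theorem Circuit.trunc_smul {n m : ℕ} (C : Circuit n m) (e : Fin 3 → ℝ) (y : PauliChoice m)
    (l : List (Step n m)) : ∀ (b : ℕ) (c : ℝ) (O : Op n),
    C.trunc e y l b ((c : ℂ) • O) = c * C.trunc e y l b O := by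
  induction l with
  | nil => intro b c O; simp [Circuit.trunc]
  | cons x l ih =>
    intro b c O
    cases x with
    | inl g => simp only [Circuit.trunc, conj_smul, ih]
    | inr k =>
      simp only [Circuit.trunc, NoisyGate.component_smul, ih, Finset.mul_sum]
      refine Finset.sum_congr rfl fun s _ => ?_
      split_ifs
      · simp
      · ring

theorem Circuit.trunc_zero {n m : ℕ} (C : Circuit n m) (e : Fin 3 → ℝ) (y : PauliChoice m)
    (l : List (Step n m)) (b : ℕ) : C.trunc e y l b 0 = 0 := by
  have := C.trunc_smul e y l b 0 0
  simpa using this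

theorem Circuit.trunc_sum {n m : ℕ} {ι : Type*} (C : Circuit n m) (e : Fin 3 → ℝ)
    (y : PauliChoice m) (l : List (Step n m)) (b : ℕ) (t : Finset ι) (f : ι → Op n) :
    C.trunc e y l b (∑ i ∈ t, f i) = ∑ i ∈ t, C.trunc e y l b (f i) := by
  classical
  induction t using Finset.induction_on with
  | empty => simp [C.trunc_zero]
  | insert a t ha ih => rw [Finset.sum_insert ha, Finset.sum_insert ha, C.trunc_add, ih]

theorem Circuit.tail_zero_add {n m : ℕ} (C : Circuit n m) (e : Fin 3 → ℝ) (y : PauliChoice m)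
    (l : List (Step n m)) : ∀ O : Op n,
    C.tail e y l 0 O = (C.stateOf e y l * O).trace.re := by
  induction l with
  | nil => intro O; simp [Circuit.tail, Circuit.stateOf]
  | cons x l ih =>
    intro O
    cases x with
    | inl g => simp only [Circuit.tail, Circuit.stateOf, ih, trace_conj_mul]
    | inr k =>
      simp only [Circuit.tail, Circuit.stateOf, ih, NoisyGate.trace_apply_mul, Nat.zero_sub,
        Matrix.mul_sum, Matrix.trace_sum, Complex.re_sum]
      refine Finset.sum_congr rfl fun s _ => ?_
      rw [Matrix.mul_smul, Matrix.trace_smul, smul_eq_mul, Complex.re_ofReal_mul]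

/-- Beyond the number of noisy gates the truncation has no effect. -/
theorem Circuit.trunc_eq_of_length_le {n m : ℕ} (C : Circuit n m) (e : Fin 3 → ℝ)
    (y : PauliChoice m) (l : List (Step n m)) : ∀ (b b' : ℕ) (O : Op n),
    (noisyGates l).length ≤ b → (noisyGates l).length ≤ b' →
      C.trunc e y l b O = C.trunc e y l b' O := by
  induction l with
  | nil => intro b b' O _ _; rfl
  | cons x l ih =>
    intro b b' O hb hb'
    cases x with
    | inl g => exact ih b b' _ hb hb'
    | inr k =>
      have hk : (noisyGates (.inr k :: l)).length = (noisyGates l).length + 1 := by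
        simp [noisyGates]
      rw [hk] at hb hb'
      simp only [Circuit.trunc]
      refine Finset.sum_congr rfl fun s _ => ?_
      have hw : weight s ≤ 1 := by unfold weight; split_ifs <;> simp
      rw [if_neg (by omega), if_neg (by omega), ih (b - weight s) (b' - weight s) _ (by omega)
        (by omega)]

end
end NoisyClifford

namespace NoisyClifford
noncomputable section

open scoped ComplexOrder

/-! ### The error of the truncation, on average over the ensemble -/

/-- Resampling one coordinate: exchanging `y k` with `z` is an involution of the pairs, after which
`z` is a free variable with four values. -/
theorem sum_update_eq {m : ℕ} (k : Fin m) (F : PauliChoice m → ℝ) :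
    ∑ y, ∑ z, F (Function.update y k z) = 4 * ∑ y, F y := by
  have h : Function.Involutive fun p : PauliChoice m × (Fin 2 × Fin 2) =>
      (Function.update p.1 k p.2, p.1 k) := by
    rintro ⟨y, z⟩
    simp
  have h2 := Fintype.sum_bijective _ h.bijective
    (fun p : PauliChoice m × (Fin 2 × Fin 2) => F (Function.update p.1 k p.2)) (fun p => F p.1)
    fun _ => rfl
  rw [Fintype.sum_prod_type, Fintype.sum_prod_type] at h2
  rw [h2, Finset.mul_sum]
  simp [Fintype.card_prod]

/-- Parseval's identity on (ℤ/2)². -/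
theorem sum_sq_sum_sign (A : Fin 2 × Fin 2 → ℝ) :
    ∑ z, (∑ s, sign s z * A s) ^ 2 = 4 * ∑ s, A s ^ 2 := by
  have h : ∀ z, (∑ s, sign s z * A s) ^ 2 = ∑ s, ∑ t, (sign s z * sign t z) * (A s * A t) := by
    intro z
    rw [sq, Finset.sum_mul_sum]
    refine Finset.sum_congr rfl fun s _ => Finset.sum_congr rfl fun t _ => ?_
    ring
  simp only [h]
  rw [Finset.sum_comm, Finset.mul_sum]
  refine Finset.sum_congr rfl fun s _ => ?_
  rw [Finset.sum_comm]
  simp only [← Finset.sum_mul, sum_sign_mul_sign]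
  simp [sq]

theorem sum_sq_sum_sign_apply {m : ℕ} (k : Fin m) (A : Fin 2 × Fin 2 → PauliChoice m → ℝ)
    (hA : ∀ s y z, A s (Function.update y k z) = A s y) :
    ∑ y, (∑ s, sign s (y k) * A s y) ^ 2 = ∑ s, ∑ y, A s y ^ 2 := by
  have h := sum_update_eq k fun y => (∑ s, sign s (y k) * A s y) ^ 2
  simp only [hA, Function.update_self, sum_sq_sum_sign, ← Finset.mul_sum] at h
  rw [Finset.sum_comm]
  linarith

theorem Circuit.tail_update {n m : ℕ} (C : Circuit n m) (e : Fin 3 → ℝ) (k : Fin m)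
    (z : Fin 2 × Fin 2) (y : PauliChoice m) (l : List (Step n m)) : ∀ (b : ℕ) (O : Op n),
    k ∉ noisyGates l → C.tail e (Function.update y k z) l b O = C.tail e y l b O := by
  induction l with
  | nil => intro b O _; rfl
  | cons x l ih =>
    intro b O hk
    cases x with
    | inl g => exact ih b _ hk
    | inr j =>
      have hk' : k ≠ j ∧ k ∉ noisyGates l := by
        simpa [noisyGates] using hk
      simp only [Circuit.tail]
      refine Finset.sum_congr rfl fun s _ => ?_
      rw [ih _ _ hk'.2, Function.update_of_ne hk'.1.symm]

theorem noiseEig_zero (s : Fin 2 × Fin 2) : noiseEig 0 s = 1 := by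
  simp [noiseEig]

/-- The noise damps the part with at least `b` nontrivial components by `κ ^ b`. -/
theorem Circuit.sum_sq_tail_le {n m : ℕ} (C : Circuit n m) (e : Fin 3 → ℝ) {κ : ℝ} (h0 : 0 ≤ κ)
    (h1 : κ ≤ 1) (hκ : ∀ s, |noiseEig e s| ≤ κ ^ weight s) (l : List (Step n m)) :
    ∀ (b : ℕ) (O : Op n), (noisyGates l).Nodup →
      ∑ y, C.tail e y l b O ^ 2 ≤ κ ^ (2 * b) * ∑ y, C.tail 0 y l 0 O ^ 2 := by
  induction l with
  | nil =>
    intro b O _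
    simp only [Circuit.tail]
    split_ifs with hb
    · simp [hb]
    · simp only [ne_eq, OfNat.ofNat_ne_zero, not_false_eq_true, zero_pow, Finset.sum_const_zero]
      positivity
  | cons x l ih =>
    intro b O hl
    cases x with
    | inl g => exact ih b _ hl
    | inr k =>
      have hl' : k ∉ noisyGates l ∧ (noisyGates l).Nodup := by
        simpa [noisyGates] using hl
      simp only [Circuit.tail, noiseEig_zero, one_mul, Nat.zero_sub]
      have e1 : ∀ y, (∑ s, noiseEig e s * sign s (y k) *
          C.tail e y l (b - weight s) ((C.gate k).component s O)) = ∑ s, sign s (y k) *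
          (noiseEig e s * C.tail e y l (b - weight s) ((C.gate k).component s O)) := fun y =>
        Finset.sum_congr rfl fun s _ => by ring
      simp only [e1]
      -- Parseval at gate `k` on both sides. What remains does not depend on `y k`, because no gate
      -- occurs twice in the list.
      rw [sum_sq_sum_sign_apply k (fun s y => noiseEig e s *
          C.tail e y l (b - weight s) ((C.gate k).component s O))
          fun s y z => by rw [C.tail_update e k z y l _ _ hl'.1],
        sum_sq_sum_sign_apply k (fun s y => C.tail 0 y l 0 ((C.gate k).component s O))
          fun s y z => by rw [C.tail_update 0 k z y l _ _ hl'.1], Finset.mul_sum]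
      refine Finset.sum_le_sum fun s _ => ?_
      simp only [mul_pow]
      rw [← Finset.mul_sum]
      have hS : 0 ≤ ∑ y, C.tail 0 y l 0 ((C.gate k).component s O) ^ 2 := by positivity
      have hn : noiseEig e s ^ 2 ≤ κ ^ (2 * weight s) := by
        rw [mul_comm, pow_mul, ← sq_abs]
        exact pow_le_pow_left₀ (abs_nonneg _) (hκ s) 2
      calc _ ≤ κ ^ (2 * weight s) * (κ ^ (2 * (b - weight s)) *
              ∑ y, C.tail 0 y l 0 ((C.gate k).component s O) ^ 2) := by
            refine mul_le_mul hn (ih _ _ hl'.2) (by positivity) (by positivity)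
        _ ≤ _ := by
            rw [← mul_assoc, ← pow_add]
            -- Because of the truncated subtraction, `weight s + (b - weight s)` may exceed `b`;
            -- this only helps, as `κ ≤ 1`.
            exact mul_le_mul_of_nonneg_right (pow_le_pow_of_le_one h0 h1 (by omega)) hS

/-- A nontrivial Pauli anticommutes with exactly two of the three errors, which gives two factors in
[0, 1]. The factor with the larger rate is at most 1 - 2ε. -/
theorem noiseEig_le {e : Fin 3 → ℝ} (he : ∀ i, 0 ≤ e i ∧ e i ≤ 1 / 2) (s : Fin 2 × Fin 2) :
    |noiseEig e s| ≤ (1 - 2 * secondLargest e) ^ weight s := by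
  obtain ⟨a0, b0⟩ := he 0
  obtain ⟨a1, b1⟩ := he 1
  obtain ⟨a2, b2⟩ := he 2
  have key : ∀ u v : ℝ, 0 ≤ u → u ≤ 1 / 2 → 0 ≤ v → v ≤ 1 / 2 → secondLargest e ≤ max u v →
      |(1 - 2 * u) * (1 - 2 * v)| ≤ 1 - 2 * secondLargest e := by
    intro u v hu hu' hv hv' h
    rw [abs_of_nonneg (mul_nonneg (by linarith) (by linarith))]
    rcases le_max_iff.1 h with h | h <;> nlinarith
  -- Of any two of three numbers, one is at least the second largest.
  have l1 : secondLargest e ≤ max (e 0) (e 1) :=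
    max_le ((min_le_left _ _).trans (le_max_left _ _))
      (max_le ((min_le_left _ _).trans (le_max_left _ _)) ((min_le_left _ _).trans (le_max_right _ _)))
  have l2 : secondLargest e ≤ max (e 0) (e 2) :=
    max_le ((min_le_left _ _).trans (le_max_left _ _))
      (max_le ((min_le_left _ _).trans (le_max_left _ _)) ((min_le_right _ _).trans (le_max_right _ _)))
  have l3 : secondLargest e ≤ max (e 1) (e 2) :=
    max_le ((min_le_right _ _).trans (le_max_left _ _))
      (max_le ((min_le_right _ _).trans (le_max_right _ _)) ((min_le_left _ _).trans (le_max_left _ _)))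
  obtain ⟨s1, s2⟩ := s
  fin_cases s1 <;> fin_cases s2
  · simp [noiseEig, weight]
  · simpa [noiseEig, weight] using key _ _ a1 b1 a2 b2 l3
  · simpa [noiseEig, weight] using key _ _ a0 b0 a2 b2 l2
  · simpa [noiseEig, weight] using key _ _ a0 b0 a1 b1 l1

/-! ### Output probabilities -/

theorem onQubit_conjTranspose_mul_self {n : ℕ} (q : Fin n) {M : Matrix (Fin 2) (Fin 2) ℂ}
    (h : M.conjTranspose * M = 1) : (onQubit q M).conjTranspose * onQubit q M = 1 := by
  rw [onQubit_conjTranspose, onQubit_mul, h, onQubit_one]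

theorem trace_conj {n : ℕ} {A : Op n} (h : A.conjTranspose * A = 1) (ρ : Op n) :
    (conj A ρ).trace = ρ.trace := by
  rw [conj, Matrix.trace_mul_comm, ← Matrix.mul_assoc, h, one_mul]

theorem hadamard_conjTranspose_mul_self : hadamard.conjTranspose * hadamard = 1 := by
  have h : ((Real.sqrt 2 : ℝ) : ℂ)⁻¹ * ((Real.sqrt 2 : ℝ) : ℂ)⁻¹ = 1 / 2 := by
    rw [← mul_inv, ← Complex.ofReal_mul, Real.mul_self_sqrt (by norm_num)]
    norm_num
  ext i j
  fin_cases i <;> fin_cases j <;>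
    simp [hadamard, Matrix.mul_apply, Fin.sum_univ_two, h] <;> norm_num

theorem phase_conjTranspose_mul_self : phase.conjTranspose * phase = 1 := by
  ext i j
  fin_cases i <;> fin_cases j <;> simp [phase, Matrix.mul_apply, Fin.sum_univ_two]

theorem cnot_apply_update {n : ℕ} {c t : Fin n} (hct : c ≠ t) (b : Basis n) :
    Function.update (Function.update b t (b t + b c)) t
      (Function.update b t (b t + b c) t + Function.update b t (b t + b c) c) = b := by
  have h : ∀ u v : Fin 2, u + v + v = u := by decide
  rw [Function.update_self, Function.update_of_ne hct, Function.update_idem, h,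
    Function.update_eq_self]

/-- The gate permutes the basis by an involution, so conjugation relabels rows and columns. -/
theorem conj_cnot_apply {n : ℕ} {c t : Fin n} (hct : c ≠ t) (ρ : Op n) (a b : Basis n) :
    conj (cnot c t) ρ a b =
      ρ (Function.update a t (a t + a c)) (Function.update b t (b t + b c)) := by
  have h : ∀ a d : Basis n, cnot c t a d = if Function.update a t (a t + a c) = d then 1 else 0 := by
    intro a d
    rw [cnot, Matrix.of_apply]
    refine if_congr ⟨?_, ?_⟩ rfl rfl
    · rintro rfl; exact cnot_apply_update hct d
    · rintro rfl; exact (cnot_apply_update hct a).symm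
  simp [conj, Matrix.mul_apply, Matrix.conjTranspose_apply, h]

theorem cnot_conjTranspose {n : ℕ} {c t : Fin n} (hct : c ≠ t) :
    (cnot c t).conjTranspose = cnot c t := by
  ext a b
  rw [Matrix.conjTranspose_apply, cnot, Matrix.of_apply, Matrix.of_apply]
  by_cases h : a = Function.update b t (b t + b c)
  · rw [if_pos h, if_pos, star_one]
    rw [h]; exact (cnot_apply_update hct b).symm
  · rw [if_neg h, if_neg, star_zero]
    rintro rfl; exact h (cnot_apply_update hct a).symm

theorem CliffordGate.conjTranspose_mul_self {n : ℕ} (g : CliffordGate n) :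
    g.toOp.conjTranspose * g.toOp = 1 := by
  cases g with
  | H q => exact onQubit_conjTranspose_mul_self q hadamard_conjTranspose_mul_self
  | S q => exact onQubit_conjTranspose_mul_self q phase_conjTranspose_mul_self
  | CNOT c t hct =>
    have h : conj (cnot c t) (1 : Op n) = 1 := by
      ext a b
      rw [conj_cnot_apply hct, Matrix.one_apply, Matrix.one_apply]
      refine if_congr ⟨fun h => ?_, fun h => by rw [h]⟩ rfl rfl
      rw [← cnot_apply_update hct a, ← cnot_apply_update hct b, h]
    rw [conj, mul_one, cnot_conjTranspose hct] at h
    rw [CliffordGate.toOp, cnot_conjTranspose hct, h]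

/-- Positive semidefinite with trace one. -/
def IsState {n : ℕ} (ρ : Op n) : Prop := ρ.PosSemidef ∧ ρ.trace = 1

theorem IsState.conj {n : ℕ} {A ρ : Op n} (hρ : IsState ρ) (h : A.conjTranspose * A = 1) :
    IsState (conj A ρ) :=
  ⟨hρ.1.mul_mul_conjTranspose_same A, (trace_conj h ρ).trans hρ.2⟩

theorem IsState.pauliError {n : ℕ} {ρ : Op n} (hρ : IsState ρ) {e : ℝ} (h0 : 0 ≤ e) (h1 : e ≤ 1)
    {σ : Matrix (Fin 2) (Fin 2) ℂ} (hσ : σ.conjTranspose * σ = 1) (q : Fin n) :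
    IsState (pauliError e σ q ρ) := by
  have h := hρ.conj (onQubit_conjTranspose_mul_self q hσ)
  refine ⟨(hρ.1.smul ?_).add (h.1.smul ?_), ?_⟩
  · exact Complex.zero_le_real.2 (sub_nonneg.2 h1)
  · exact Complex.zero_le_real.2 h0
  · rw [NoisyClifford.pauliError, Matrix.trace_add, Matrix.trace_smul, Matrix.trace_smul, hρ.2, h.2]
    simp

theorem pauliX_conjTranspose_mul_self : pauliX.conjTranspose * pauliX = 1 := by
  ext i j
  fin_cases i <;> fin_cases j <;> simp [pauliX, Matrix.mul_apply, Fin.sum_univ_two]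

theorem pauliY_conjTranspose_mul_self : pauliY.conjTranspose * pauliY = 1 := by
  ext i j
  fin_cases i <;> fin_cases j <;> simp [pauliY, Matrix.mul_apply, Fin.sum_univ_two]

theorem pauliZ_conjTranspose_mul_self : pauliZ.conjTranspose * pauliZ = 1 := by
  ext i j
  fin_cases i <;> fin_cases j <;> simp [pauliZ, Matrix.mul_apply, Fin.sum_univ_two]

theorem pauliXZ_conjTranspose_mul_self (z : Fin 2 × Fin 2) :
    (pauliXZ z).conjTranspose * pauliXZ z = 1 := by
  have h : ∀ z : Fin 2 × Fin 2, z + z = 0 := by decide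
  rw [pauliXZ_conjTranspose, Matrix.smul_mul, pauliXZ_mul, h z, pauliXZ_zero, smul_smul, ← mul_pow]
  simp

theorem IsState.noise {n : ℕ} {ρ : Op n} (hρ : IsState ρ) {e : Fin 3 → ℝ}
    (he : ∀ i, 0 ≤ e i ∧ e i ≤ 1) (q : Fin n) : IsState (noise e q ρ) :=
  ((hρ.pauliError (he 0).1 (he 0).2 pauliZ_conjTranspose_mul_self q).pauliError
    (he 1).1 (he 1).2 pauliX_conjTranspose_mul_self q).pauliError
    (he 2).1 (he 2).2 pauliY_conjTranspose_mul_self q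

theorem unitary_conjTranspose_mul_self (U : Matrix.unitaryGroup (Fin 2) ℂ) :
    U.1.conjTranspose * U.1 = 1 := by
  simpa [Matrix.star_eq_conjTranspose] using (Matrix.mem_unitaryGroup_iff'.1 U.2)

theorem Circuit.isState_stateOf {n m : ℕ} (C : Circuit n m) {e : Fin 3 → ℝ}
    (he : ∀ i, 0 ≤ e i ∧ e i ≤ 1) (y : PauliChoice m) (l : List (Step n m)) :
    IsState (C.stateOf e y l) := by
  induction l with
  | nil =>
    refine ⟨Matrix.PosSemidef.diagonal fun b => ?_, ?_⟩
    · simp only [Pi.zero_apply]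
      split_ifs <;> simp
    · simp [Circuit.stateOf, zeroState, Matrix.trace_diagonal]
  | cons x l ih =>
    cases x with
    | inl g => exact ih.conj g.conjTranspose_mul_self
    | inr k =>
      have hU := onQubit_conjTranspose_mul_self (C.gate k).qubit
        (unitary_conjTranspose_mul_self (C.gate k).U)
      have hP := onQubit_conjTranspose_mul_self (C.gate k).qubit
        (pauliXZ_conjTranspose_mul_self (y k))
      rw [Circuit.stateOf, NoisyGate.apply]
      split_ifs
      · exact ((ih.conj hP).noise he _).conj hU
      · exact ((ih.conj hU).conj hP).noise he _

theorem trace_mul_outcomeProjector {n r : ℕ} (μ : Fin r ↪ Fin n) (x : Basis r) (ρ : Op n) :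
    (ρ * outcomeProjector μ x).trace = ∑ b, if ∀ j, b (μ j) = x j then ρ b b else 0 := by
  simp [Matrix.trace, outcomeProjector, Matrix.mul_diagonal]

theorem IsState.outcome_nonneg {n r : ℕ} {ρ : Op n} (hρ : IsState ρ) (μ : Fin r ↪ Fin n)
    (x : Basis r) : 0 ≤ (ρ * outcomeProjector μ x).trace.re := by
  rw [trace_mul_outcomeProjector, Complex.re_sum]
  refine Finset.sum_nonneg fun b _ => ?_
  split_ifs
  · exact (Complex.le_def.1 hρ.1.diag_nonneg).1
  · simp

theorem IsState.sum_outcome {n r : ℕ} {ρ : Op n} (hρ : IsState ρ) (μ : Fin r ↪ Fin n) :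
    ∑ x, (ρ * outcomeProjector μ x).trace.re = 1 := by
  rw [← Complex.re_sum]
  simp only [trace_mul_outcomeProjector]
  rw [Finset.sum_comm]
  have h : ∀ b : Basis n, (∑ x : Basis r, if ∀ j, b (μ j) = x j then ρ b b else 0) = ρ b b := by
    intro b
    rw [Finset.sum_eq_single fun j => b (μ j)]
    · simp
    · intro x _ hx
      rw [if_neg]
      exact fun h => hx (funext fun j => (h j).symm)
    · simp
  simp only [h]
  have := hρ.2
  rw [Matrix.trace] at this
  simp only [Matrix.diag_apply] at this
  rw [this, Complex.one_re]

/-- Outcome probabilities lie in [0, 1], so their squares do not exceed them. -/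
theorem IsState.sum_sq_outcome_le {n r : ℕ} {ρ : Op n} (hρ : IsState ρ) (μ : Fin r ↪ Fin n) :
    ∑ x, (ρ * outcomeProjector μ x).trace.re ^ 2 ≤ 1 := by
  rw [← hρ.sum_outcome μ]
  refine Finset.sum_le_sum fun x _ => ?_
  have h1 := Finset.single_le_sum (fun x _ => hρ.outcome_nonneg μ x) (Finset.mem_univ x)
  rw [hρ.sum_outcome μ] at h1
  have h0 := hρ.outcome_nonneg μ x
  nlinarith

theorem Circuit.outputProb_eq_tail {n m r : ℕ} (C : Circuit n m) (e : Fin 3 → ℝ)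
    (y : PauliChoice m) (μ : Fin r ↪ Fin n) (x : Basis r) :
    C.outputProb e y μ x = C.tail e y C.steps.reverse 0 (outcomeProjector μ x) := by
  rw [Circuit.outputProb, stateAfter_last, C.tail_zero_add]

theorem Circuit.sum_outputProb {n m r : ℕ} (C : Circuit n m) {e : Fin 3 → ℝ}
    (he : ∀ i, 0 ≤ e i ∧ e i ≤ 1) (y : PauliChoice m) (μ : Fin r ↪ Fin n) :
    ∑ x, |C.outputProb e y μ x| = 1 := by
  have h := C.isState_stateOf he y C.steps.reverse
  simp only [Circuit.outputProb, stateAfter_last, abs_of_nonneg (h.outcome_nonneg μ _)]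
  exact h.sum_outcome μ

theorem secondLargest_le {e : Fin 3 → ℝ} {c : ℝ} (h : ∀ i, e i ≤ c) : secondLargest e ≤ c :=
  max_le ((min_le_left _ _).trans (h 0)) (max_le ((min_le_left _ _).trans (h 0))
    ((min_le_left _ _).trans (h 1)))

/-- The mean square error of the truncation. -/
theorem Circuit.sum_sq_error_le {n m r : ℕ} (C : Circuit n m) {e : Fin 3 → ℝ}
    (he : ∀ i, 0 ≤ e i ∧ e i ≤ 1 / 2) (μ : Fin r ↪ Fin n) (b : ℕ) :
    ∑ y, (∑ x, |C.trunc e y C.steps.reverse b (outcomeProjector μ x) - C.outputProb e y μ x|) ^ 2 ≤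
      2 ^ r * (1 - 2 * secondLargest e) ^ (2 * (b + 1)) * Nat.card (PauliChoice m) := by
  have hs : secondLargest e ≤ 1 / 2 := secondLargest_le fun i => (he i).2
  have hs0 : 0 ≤ secondLargest e := by
    unfold secondLargest
    exact le_max_of_le_left (le_min (he 0).1 (he 1).1)
  have hnd : (noisyGates C.steps.reverse).Nodup := by
    rw [noisyGates, List.filterMap_reverse, ← noisyGates, noisyGates_steps]
    simpa using List.nodup_finRange m
  have h1 : ∀ y x, |C.trunc e y C.steps.reverse b (outcomeProjector μ x) - C.outputProb e y μ x| =
      |C.tail e y C.steps.reverse (b + 1) (outcomeProjector μ x)| := by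
    intro y x
    rw [C.outputProb_eq_tail, ← C.trunc_add_tail e y _ b, ← abs_neg]
    congr 1
    ring
  -- Cauchy–Schwarz over the 2^r outcomes.
  have h2 : ∀ y, (∑ x, |C.tail e y C.steps.reverse (b + 1) (outcomeProjector μ x)|) ^ 2 ≤
      2 ^ r * ∑ x, C.tail e y C.steps.reverse (b + 1) (outcomeProjector μ x) ^ 2 := by
    intro y
    have := sq_sum_le_card_mul_sum_sq (s := (Finset.univ : Finset (Basis r)))
      (f := fun x => |C.tail e y C.steps.reverse (b + 1) (outcomeProjector μ x)|)
    simpa using this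
  -- At rate zero the unrestricted sum is an outcome probability of the noiseless circuit.
  have h3 : ∀ y, ∑ x, C.tail 0 y C.steps.reverse 0 (outcomeProjector μ x) ^ 2 ≤ 1 := by
    intro y
    simp only [C.tail_zero_add]
    exact (C.isState_stateOf (e := 0) (by simp) y _).sum_sq_outcome_le μ
  simp only [h1]
  calc _ ≤ ∑ y, 2 ^ r * ∑ x, C.tail e y C.steps.reverse (b + 1) (outcomeProjector μ x) ^ 2 :=
        Finset.sum_le_sum fun y _ => h2 y
    _ = 2 ^ r * ∑ x, ∑ y, C.tail e y C.steps.reverse (b + 1) (outcomeProjector μ x) ^ 2 := by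
        rw [← Finset.mul_sum, Finset.sum_comm]
    _ ≤ 2 ^ r * ∑ x, (1 - 2 * secondLargest e) ^ (2 * (b + 1)) *
          ∑ y, C.tail 0 y C.steps.reverse 0 (outcomeProjector μ x) ^ 2 := by
        refine mul_le_mul_of_nonneg_left (Finset.sum_le_sum fun x _ => ?_) (by positivity)
        exact C.sum_sq_tail_le e (by linarith) (by linarith) (noiseEig_le he) _ _ _ hnd
    _ = 2 ^ r * (1 - 2 * secondLargest e) ^ (2 * (b + 1)) *
          ∑ y, ∑ x, C.tail 0 y C.steps.reverse 0 (outcomeProjector μ x) ^ 2 := by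
        rw [← Finset.mul_sum, Finset.sum_comm, mul_assoc]
    _ ≤ 2 ^ r * (1 - 2 * secondLargest e) ^ (2 * (b + 1)) * ∑ y : PauliChoice m, 1 := by
        refine mul_le_mul_of_nonneg_left (Finset.sum_le_sum fun y _ => h3 y) ?_
        rw [pow_mul]
        positivity
    _ = _ := by simp [Nat.card_eq_fintype_card]

/-- Chebyshev's inequality for the uniform distribution. -/
theorem card_le_of_sum_sq_le {α : Type*} [Fintype α] (f : α → ℝ) {δ η : ℝ} (hδ : 0 < δ)
    (hf : ∑ a, f a ^ 2 ≤ δ ^ 2 * η * Nat.card α) :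
    (1 - η) * (Nat.card α : ℝ) ≤ (Nat.card {a : α // f a ≤ δ} : ℝ) := by
  classical
  rw [Nat.card_eq_fintype_card, Nat.card_eq_fintype_card, Fintype.card_subtype]
  rw [Nat.card_eq_fintype_card, ← Finset.card_univ] at hf
  rw [← Finset.card_univ]
  have h1 := Finset.card_filter_add_card_filter_not (s := (Finset.univ : Finset α)) (fun a => f a ≤ δ)
  have h1' : ((Finset.univ.filter fun a => f a ≤ δ).card : ℝ) +
      ((Finset.univ.filter fun a => ¬ f a ≤ δ).card : ℝ) = (Finset.univ : Finset α).card := by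
    exact_mod_cast h1
  have h2 : ((Finset.univ.filter fun a => ¬ f a ≤ δ).card : ℝ) * δ ^ 2 ≤ ∑ a, f a ^ 2 := by
    rw [← nsmul_eq_mul]
    refine (Finset.card_nsmul_le_sum _ (fun a => f a ^ 2) _ fun a ha => ?_).trans
      (Finset.sum_le_sum_of_subset_of_nonneg (Finset.filter_subset _ _) fun _ _ _ => by positivity)
    have := (Finset.mem_filter.1 ha).2
    exact pow_le_pow_left₀ hδ.le (not_le.1 this).le 2
  have h3 : ((Finset.univ.filter fun a => ¬ f a ≤ δ).card : ℝ) ≤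
      η * (Finset.univ : Finset α).card := by
    have hδ2 : 0 < δ ^ 2 := by positivity
    refine le_of_mul_le_mul_right ?_ hδ2
    calc _ ≤ _ := h2
      _ ≤ _ := hf
      _ = _ := by ring
  linarith

end
end NoisyClifford

namespace NoisyClifford
noncomputable section

/-! ### Pauli strings -/

/-- The Hermitian Pauli matrix with given `X`-bit and `Z`-bit. -/
def pauliMat (p : Fin 2 × Fin 2) : Matrix (Fin 2) (Fin 2) ℂ :=
  !![1 - (p.1 : ℕ), (p.1 : ℕ) * (1 - (p.2 : ℕ)) - (p.1 : ℕ) * (p.2 : ℕ) * Complex.I;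
    (p.1 : ℕ) * (1 - (p.2 : ℕ)) + (p.1 : ℕ) * (p.2 : ℕ) * Complex.I,
    (1 - (p.1 : ℕ)) * (1 - 2 * (p.2 : ℕ))]

theorem pauliMat_zero : pauliMat 0 = 1 := by
  ext i j; fin_cases i <;> fin_cases j <;> simp [pauliMat]

theorem pauliMat_conjTranspose (p : Fin 2 × Fin 2) : (pauliMat p).conjTranspose = pauliMat p := by
  obtain ⟨x, z⟩ := p
  ext i j
  fin_cases x <;> fin_cases z <;> fin_cases i <;> fin_cases j <;> simp [pauliMat]

theorem trace_pauliMat (p : Fin 2 × Fin 2) : (pauliMat p).trace = if p = 0 then 2 else 0 := by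
  obtain ⟨x, z⟩ := p
  fin_cases x <;> fin_cases z <;> simp [pauliMat, Matrix.trace_fin_two] <;> norm_num

theorem pauliXZ_conj_pauliMat (z p : Fin 2 × Fin 2) :
    pauliXZ z * pauliMat p * (pauliXZ z).conjTranspose = (sign p z : ℂ) • pauliMat p := by
  obtain ⟨z1, z2⟩ := z
  obtain ⟨p1, p2⟩ := p
  ext i j
  fin_cases z1 <;> fin_cases z2 <;> fin_cases p1 <;> fin_cases p2 <;> fin_cases i <;>
    fin_cases j <;> simp [pauliMat, pauliXZ, pauliX, pauliZ, sign, intSign, Matrix.mul_apply,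
      Fin.sum_univ_two, Matrix.vecHead, Matrix.vecTail] <;> norm_num

/-- The entries of the Pauli matrices. -/
def pauliEntry (p : Fin 2 × Fin 2) (a b : Fin 2) : GaussianInt :=
  if a = b + p.1 then
    if p = (1, 1) then (if a = 0 then ⟨0, -1⟩ else ⟨0, 1⟩) else if p.2 = 1 ∧ b = 1 then -1 else 1
  else 0

theorem pauliMat_apply (p : Fin 2 × Fin 2) (a b : Fin 2) :
    pauliMat p a b = GaussianInt.toComplex (pauliEntry p a b) := by
  obtain ⟨x, z⟩ := p
  fin_cases x <;> fin_cases z <;> fin_cases a <;> fin_cases b <;>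
    simp [pauliMat, pauliEntry, GaussianInt.toComplex_def]
  norm_num

/-- The action of CNOT on all two-qubit Paulis, entry by entry. Gaussian integers have decidable
equality, so this is a finite check. -/
theorem pauliEntry_cnot : ∀ (p q : Fin 2 × Fin 2) (a a' b b' : Fin 2),
    pauliEntry p a b * pauliEntry q (a' + a) (b' + b) =
      (if p.1 = 1 ∧ q.2 = 1 ∧ q.1 = p.2 then -1 else 1) *
        (pauliEntry (p.1, p.2 + q.2) a b * pauliEntry (q.1 + p.1, q.2) a' b') := by
  decide +kernel

/-- The coefficients of a Hermitian matrix in the Pauli basis. -/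
theorem sum_pauliMat {M : Matrix (Fin 2) (Fin 2) ℂ} (hM : M.conjTranspose = M) :
    M = ∑ s, ((1 / 2 * (pauliMat s * M).trace.re : ℝ) : ℂ) • pauliMat s := by
  have h : ∀ i j, (starRingEnd ℂ) (M j i) = M i j := fun i j => congrFun (congrFun hM i) j
  have h00 := congrArg Complex.im (h 0 0)
  have h11 := congrArg Complex.im (h 1 1)
  have hr := congrArg Complex.re (h 0 1)
  have hi := congrArg Complex.im (h 0 1)
  simp only [Complex.conj_re, Complex.conj_im] at h00 h11 hr hi
  ext i j
  fin_cases i <;> fin_cases j <;>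
    simp [pauliMat, Fintype.sum_prod_type, Matrix.trace_fin_two,
      Matrix.vecMul, Matrix.vecHead, Matrix.vecTail, Complex.ext_iff] <;>
    constructor <;> linarith

/-- The matrix of conjugation with a unitary in the Pauli basis. -/
def rotation (U : Matrix (Fin 2) (Fin 2) ℂ) (p s : Fin 2 × Fin 2) : ℝ :=
  1 / 2 * (pauliMat s * (U.conjTranspose * pauliMat p * U)).trace.re

theorem rotation_spec (U : Matrix (Fin 2) (Fin 2) ℂ) (p : Fin 2 × Fin 2) :
    U.conjTranspose * pauliMat p * U = ∑ s, (rotation U p s : ℂ) • pauliMat s :=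
  sum_pauliMat (by
    simp [Matrix.conjTranspose_mul, pauliMat_conjTranspose, Matrix.mul_assoc])

theorem rotation_zero_left (U : Matrix.unitaryGroup (Fin 2) ℂ) (s : Fin 2 × Fin 2) :
    rotation U.1 0 s = if s = 0 then 1 else 0 := by
  rw [rotation, pauliMat_zero, mul_one, unitary_conjTranspose_mul_self, mul_one, trace_pauliMat]
  split_ifs <;> simp

/-- Conjugation preserves the trace, and of the Pauli matrices only the identity has nonzero trace.
Together with `rotation_zero_left`, a path is nontrivial before a noisy gate exactly if it is
nontrivial after it. -/
theorem rotation_zero_right (U : Matrix.unitaryGroup (Fin 2) ℂ) {p : Fin 2 × Fin 2} (hp : p ≠ 0) :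
    rotation U.1 p 0 = 0 := by
  have h : U.1 * U.1.conjTranspose = 1 := by
    simpa [Matrix.star_eq_conjTranspose] using (Matrix.mem_unitaryGroup_iff.1 U.2)
  rw [rotation, pauliMat_zero, one_mul, Matrix.trace_mul_comm, ← Matrix.mul_assoc, h, one_mul,
    trace_pauliMat, if_neg hp]
  simp

/-- A tensor product of Pauli matrices. -/
def pstr {n : ℕ} (P : Fin n → Fin 2 × Fin 2) : Op n := tens fun j => pauliMat (P j)

theorem pstr_update {n : ℕ} (P : Fin n → Fin 2 × Fin 2) (q : Fin n) (s : Fin 2 × Fin 2) :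
    pstr (Function.update P q s) = tens (Function.update (fun j => pauliMat (P j)) q (pauliMat s)) := by
  rw [pstr]
  congr 1
  funext j
  by_cases h : j = q
  · subst h; simp
  · simp [Function.update_of_ne h]

theorem tens_update_smul {n : ℕ} (A : Fin n → Matrix (Fin 2) (Fin 2) ℂ) (q : Fin n) (c : ℂ)
    (M : Matrix (Fin 2) (Fin 2) ℂ) :
    tens (Function.update A q (c • M)) = c • tens (Function.update A q M) := by
  ext a b
  rw [Matrix.smul_apply, tens_update_apply, tens_update_apply, Matrix.smul_apply, smul_eq_mul,
    smul_eq_mul, mul_assoc]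

theorem tens_update_sum {n : ℕ} {ι : Type*} (A : Fin n → Matrix (Fin 2) (Fin 2) ℂ) (q : Fin n)
    (t : Finset ι) (M : ι → Matrix (Fin 2) (Fin 2) ℂ) :
    tens (Function.update A q (∑ i ∈ t, M i)) = ∑ i ∈ t, tens (Function.update A q (M i)) := by
  ext a b
  rw [Matrix.sum_apply, tens_update_apply, Matrix.sum_apply, Finset.sum_mul]
  simp only [tens_update_apply]

theorem pconj_pstr {n : ℕ} (q : Fin n) (z : Fin 2 × Fin 2) (P : Fin n → Fin 2 × Fin 2) :
    pconj q z (pstr P) = (sign (P q) z : ℂ) • pstr P := by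
  rw [pconj, pstr, conj_onQubit_tens, pauliXZ_conj_pauliMat, tens_update_smul,
    Function.update_eq_self_iff.2 rfl]

theorem proj_pstr {n : ℕ} (q : Fin n) (s : Fin 2 × Fin 2) (P : Fin n → Fin 2 × Fin 2) :
    proj q s (pstr P) = if P q = s then pstr P else 0 := by
  simp only [proj, pconj_pstr, smul_smul]
  rw [← Finset.sum_smul]
  have h := congrArg (Complex.ofReal) (sum_sign_mul_sign s (P q))
  push_cast at h
  rw [h, smul_smul]
  by_cases hs : P q = s
  · simp [hs]
  · rw [if_neg hs, if_neg (Ne.symm hs)]; simp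

theorem conj_unitary_pstr {n : ℕ} (q : Fin n) (U : Matrix (Fin 2) (Fin 2) ℂ)
    (P : Fin n → Fin 2 × Fin 2) : conj (onQubit q U.conjTranspose) (pstr P) =
      ∑ s, (rotation U (P q) s : ℂ) • pstr (Function.update P q s) := by
  rw [pstr, conj_onQubit_tens, Matrix.conjTranspose_conjTranspose, rotation_spec, tens_update_sum]
  simp only [tens_update_smul, pstr_update]

/-- Observables travel backwards. If the Pauli precedes the unitary in the circuit, `s` is the
operator that leaves the unitary in this direction; otherwise it is the one that enters. -/
theorem NoisyGate.component_pstr {n : ℕ} (g : NoisyGate n) (s : Fin 2 × Fin 2)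
    (P : Fin n → Fin 2 × Fin 2) : g.component s (pstr P) = if g.pauliFirst then
      (rotation g.U.1 (P g.qubit) s : ℂ) • pstr (Function.update P g.qubit s)
      else if P g.qubit = s then
        ∑ t, (rotation g.U.1 s t : ℂ) • pstr (Function.update P g.qubit t) else 0 := by
  rw [NoisyGate.component]
  split_ifs with h1 h2
  · have hsum : ∀ f : Fin 2 × Fin 2 → Op n, proj g.qubit s (∑ t, f t) =
        ∑ t, proj g.qubit s (f t) := fun f => by
      simp only [proj, pconj, conj_sum, Finset.smul_sum]
      rw [Finset.sum_comm]
    rw [conj_unitary_pstr, hsum]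
    simp only [proj_smul, proj_pstr, Function.update_self]
    simp
  · rw [proj_pstr, if_pos h2, conj_unitary_pstr, h2]
  · rw [proj_pstr, if_neg h2]
    simp [conj]

/-- The action of a Clifford gate on Pauli strings in the Heisenberg picture, up to the sign. -/
def CliffordGate.act {n : ℕ} : CliffordGate n → (Fin n → Fin 2 × Fin 2) → Fin n → Fin 2 × Fin 2
  | .H q, P => Function.update P q ((P q).2, (P q).1)
  | .S q, P => Function.update P q ((P q).1, (P q).1 + (P q).2)
  | .CNOT c t _, P => Function.update (Function.update P c ((P c).1, (P c).2 + (P t).2)) t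
      ((P t).1 + (P c).1, (P t).2)

/-- The negative cases are H†YH = -Y, S†XS = -Y, and for CNOT the exchange of X⊗Z and Y⊗Y (control
first). -/
def CliffordGate.actSign {n : ℕ} : CliffordGate n → (Fin n → Fin 2 × Fin 2) → ℝ
  | .H q, P => if P q = (1, 1) then -1 else 1
  | .S q, P => if P q = (1, 0) then -1 else 1
  | .CNOT c t _, P => if (P c).1 = 1 ∧ (P t).2 = 1 ∧ (P t).1 = (P c).2 then -1 else 1

theorem hadamard_conj_pauliMat (p : Fin 2 × Fin 2) :
    hadamard.conjTranspose * pauliMat p * hadamard =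
      (if p = (1, 1) then -1 else 1 : ℂ) • pauliMat (p.2, p.1) := by
  have h : ((Real.sqrt 2 : ℝ) : ℂ)⁻¹ * ((Real.sqrt 2 : ℝ) : ℂ)⁻¹ = 1 / 2 := by
    rw [← mul_inv, ← Complex.ofReal_mul, Real.mul_self_sqrt (by norm_num)]
    norm_num
  have hh : hadamard.conjTranspose = hadamard := by
    ext i j
    fin_cases i <;> fin_cases j <;> simp [hadamard]
  rw [hh, hadamard, Matrix.smul_mul, Matrix.smul_mul, Matrix.mul_smul, smul_smul, h]
  obtain ⟨x, z⟩ := p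
  ext i j
  fin_cases x <;> fin_cases z <;> fin_cases i <;> fin_cases j <;>
    simp [pauliMat, Matrix.vecHead, Matrix.vecTail] <;> ring

theorem phase_conj_pauliMat (p : Fin 2 × Fin 2) :
    phase.conjTranspose * pauliMat p * phase =
      (if p = (1, 0) then -1 else 1 : ℂ) • pauliMat (p.1, p.1 + p.2) := by
  obtain ⟨x, z⟩ := p
  ext i j
  fin_cases x <;> fin_cases z <;> fin_cases i <;> fin_cases j <;>
    simp [pauliMat, phase, Matrix.mul_apply, Fin.sum_univ_two]
  linear_combination Complex.I_mul_I

theorem CliffordGate.conj_pstr {n : ℕ} (g : CliffordGate n) (P : Fin n → Fin 2 × Fin 2) :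
    conj g.toOp.conjTranspose (pstr P) = (g.actSign P : ℂ) • pstr (g.act P) := by
  cases g with
  | H q =>
    rw [CliffordGate.toOp, onQubit_conjTranspose, pstr, conj_onQubit_tens,
      Matrix.conjTranspose_conjTranspose, hadamard_conj_pauliMat, tens_update_smul, CliffordGate.act,
      pstr_update, CliffordGate.actSign]
    split_ifs <;> simp
  | S q =>
    rw [CliffordGate.toOp, onQubit_conjTranspose, pstr, conj_onQubit_tens,
      Matrix.conjTranspose_conjTranspose, phase_conj_pauliMat, tens_update_smul, CliffordGate.act,
      pstr_update, CliffordGate.actSign]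
    split_ifs <;> simp
  | CNOT c t hct =>
    rw [CliffordGate.toOp, cnot_conjTranspose hct]
    ext a b
    rw [conj_cnot_apply hct, Matrix.smul_apply, smul_eq_mul]
    have hc : c ∈ Finset.univ.erase t := Finset.mem_erase.2 ⟨hct, Finset.mem_univ c⟩
    simp only [pstr, tens, Matrix.of_apply]
    rw [← Finset.mul_prod_erase _ _ (Finset.mem_univ t), ← Finset.mul_prod_erase _ _ hc,
      ← Finset.mul_prod_erase (a := t) _ _ (Finset.mem_univ t), ← Finset.mul_prod_erase _ _ hc]
    simp only [CliffordGate.act, Function.update_self, Function.update_of_ne hct]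
    have hrest : ∀ j ∈ (Finset.univ.erase t).erase c,
        pauliMat (P j) (Function.update a t (a t + a c) j) (Function.update b t (b t + b c) j) =
        pauliMat (Function.update (Function.update P c ((P c).1, (P c).2 + (P t).2)) t
          ((P t).1 + (P c).1, (P t).2) j) (a j) (b j) := by
      intro j hj
      have h1 := Finset.ne_of_mem_erase hj
      have h2 := Finset.ne_of_mem_erase (Finset.mem_of_mem_erase hj)
      simp only [Function.update_of_ne h1, Function.update_of_ne h2]
    rw [Finset.prod_congr rfl hrest, ← mul_assoc, ← mul_assoc, ← mul_assoc]
    congr 1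
    -- All other tensor factors agree by `hrest`; the entries at control and target are those of the
    -- finite check.
    have key := congrArg GaussianInt.toComplex (pauliEntry_cnot (P c) (P t) (a c) (a t) (b c) (b t))
    rw [map_mul, map_mul, map_mul, ← pauliMat_apply, ← pauliMat_apply, ← pauliMat_apply,
      ← pauliMat_apply] at key
    rw [mul_comm, key, CliffordGate.actSign]
    split_ifs <;> simp <;> ring

/-- The trace is the product of the upper left entries, which are 1 for the identity and `Z`, and 0
for `X` and `Y`. -/
theorem trace_zeroState_mul_pstr {n : ℕ} (P : Fin n → Fin 2 × Fin 2) :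
    (zeroState n * pstr P).trace.re = if ∀ j, (P j).1 = 0 then 1 else 0 := by
  have h : (zeroState n * pstr P).trace = ∏ j, pauliMat (P j) 0 0 := by
    simp [Matrix.trace, zeroState, Matrix.diagonal_mul, pstr, tens]
  have h0 : ∀ p : Fin 2 × Fin 2, pauliMat p 0 0 = if p.1 = 0 then 1 else 0 := by
    rintro ⟨x, z⟩
    fin_cases x <;> simp [pauliMat]
  rw [h]
  simp only [h0]
  split_ifs with hP
  · simp [hP]
  · push Not at hP
    obtain ⟨j, hj⟩ := hP
    rw [Finset.prod_eq_zero (Finset.mem_univ j) (if_neg hj), Complex.zero_re]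

/-! ### Sums over Pauli paths -/

/-- A Pauli string with a coefficient and the choices for the next nontrivial noisy gates. -/
structure Config (n : ℕ) where
  str : Fin n → Fin 2 × Fin 2
  w : ℝ
  digits : List (Fin 2 × Fin 2)

/-- The coefficient for passing from the Pauli operator `p` to `s` at a noisy gate. -/
def NoisyGate.coeff {n : ℕ} (g : NoisyGate n) (e : Fin 3 → ℝ) (y p s : Fin 2 × Fin 2) : ℝ :=
  noiseEig e (if g.pauliFirst then s else p) * sign (if g.pauliFirst then s else p) y *
    rotation g.U.1 p s

/-- A trivial Pauli passes a noisy gate unchanged and uses no digit. Otherwise the next digit is the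
new Pauli. A missing digit is read as `0`; then `rotation_zero_right` makes the coefficient zero, so
lists that are too short contribute nothing. Lists that are too long are excluded by `Config.value`.
-/
def Circuit.stepConfig {n m : ℕ} (C : Circuit n m) (e : Fin 3 → ℝ) (y : PauliChoice m) :
    Step n m → Config n → Config n
  | .inl g, c => ⟨g.act c.str, g.actSign c.str * c.w, c.digits⟩
  | .inr k, c => if c.str (C.gate k).qubit = 0 then c else
      ⟨Function.update c.str (C.gate k).qubit (c.digits.headD 0),
        (C.gate k).coeff e (y k) (c.str (C.gate k).qubit) (c.digits.headD 0) * c.w, c.digits.tail⟩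

def Circuit.runConfig {n m : ℕ} (C : Circuit n m) (e : Fin 3 → ℝ) (y : PauliChoice m) :
    List (Step n m) → Config n → Config n
  | [], c => c
  | x :: l, c => C.runConfig e y l (C.stepConfig e y x c)

/-- The contribution of a path. -/
def Config.value {n : ℕ} (c : Config n) : ℝ :=
  if c.digits = [] ∧ ∀ j, (c.str j).1 = 0 then c.w else 0

/-- All lists of at most `b` nontrivial Pauli operators. -/
def digitLists : ℕ → List (List (Fin 2 × Fin 2))
  | 0 => [[]]
  | b + 1 => [] :: ((digitLists b).map (List.cons (0, 1)) ++
      ((digitLists b).map (List.cons (1, 0)) ++ (digitLists b).map (List.cons (1, 1))))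

/-- The geometric sum 1 + 3 + ⋯ + 3^b, without division. -/
theorem length_digitLists (b : ℕ) : 2 * (digitLists b).length + 1 = 3 ^ (b + 1) := by
  induction b with
  | zero => rfl
  | succ b ih =>
    simp only [digitLists, List.length_cons, List.length_append, List.length_map]
    rw [pow_succ, ← ih]
    ring

theorem length_le_of_mem_digitLists : ∀ (b : ℕ) (d : List (Fin 2 × Fin 2)),
    d ∈ digitLists b → d.length ≤ b := by
  intro b
  induction b with
  | zero => simp [digitLists]
  | succ b ih =>
    intro d hd
    simp only [digitLists, List.mem_cons, List.mem_append, List.mem_map] at hd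
    rcases hd with rfl | ⟨d, h, rfl⟩ | ⟨d, h, rfl⟩ | ⟨d, h, rfl⟩ <;> simp <;> exact ih d h

theorem Circuit.value_runConfig_zero {n m : ℕ} (C : Circuit n m) (e : Fin 3 → ℝ)
    (y : PauliChoice m) (l : List (Step n m)) : ∀ c : Config n, c.w = 0 →
    (C.runConfig e y l c).value = 0 := by
  induction l with
  | nil => intro c hc; simp [Circuit.runConfig, Config.value, hc]
  | cons x l ih =>
    intro c hc
    refine ih _ ?_
    cases x with
    | inl g => simp [Circuit.stepConfig, hc]
    | inr k =>
      simp only [Circuit.stepConfig]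
      split_ifs <;> simp [hc]

theorem noiseEig_zero_right (e : Fin 3 → ℝ) : noiseEig e 0 = 1 := by
  simp [noiseEig]

/-- The sum over all paths is the truncated expectation value. -/
theorem Circuit.sum_value_runConfig {n m : ℕ} (C : Circuit n m) (e : Fin 3 → ℝ)
    (y : PauliChoice m) (l : List (Step n m)) : ∀ (b : ℕ) (P : Fin n → Fin 2 × Fin 2) (w : ℝ),
    ((digitLists b).map fun d => (C.runConfig e y l ⟨P, w, d⟩).value).sum =
      w * C.trunc e y l b (pstr P) := by
  induction l with
  | nil =>
    intro b P w
    simp only [Circuit.runConfig, Circuit.trunc, trace_zeroState_mul_pstr, Config.value]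
    -- With no gates left, only the empty list has used up its digits.
    cases b with
    | zero => simp [digitLists]
    | succ b => simp [digitLists, Function.comp_def]
  | cons x l ih =>
    intro b P w
    cases x with
    | inl g =>
      simp only [Circuit.runConfig, Circuit.stepConfig, ih, Circuit.trunc, g.conj_pstr, C.trunc_smul]
      ring
    | inr k =>
      set g := C.gate k with hg
      simp only [Circuit.runConfig, Circuit.stepConfig, Circuit.trunc, ← hg]
      by_cases hP : P g.qubit = 0
      · simp only [hP, if_true, ih]
        -- A trivial Pauli has only the component `0`, which has weight zero and eigenvalue one, so
        -- the budget remains `b`.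
        rw [Finset.sum_eq_single 0]
        · have hc : g.component 0 (pstr P) = pstr P := by
            rw [g.component_pstr, hP]
            have h0 : Function.update P g.qubit 0 = P := by rw [← hP, Function.update_eq_self]
            simp [rotation_zero_left, h0]
          simp [hc, weight, noiseEig_zero_right, sign_zero_left]
        · intro s _ hs
          have hc : g.component s (pstr P) = 0 := by
            rw [g.component_pstr, hP]
            simp [rotation_zero_left, hs, Ne.symm hs]
          simp [hc, C.trunc_zero]
        · simp
      · simp only [if_neg hP]
        -- The empty list meets a nontrivial gate and dies.
        have h0 : (C.runConfig e y l ⟨Function.update P g.qubit 0,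
            g.coeff e (y k) (P g.qubit) 0 * w, []⟩).value = 0 :=
          C.value_runConfig_zero e y l _ (by simp [NoisyGate.coeff, rotation_zero_right g.U hP])
        have hT : ∀ f : Fin 2 × Fin 2 → ℝ, f 0 = 0 →
            ∑ s, f s = f (0, 1) + (f (1, 0) + f (1, 1)) := by
          intro f hf
          rw [Fintype.sum_prod_type, Fin.sum_univ_two, Fin.sum_univ_two, Fin.sum_univ_two]
          have : f (0, 0) = 0 := hf
          rw [this]; ring
        have hz : g.component 0 (pstr P) = 0 := by
          rw [g.component_pstr]
          simp [rotation_zero_right g.U hP, hP]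
        rw [hT _ (by simp [hz, C.trunc_zero])]
        cases b with
        | zero => simp [digitLists, h0, weight]
        | succ b =>
          have h1 : ∀ s : Fin 2 × Fin 2, s ≠ 0 → ¬ b + 1 < weight s ∧ b + 1 - weight s = b := by
            intro s hs
            simp [weight, hs]
          simp only [digitLists, List.map_cons, List.map_append, List.map_map, Function.comp_def,
            List.sum_cons, List.sum_append, List.headD_cons, List.tail_cons, List.headD_nil,
            List.tail_nil, ih, h0, zero_add]
          rw [if_neg (h1 _ (by decide)).1, if_neg (h1 _ (by decide)).1, if_neg (h1 _ (by decide)).1,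
            (h1 _ (by decide)).2, (h1 _ (by decide)).2, (h1 _ (by decide)).2]
          by_cases hf : g.pauliFirst = true
          -- Here the component `s` consists of one string, so the components correspond to the
          -- digits.
          · simp only [g.component_pstr, if_pos hf, C.trunc_smul, NoisyGate.coeff]
            ring
          · have hsum : ∀ s, C.trunc e y l b (∑ t, (rotation g.U.1 s t : ℂ) •
                pstr (Function.update P g.qubit t)) =
                ∑ t, rotation g.U.1 s t * C.trunc e y l b (pstr (Function.update P g.qubit t)) := by
              intro s
              rw [C.trunc_sum]
              simp only [C.trunc_smul]
            -- Here only the component of the incoming Pauli is nonzero, and the digits number the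
            -- terms of its image under the unitary. The budget drops by one in both cases.
            rw [← hT (fun s => noiseEig e s * sign s (y k) * C.trunc e y l b
              (g.component s (pstr P))) (by simp [hz, C.trunc_zero]), Finset.sum_eq_single (P g.qubit)]
            · simp only [g.component_pstr, if_neg hf, if_true, hsum]
              rw [hT _ (by simp [rotation_zero_right g.U hP])]
              simp only [NoisyGate.coeff, if_neg hf]
              ring
            · intro s _ hs
              simp [g.component_pstr, hf, Ne.symm hs, C.trunc_zero]
            · simp

/-! ### The measured observable as a sum of Pauli strings -/

/-- Multiplying the Pauli `Z` on the measured qubit `j` to a string if `a j = 1`, with the sign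
of the outcome. -/
def measureStep {n r : ℕ} (μ : Fin r ↪ Fin n) (x a : Basis r)
    (c : (Fin n → Fin 2 × Fin 2) × ℝ) (j : Fin r) : (Fin n → Fin 2 × Fin 2) × ℝ :=
  if a j = 1 then (Function.update c.1 (μ j) (0, 1), if x j = 1 then -c.2 else c.2) else c

/-- The Pauli string of a Fourier mode of the outcome projector, with its coefficient. -/
def measured {n r : ℕ} (μ : Fin r ↪ Fin n) (x a : Basis r) : (Fin n → Fin 2 × Fin 2) × ℝ :=
  (List.finRange r).foldl (measureStep μ x a) (0, (1 / 2) ^ r)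

theorem foldl_measureStep {n r : ℕ} (μ : Fin r ↪ Fin n) (x a : Basis r) (l : List (Fin r)) :
    ∀ c, ((l.foldl (measureStep μ x a) c).1 =
      fun q => if ∃ j ∈ l, μ j = q ∧ a j = 1 then (0, 1) else c.1 q) ∧
    (l.foldl (measureStep μ x a) c).2 =
      (l.map fun j => if a j = 1 ∧ x j = 1 then (-1 : ℝ) else 1).prod * c.2 := by
  induction l with
  | nil => intro c; simp
  | cons i l ih =>
    intro c
    rw [List.foldl_cons, (ih _).1, (ih _).2]
    constructor
    · funext q
      by_cases h : ∃ j ∈ l, μ j = q ∧ a j = 1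
      · rw [if_pos h, if_pos]
        obtain ⟨j, hj, h⟩ := h
        exact ⟨j, List.mem_cons_of_mem _ hj, h⟩
      · rw [if_neg h]
        by_cases hi : μ i = q ∧ a i = 1
        · rw [if_pos ⟨i, List.mem_cons_self, hi⟩, measureStep, if_pos hi.2, ← hi.1]
          simp
        · rw [if_neg]
          · rw [measureStep]
            by_cases ha : a i = 1
            · have : q ≠ μ i := fun hq => hi ⟨hq.symm, ha⟩
              rw [if_pos ha]; exact Function.update_of_ne this _ _
            · rw [if_neg ha]
          · rintro ⟨j, hj, hjq⟩
            rcases List.mem_cons.1 hj with rfl | hj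
            · exact hi hjq
            · exact h ⟨j, hj, hjq⟩
    · rw [List.map_cons, List.prod_cons, measureStep]
      by_cases ha : a i = 1 <;> by_cases hx : x i = 1 <;> simp [ha, hx]

theorem measured_snd {n r : ℕ} (μ : Fin r ↪ Fin n) (x a : Basis r) :
    ((measured μ x a).2 : ℂ) =
      (∏ j, if a j = 1 ∧ x j = 1 then (-1 : ℂ) else 1) * ∏ _j : Fin r, (1 / 2) := by
  have := (foldl_measureStep μ x a (List.finRange r) (0, (1 / 2) ^ r)).2
  rw [← measured, ← List.ofFn_eq_map, List.prod_ofFn] at this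
  rw [this]
  simp only [Complex.ofReal_mul, Complex.ofReal_prod, apply_ite Complex.ofReal]
  simp

theorem pstr_measured_apply {n r : ℕ} (μ : Fin r ↪ Fin n) (x a : Basis r) (b b' : Basis n) :
    pstr (measured μ x a).1 b b' =
      if b = b' then ∏ j, (if a j = 1 ∧ b (μ j) = 1 then (-1 : ℂ) else 1) else 0 := by
  have h1 := (foldl_measureStep μ x a (List.finRange r) (0, (1 / 2) ^ r)).1
  rw [← measured] at h1
  rw [h1, pstr, tens, Matrix.of_apply]
  have e0 : ∀ u v : Fin 2, pauliMat (0, 1) u v = if u = v then (if u = 1 then -1 else 1) else 0 := by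
    intro u v
    fin_cases u <;> fin_cases v <;> simp [pauliMat]
    norm_num
  have e1 : ∀ u v : Fin 2, pauliMat 0 u v = if u = v then 1 else 0 := by
    intro u v
    rw [pauliMat_zero, Matrix.one_apply]
  have e2 : ∀ (c : Prop) [Decidable c] (u v : Fin 2),
      pauliMat (if c then (0, 1) else (0 : Fin 2 × Fin 2)) u v =
        if u = v then (if c ∧ u = 1 then -1 else 1) else 0 := by
    intro c _ u v
    by_cases hc : c
    · simp only [hc, if_true, e0, true_and]
    · simp only [hc, if_false, e1, false_and]
  simp only [Pi.zero_apply, e2]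
  split_ifs with hb
  · subst hb
    symm
    -- Unmeasured qubits contribute the factor 1, and distinct `j` belong to distinct qubits.
    refine Fintype.prod_of_injective μ μ.injective _ _ ?_ ?_
    · intro q hq
      rw [if_pos rfl, if_neg]
      rintro ⟨⟨j, _, hj, _⟩, _⟩
      exact hq ⟨j, hj⟩
    · intro i
      simp
  · obtain ⟨q, hq⟩ := Function.ne_iff.1 hb
    exact Finset.prod_eq_zero (Finset.mem_univ q) (if_neg hq)

/-- The projector is the product over `j` of (1 + (-1)^(x j) Z)/2 on qubit `μ j`; multiplying out
gives one string for each `a`. -/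
theorem outcomeProjector_eq_sum {n r : ℕ} (μ : Fin r ↪ Fin n) (x : Basis r) :
    outcomeProjector μ x =
      ∑ a : Basis r, ((measured μ x a).2 : ℂ) • pstr (measured μ x a).1 := by
  ext b b'
  rw [Matrix.sum_apply]
  simp only [Matrix.smul_apply, pstr_measured_apply, smul_eq_mul]
  rw [outcomeProjector, Matrix.diagonal_apply]
  split_ifs with hb h
  · simp only [measured_snd, ← Finset.prod_mul_distrib]
    have h3 := Finset.prod_univ_sum (fun _ : Fin r => (Finset.univ : Finset (Fin 2)))
      (fun j u => (if u = 1 ∧ x j = 1 then (-1 : ℂ) else 1) * (1 / 2) *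
        (if u = 1 ∧ b (μ j) = 1 then (-1 : ℂ) else 1))
    rw [Fintype.piFinset_univ] at h3
    rw [← h3]
    symm
    refine Finset.prod_eq_one fun j _ => ?_
    rw [h j, Fin.sum_univ_two]
    split_ifs <;> norm_num at *
  · simp only [measured_snd, ← Finset.prod_mul_distrib]
    have h3 := Finset.prod_univ_sum (fun _ : Fin r => (Finset.univ : Finset (Fin 2)))
      (fun j u => (if u = 1 ∧ x j = 1 then (-1 : ℂ) else 1) * (1 / 2) *
        (if u = 1 ∧ b (μ j) = 1 then (-1 : ℂ) else 1))
    rw [Fintype.piFinset_univ] at h3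
    rw [← h3]
    symm
    push Not at h
    obtain ⟨j, hj⟩ := h
    refine Finset.prod_eq_zero (Finset.mem_univ j) ?_
    -- At a qubit with the wrong bit the factor is 1/2 - 1/2.
    have h4 : (x j = 1 ∧ b (μ j) ≠ 1) ∨ (x j ≠ 1 ∧ b (μ j) = 1) := by omega
    rw [Fin.sum_univ_two]
    rcases h4 with h4 | h4 <;> simp [h4.1, h4.2]
  · simp

end
end NoisyClifford

namespace NoisyClifford
noncomputable section

/-! ### The code for a single gate

Natural-number variables: `0` the number of qubits, `1`, `2`, `3` the addresses of the `X`-bits, the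
`Z`-bits and the digits, `4` the address of the next digit, `5` and `6` the addresses of the current
gate and the current unitary, `7` a counter, `8` the number of gates, `9` the end of the real input.
Real variables: `0` the sum over the paths, `1` the coefficient of the current path. -/

attribute [simp] Stmt.sem

/-- Exclusive or for bits: of the two truncated differences at most one is nonzero. -/
def NExpr.xor (d e : NExpr) : NExpr := .add (.sub d e) (.sub e d)

/-- Conjunction for bits, by truncated subtraction. -/
def NExpr.and (d e : NExpr) : NExpr := .sub (.add d e) (.c 1)

@[simp] theorem NExpr.eval_xor (d e : NExpr) (s : State) :
    (d.xor e).eval s = (d.eval s - e.eval s) + (e.eval s - d.eval s) := rfl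

@[simp] theorem NExpr.eval_and (d e : NExpr) (s : State) :
    (d.and e).eval s = d.eval s + e.eval s - 1 := rfl

def Stmt.rsetIf (e : NExpr) (a : ℕ) (f : RExpr) : Stmt := .ite e (.rset a f) .skip

@[simp] theorem Stmt.sem_rsetIf (e : NExpr) (a : ℕ) (f : RExpr) (s : State) :
    (Stmt.rsetIf e a f).sem s = { s with
      rreg := Function.update s.rreg a (if e.eval s ≠ 0 then f.eval s else s.rreg a) } := by
  rw [Stmt.rsetIf, Stmt.sem]
  split_ifs <;> simp [Stmt.sem]

/-- Store the Pauli operator with bits `d` and `e` on the qubit in variable `q`. -/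
@[simp] def Stmt.storePauli (q : ℕ) (d e : NExpr) : Stmt :=
  .seq (.st (.add (.v 1) (.v q)) d) (.st (.add (.v 2) (.v q)) e)

def Stmt.block : List Stmt → Stmt
  | [] => .skip
  | P :: l => .seq P (block l)

@[simp] theorem Stmt.sem_block_nil (s : State) : (Stmt.block []).sem s = s := rfl

@[simp] theorem Stmt.sem_block_cons (P : Stmt) (l : List Stmt) (s : State) :
    (Stmt.block (P :: l)).sem s = (Stmt.block l).sem (P.sem s) := rfl

/-- Load the Pauli operator on the qubit in variable `q` to variables `a` and `b`. -/
@[simp] def Stmt.loadPauli (q a b : ℕ) : Stmt :=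
  .seq (.nset a (.ld (.add (.v 1) (.v q)))) (.nset b (.ld (.add (.v 2) (.v q))))

@[simp] def negate : RExpr := .sub (.c 0) (.v 1)

def gateH : Stmt := .block [.loadPauli 13 10 11, .storePauli 13 (.v 11) (.v 10),
  .rsetIf ((NExpr.v 10).and (.v 11)) 1 negate]

def gateS : Stmt := .block [.loadPauli 13 10 11, .storePauli 13 (.v 10) ((NExpr.v 10).xor (.v 11)),
  .rsetIf (.sub (.v 10) (.v 11)) 1 negate]

def gateCNOT : Stmt := .block [.nset 14 (.ld (.add (.v 5) (.c 2))), .loadPauli 13 10 11,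
  .loadPauli 14 15 16, .storePauli 13 (.v 10) ((NExpr.v 11).xor (.v 16)),
  .storePauli 14 ((NExpr.v 15).xor (.v 10)) (.v 16),
  .rsetIf (((NExpr.v 10).and (.v 16)).and (.sub (.c 1) ((NExpr.v 15).xor (.v 11)))) 1 negate]

/-- Complex expressions. -/
structure CExpr where
  re : RExpr
  im : RExpr

def CExpr.eval (s : State) (e : CExpr) : ℂ := ⟨e.re.eval s, e.im.eval s⟩

def CExpr.add (d e : CExpr) : CExpr := ⟨.add d.re e.re, .add d.im e.im⟩

def CExpr.mul (d e : CExpr) : CExpr :=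
  ⟨.sub (.mul d.re e.re) (.mul d.im e.im), .add (.mul d.re e.im) (.mul d.im e.re)⟩

def CExpr.conj (e : CExpr) : CExpr := ⟨e.re, .sub (.c 0) e.im⟩

theorem CExpr.eval_add (s : State) (d e : CExpr) : (d.add e).eval s = d.eval s + e.eval s := by
  apply Complex.ext <;> simp [CExpr.eval, CExpr.add]

theorem CExpr.eval_mul (s : State) (d e : CExpr) : (d.mul e).eval s = d.eval s * e.eval s := by
  apply Complex.ext <;> simp [CExpr.eval, CExpr.mul]

theorem CExpr.eval_conj (s : State) (e : CExpr) : e.conj.eval s = star (e.eval s) := by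
  apply Complex.ext <;> simp [CExpr.eval, CExpr.conj]

/-- Complex `2 × 2` matrices of expressions. -/
abbrev MExpr : Type := Fin 2 → Fin 2 → CExpr

def MExpr.eval (s : State) (A : MExpr) : Matrix (Fin 2) (Fin 2) ℂ :=
  Matrix.of fun i j => (A i j).eval s

def MExpr.mul (A B : MExpr) : MExpr := fun i j =>
  ((A i 0).mul (B 0 j)).add ((A i 1).mul (B 1 j))

def MExpr.adj (A : MExpr) : MExpr := fun i j => (A j i).conj

def MExpr.tr (A : MExpr) : CExpr := (A 0 0).add (A 1 1)

theorem MExpr.eval_mul (s : State) (A B : MExpr) : (A.mul B).eval s = A.eval s * B.eval s := by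
  ext i j
  simp only [MExpr.eval, MExpr.mul, Matrix.mul_apply, Matrix.of_apply, CExpr.eval_add,
    CExpr.eval_mul, Fin.sum_univ_two]

theorem MExpr.eval_adj (s : State) (A : MExpr) : A.adj.eval s = (A.eval s).conjTranspose := by
  ext i j
  simp only [MExpr.eval, MExpr.adj, Matrix.conjTranspose_apply, Matrix.of_apply, CExpr.eval_conj]

theorem MExpr.eval_tr (s : State) (A : MExpr) : A.tr.eval s = (A.eval s).trace := by
  simp only [MExpr.eval, MExpr.tr, Matrix.trace_fin_two, Matrix.of_apply, CExpr.eval_add]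

/-- The Pauli matrix with its bits in the real variables `a` and `b`. -/
def pauliExpr (a b : ℕ) : MExpr :=
  ![![⟨.sub (.c 1) (.v a), .c 0⟩,
      ⟨.mul (.v a) (.sub (.c 1) (.v b)), .sub (.c 0) (.mul (.v a) (.v b))⟩],
    ![⟨.mul (.v a) (.sub (.c 1) (.v b)), .mul (.v a) (.v b)⟩,
      ⟨.mul (.sub (.c 1) (.v a)) (.sub (.c 1) (.mul (.c 2) (.v b))), .c 0⟩]]

theorem eval_pauliExpr (a b : ℕ) (s : State) (p : Fin 2 × Fin 2) (ha : s.rreg a = (p.1 : ℕ))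
    (hb : s.rreg b = (p.2 : ℕ)) : (pauliExpr a b).eval s = pauliMat p := by
  ext i j
  fin_cases i <;> fin_cases j <;> apply Complex.ext <;>
    simp [MExpr.eval, pauliExpr, CExpr.eval, pauliMat, ha, hb]

/-- The unitary matrix at the address in variable `6`. -/
def unitaryExpr : MExpr := fun i j =>
  ⟨.ld (.add (.v 6) (.c (4 * i + 2 * j))), .ld (.add (.v 6) (.c (4 * i + 2 * j + 1)))⟩

/-- An entry of the rotation matrix. -/
def rotationExpr : RExpr :=
  .mul (.c (1 / 2)) ((pauliExpr 4 5).mul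
    ((unitaryExpr.adj.mul (pauliExpr 2 3)).mul unitaryExpr)).tr.re

theorem eval_rotationExpr (s : State) (U : Matrix (Fin 2) (Fin 2) ℂ) (p t : Fin 2 × Fin 2)
    (h2 : s.rreg 2 = (p.1 : ℕ)) (h3 : s.rreg 3 = (p.2 : ℕ)) (h4 : s.rreg 4 = (t.1 : ℕ))
    (h5 : s.rreg 5 = (t.2 : ℕ))
    (hU : ∀ i j : Fin 2, s.rmem (s.reg 6 + (4 * i + 2 * j)) = (U i j).re ∧
      s.rmem (s.reg 6 + (4 * i + 2 * j + 1)) = (U i j).im) :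
    rotationExpr.eval s = rotation U p t := by
  have hu : unitaryExpr.eval s = U := by
    ext i j
    apply Complex.ext
    · exact (hU i j).1
    · exact (hU i j).2
  have h : ∀ e : CExpr, e.re.eval s = (e.eval s).re := fun _ => rfl
  rw [rotationExpr, RExpr.eval, h, MExpr.eval_tr, MExpr.eval_mul, MExpr.eval_mul, MExpr.eval_mul,
    MExpr.eval_adj, hu, eval_pauliExpr 2 3 s p h2 h3, eval_pauliExpr 4 5 s t h4 h5, rotation]
  simp [RExpr.eval]

/-- Decode the next digit to variables `14` and `15` and advance. -/
def readDigit : Stmt := .block [.nset 21 (.ld (.v 4)),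
  -- The increment is 1 for a nonzero code and 0 for the end mark, which can therefore be read
  -- repeatedly.
  .nset 4 (.add (.v 4) (.sub (.v 21) (.sub (.v 21) (.c 1)))),
  .nset 15 (.sub (.sub (.v 21) (.c 1)) (.sub (.v 21) (.c 2))),
  .nset 14 (.sub (.v 21) (.add (.v 15) (.v 15)))]

/-- Multiply with the eigenvalue of the noise and the sign of the random Pauli operator. -/
def damp : Stmt := .block [
  .nset 18 (.sub (.v 12) (.c 3)),
  -- Variable `18` is 0 if the Pauli comes first and 1 otherwise. Subtracting 1 erases a bit, so the
  -- sum selects the new or the old Pauli operator.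
  .nset 16 (.add (.sub (.v 10) (.sub (.c 1) (.v 18))) (.sub (.v 14) (.v 18))),
  .nset 17 (.add (.sub (.v 11) (.sub (.c 1) (.v 18))) (.sub (.v 15) (.v 18))),
  .nset 19 (.ld (.add (.v 5) (.c 2))),
  .nset 20 (.ld (.add (.v 5) (.c 3))),
  .rsetIf (.v 16) 1 (.mul (.sub (.c 1) (.mul (.c 2) (.ld (.c 0)))) (.v 1)),
  .rsetIf (.v 17) 1 (.mul (.sub (.c 1) (.mul (.c 2) (.ld (.c 1)))) (.v 1)),
  .rsetIf ((NExpr.v 16).xor (.v 17)) 1 (.mul (.sub (.c 1) (.mul (.c 2) (.ld (.c 2)))) (.v 1)),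
  .rsetIf (((NExpr.v 16).and (.v 19)).xor ((NExpr.v 17).and (.v 20))) 1 negate]

/-- Multiply with the entry of the rotation matrix. -/
def rotate : Stmt := .block [
  .rset 2 (.c 0), .rsetIf (.v 10) 2 (.c 1), .rset 3 (.c 0), .rsetIf (.v 11) 3 (.c 1),
  .rset 4 (.c 0), .rsetIf (.v 14) 4 (.c 1), .rset 5 (.c 0), .rsetIf (.v 15) 5 (.c 1),
  .rset 1 (.mul rotationExpr (.v 1))]

def gateNoisy : Stmt := .block [
  .nset 6 (.sub (.v 6) (.c 8)), .loadPauli 13 10 11,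
  .ite (.add (.v 10) (.v 11))
    (.block [readDigit, damp, rotate, .storePauli 13 (.v 14) (.v 15)]) .skip]

/-- Fetch and execute one gate. -/
def gateStep : Stmt := .block [
  .nset 7 (.sub (.v 7) (.c 1)), .nset 5 (.sub (.v 5) (.c 4)), .nset 12 (.ld (.v 5)),
  .nset 13 (.ld (.add (.v 5) (.c 1))),
  -- The gate codes are 0 for H, 1 for S, 2 for CNOT; 3 and 4 are the two kinds of noisy gate.
  .ite (.v 12) (.ite (.sub (.v 12) (.c 1)) (.ite (.sub (.v 12) (.c 2)) gateNoisy gateCNOT) gateS)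
    gateH]

/-! ### Correctness of the code for a single gate -/

/-- The sizes and the input as seen by the machine. -/
structure Layout (n : ℕ) where
  /-- the length of the input -/
  B : ℕ
  /-- the number of gates -/
  N : ℕ
  /-- the length of the real input -/
  R : ℕ
  inp : ℕ → ℕ
  rinp : ℕ → ℝ

/-- The part of the state that does not change while a path is processed. -/
structure Layout.Base {n : ℕ} (L : Layout n) (acc : ℝ) (s : State) : Prop where
  size : s.reg 0 = n
  B : s.reg 1 = L.B
  Z : s.reg 2 = L.B + n
  D : s.reg 3 = L.B + n + n
  N : s.reg 8 = L.N
  R : s.reg 9 = L.R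
  inp : ∀ i < L.B, s.mem i = L.inp i
  rinp : s.rmem = L.rinp
  acc : s.rreg 0 = acc

/-- The code of a digit. -/
def digitCode (p : Fin 2 × Fin 2) : ℕ := p.1 + (p.2 + p.2)

/-- The state holds the configuration `c`. -/
structure Layout.Holds {n : ℕ} (L : Layout n) (acc : ℝ) (c : Config n) (s : State) : Prop extends
    L.Base acc s where
  w : s.rreg 1 = c.w
  str : ∀ j : Fin n, s.mem (L.B + j) = (c.str j).1 ∧ s.mem (L.B + n + j) = (c.str j).2
  dptr : L.B + n + n ≤ s.reg 4
  -- The index `j = c.digits.length` is included: there the default `0` of `getD` stands for the end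
  -- mark.
  dig : ∀ j ≤ c.digits.length, s.mem (s.reg 4 + j) = digitCode (c.digits.getD j 0)
  nz : ∀ d ∈ c.digits, d ≠ 0

theorem Layout.Base.frame {n : ℕ} {L : Layout n} {acc : ℝ} {s s' : State} (h : L.Base acc s)
    (hreg : ∀ i ∈ [0, 1, 2, 3, 8, 9], s'.reg i = s.reg i) (hmem : ∀ i < L.B, s'.mem i = s.mem i)
    (hrmem : s'.rmem = s.rmem) (hacc : s'.rreg 0 = s.rreg 0) : L.Base acc s' where
  size := (hreg 0 (by simp)).trans h.size
  B := (hreg 1 (by simp)).trans h.B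
  Z := (hreg 2 (by simp)).trans h.Z
  D := (hreg 3 (by simp)).trans h.D
  N := (hreg 8 (by simp)).trans h.N
  R := (hreg 9 (by simp)).trans h.R
  inp := fun i hi => (hmem i hi).trans (h.inp i hi)
  rinp := hrmem.trans h.rinp
  acc := hacc.trans h.acc

theorem Layout.Holds.frame {n : ℕ} {L : Layout n} {acc : ℝ} {c : Config n} {s s' : State}
    (h : L.Holds acc c s) {w' : ℝ} (hreg : ∀ i ∈ [0, 1, 2, 3, 4, 8, 9], s'.reg i = s.reg i)
    (hmem : s'.mem = s.mem) (hrmem : s'.rmem = s.rmem) (hacc : s'.rreg 0 = s.rreg 0)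
    (hw : s'.rreg 1 = w') : L.Holds acc ⟨c.str, w', c.digits⟩ s' where
  toBase := h.toBase.frame (fun i hi => hreg i (by simp at hi ⊢; tauto))
    (fun i _ => by rw [hmem]) hrmem hacc
  w := hw
  str := by rw [hmem]; exact h.str
  dptr := by rw [hreg 4 (by simp)]; exact h.dptr
  dig := by rw [hreg 4 (by simp), hmem]; exact h.dig
  nz := h.nz

theorem Layout.Holds.store {n : ℕ} {L : Layout n} {acc : ℝ} {c : Config n} {s s' : State}
    (h : L.Holds acc c s) {w' : ℝ} (q : Fin n) (p : Fin 2 × Fin 2)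
    (hreg : ∀ i ∈ [0, 1, 2, 3, 4, 8, 9], s'.reg i = s.reg i)
    (hmem : s'.mem = Function.update (Function.update s.mem (L.B + q) p.1) (L.B + n + q) p.2)
    (hrmem : s'.rmem = s.rmem) (hacc : s'.rreg 0 = s.rreg 0) (hw : s'.rreg 1 = w') :
    L.Holds acc ⟨Function.update c.str q p, w', c.digits⟩ s' where
  toBase := h.toBase.frame (fun i hi => hreg i (by simp at hi ⊢; tauto))
    (fun i hi => by
      rw [hmem, Function.update_of_ne (by omega), Function.update_of_ne (by omega)]) hrmem hacc
  w := hw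
  str := by
    intro j
    rw [hmem]
    by_cases hj : j = q
    · subst hj
      simp only [Function.update_self, and_true]
      have := j.isLt
      rw [Function.update_of_ne (by omega), Function.update_self]
    · have hj' : (j : ℕ) ≠ q := fun h => hj (Fin.ext h)
      simp only [Function.update_of_ne hj]
      have := j.isLt
      have := q.isLt
      rw [Function.update_of_ne (by omega), Function.update_of_ne (by omega),
        Function.update_of_ne (by omega), Function.update_of_ne (by omega)]
      exact h.str j
  dptr := by rw [hreg 4 (by simp)]; exact h.dptr
  dig := by
    intro j hj
    have := h.dptr
    have := q.isLt
    rw [hreg 4 (by simp), hmem, Function.update_of_ne (by omega), Function.update_of_ne (by omega)]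
    exact h.dig j hj
  nz := h.nz

theorem val_add_fin_two : ∀ a b : Fin 2, ((a + b : Fin 2) : ℕ) = ((a : ℕ) - b) + ((b : ℕ) - a) := by
  decide

theorem Layout.Holds.after_gateH {n : ℕ} {L : Layout n} {acc : ℝ} {c : Config n} {s : State}
    (h : L.Holds acc c s) (q : Fin n) (hq : s.reg 13 = q) :
    L.Holds acc ⟨(CliffordGate.H q).act c.str, (CliffordGate.H q).actSign c.str * c.w, c.digits⟩
      (gateH.sem s) := by
  have hx := (h.str q).1
  have hz := (h.str q).2
  have key : ∀ p : Fin 2 × Fin 2, (p.1 : ℕ) + p.2 - 1 = 0 ↔ ¬ p = (1, 1) := by decide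
  refine h.store q ((c.str q).2, (c.str q).1) ?_ ?_ ?_ ?_ ?_
  · intro i hi
    fin_cases hi <;> simp [gateH]
  · simp [gateH, h.B, h.Z, hq, hx, hz]
  · simp [gateH]
  · simp [gateH]
  · simp [gateH, h.B, h.Z, hq, hx, hz, h.w, CliffordGate.actSign, key]

theorem Layout.Holds.after_gateS {n : ℕ} {L : Layout n} {acc : ℝ} {c : Config n} {s : State}
    (h : L.Holds acc c s) (q : Fin n) (hq : s.reg 13 = q) :
    L.Holds acc ⟨(CliffordGate.S q).act c.str, (CliffordGate.S q).actSign c.str * c.w, c.digits⟩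
      (gateS.sem s) := by
  have hx := (h.str q).1
  have hz := (h.str q).2
  have key : ∀ p : Fin 2 × Fin 2, (p.1 : ℕ) - p.2 = 0 ↔ ¬ p = (1, 0) := by decide
  refine h.store q ((c.str q).1, (c.str q).1 + (c.str q).2) ?_ ?_ ?_ ?_ ?_
  · intro i hi
    fin_cases hi <;> simp [gateS]
  · simp [gateS, h.B, h.Z, hq, hx, hz, val_add_fin_two]
  · simp [gateS]
  · simp [gateS]
  · simp [gateS, h.B, h.Z, hq, hx, hz, h.w, CliffordGate.actSign, key]

theorem Layout.Holds.after_gateCNOT {n : ℕ} {L : Layout n} {acc : ℝ} {c : Config n} {s : State}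
    (h : L.Holds acc c s) (q t : Fin n) (hqt : q ≠ t) (hq : s.reg 13 = q)
    (hp : s.reg 5 + 2 < L.B) (ht : L.inp (s.reg 5 + 2) = t) :
    L.Holds acc ⟨(CliffordGate.CNOT q t hqt).act c.str,
      (CliffordGate.CNOT q t hqt).actSign c.str * c.w, c.digits⟩ (gateCNOT.sem s) := by
  have hx := (h.str q).1
  have hz := (h.str q).2
  have hx' := (h.str t).1
  have hz' := (h.str t).2
  have ht' : s.mem (s.reg 5 + 2) = t := by rw [h.inp _ hp, ht]
  have key : ∀ a b : Fin 2 × Fin 2, (a.1 : ℕ) + b.2 - 1 +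
      (1 - ((b.1 : ℕ) - a.2 + ((a.2 : ℕ) - b.1))) - 1 = 0 ↔
      ¬ (a.1 = 1 ∧ b.2 = 1 ∧ b.1 = a.2) := by decide
  -- The control is stored first; the bits for the target were loaded before that.
  have h1 : L.Holds acc ⟨Function.update c.str q ((c.str q).1, (c.str q).2 + (c.str t).2), c.w,
      c.digits⟩ ((Stmt.storePauli 13 (.v 10) ((NExpr.v 11).xor (.v 16))).sem
        ((Stmt.loadPauli 14 15 16).sem ((Stmt.loadPauli 13 10 11).sem
          ((Stmt.nset 14 (.ld (.add (.v 5) (.c 2)))).sem s)))) := by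
    refine h.store q ((c.str q).1, (c.str q).2 + (c.str t).2) ?_ ?_ ?_ ?_ ?_
    · intro i hi
      fin_cases hi <;> simp
    · simp [h.B, h.Z, hq, ht', hx, hz, hz', val_add_fin_two]
    · simp
    · simp
    · simp [h.w]
  refine h1.store t ((c.str t).1 + (c.str q).1, (c.str t).2) ?_ ?_ ?_ ?_ ?_
  · intro i hi
    fin_cases hi <;> simp [gateCNOT]
  · simp [gateCNOT, h.B, h.Z, hq, ht', hx, hx', hz, hz', val_add_fin_two]
  · simp [gateCNOT]
  · simp [gateCNOT]
  · have := key (c.str q) (c.str t)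
    simp [gateCNOT, h.B, h.Z, hq, ht', hx, hx', hz, hz', h.w, CliffordGate.actSign,
      this]

theorem Layout.Holds.after_readDigit {n : ℕ} {L : Layout n} {acc : ℝ} {c : Config n} {s : State}
    (h : L.Holds acc c s) :
    L.Holds acc ⟨c.str, c.w, c.digits.tail⟩ (readDigit.sem s) ∧
      (readDigit.sem s).reg 14 = ((c.digits.headD 0).1 : ℕ) ∧
      (readDigit.sem s).reg 15 = ((c.digits.headD 0).2 : ℕ) := by
  have hd : s.mem (s.reg 4) = digitCode (c.digits.headD 0) := by
    have := h.dig 0 (Nat.zero_le _)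
    rw [add_zero] at this
    rw [this]
    cases c.digits <;> rfl
  have e1 : ∀ p : Fin 2 × Fin 2, digitCode p - 1 - (digitCode p - 2) = p.2 := by decide
  have e2 : ∀ p : Fin 2 × Fin 2, digitCode p - (p.2 + p.2) = p.1 := by decide
  have e3 : ∀ p : Fin 2 × Fin 2, p ≠ 0 → digitCode p - (digitCode p - 1) = 1 := by decide
  refine ⟨?_, ?_, ?_⟩
  · have h4 : (readDigit.sem s).reg 4 = s.reg 4 +
        (digitCode (c.digits.headD 0) - (digitCode (c.digits.headD 0) - 1)) := by
      simp [readDigit, hd]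
    exact {
      toBase := h.toBase.frame (fun i hi => by fin_cases hi <;> simp [readDigit])
        (fun i _ => by simp [readDigit]) (by simp [readDigit])
        (by simp [readDigit])
      w := by simp [readDigit, h.w]
      str := fun j => by simpa [readDigit] using h.str j
      dptr := by
        have := h.dptr
        omega
      dig := by
        intro j hj
        have hm : (readDigit.sem s).mem = s.mem := by simp [readDigit]
        rw [hm, h4]
        have hdig := h.dig
        have hnz := h.nz
        revert hj hdig hnz
        cases c.digits with
        | nil =>
          intro hj hdig _
          -- The end mark was read, so the pointer has not moved.
          obtain rfl : j = 0 := by simpa using hj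
          exact hdig 0 le_rfl
        | cons d l =>
          intro hj hdig hnz
          have hj' : j ≤ l.length := hj
          have := hdig (j + 1) (by simpa using hj')
          rw [List.headD_cons, e3 d (hnz d List.mem_cons_self), add_assoc, add_comm 1 j, this]
          rfl
      nz := fun d hd => h.nz d (List.mem_of_mem_tail hd) }
  · simp [readDigit, hd, e1, e2]
  · simp [readDigit, hd, e1]

end
end NoisyClifford

namespace NoisyClifford
noncomputable section

theorem Layout.Holds.after_damp {n : ℕ} {L : Layout n} {acc : ℝ} {c : Config n} {s : State}
    (h : L.Holds acc c s) (p t y : Fin 2 × Fin 2) (e : Fin 3 → ℝ) (b : Bool)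
    (h10 : s.reg 10 = (p.1 : ℕ)) (h11 : s.reg 11 = (p.2 : ℕ)) (h14 : s.reg 14 = (t.1 : ℕ))
    (h15 : s.reg 15 = (t.2 : ℕ)) (h12 : s.reg 12 = if b then 3 else 4) (h5 : s.reg 5 + 3 < L.B)
    (hy1 : L.inp (s.reg 5 + 2) = (y.1 : ℕ)) (hy2 : L.inp (s.reg 5 + 3) = (y.2 : ℕ))
    (he : ∀ i : Fin 3, L.rinp i = e i) :
    L.Holds acc ⟨c.str, noiseEig e (if b then t else p) * sign (if b then t else p) y * c.w,
      c.digits⟩ (damp.sem s) := by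
  refine h.frame ?_ ?_ ?_ ?_ ?_
  · intro i hi
    fin_cases hi <;> simp [damp]
  · simp [damp]
  · simp [damp]
  · simp [damp]
  · have g1 : s.mem (s.reg 5 + 2) = (y.1 : ℕ) := by rw [h.inp _ (by omega), hy1]
    have g2 : s.mem (s.reg 5 + 3) = (y.2 : ℕ) := by rw [h.inp _ (by omega), hy2]
    have r0 : s.rmem 0 = e 0 := by rw [h.rinp]; exact he 0
    have r1 : s.rmem 1 = e 1 := by rw [h.rinp]; exact he 1
    have r2 : s.rmem 2 = e 2 := by rw [h.rinp]; exact he 2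
    set v := if b then t else p with hv
    have k1 : (p.1 : ℕ) - (1 - ((if b then 3 else 4) - 3)) + ((t.1 : ℕ) - ((if b then 3 else 4) - 3))
        = v.1 := by
      cases b
      · have := t.1.isLt
        simp only [hv, Bool.false_eq_true, if_false]; omega
      · have := p.1.isLt
        simp only [hv, if_true]; omega
    have k2 : (p.2 : ℕ) - (1 - ((if b then 3 else 4) - 3)) + ((t.2 : ℕ) - ((if b then 3 else 4) - 3))
        = v.2 := by
      cases b
      · have := t.2.isLt
        simp only [hv, Bool.false_eq_true, if_false]; omega
      · have := p.2.isLt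
        simp only [hv, if_true]; omega
    have hw := h.w
    clear_value v
    simp only [damp, Stmt.sem_block_cons, Stmt.sem_block_nil, Stmt.sem_rsetIf, Stmt.sem, negate,
      NExpr.eval, RExpr.eval, NExpr.eval_xor, NExpr.eval_and, Function.update_apply,
      Nat.reduceEqDiff, if_true, if_false, h10, h11, h14, h15, h12, g1, g2,
      r0, r1, r2, k1, k2, hw]
    obtain ⟨v1, v2⟩ := v
    obtain ⟨y1, y2⟩ := y
    fin_cases v1 <;> fin_cases v2 <;> fin_cases y1 <;> fin_cases y2 <;>
      simp [noiseEig, sign, intSign] <;> ring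

theorem Layout.Holds.after_rotate {n : ℕ} {L : Layout n} {acc : ℝ} {c : Config n} {s : State}
    (h : L.Holds acc c s) (p t : Fin 2 × Fin 2) (U : Matrix (Fin 2) (Fin 2) ℂ)
    (h10 : s.reg 10 = (p.1 : ℕ)) (h11 : s.reg 11 = (p.2 : ℕ)) (h14 : s.reg 14 = (t.1 : ℕ))
    (h15 : s.reg 15 = (t.2 : ℕ))
    (hU : ∀ i j : Fin 2, L.rinp (s.reg 6 + (4 * i + 2 * j)) = (U i j).re ∧
      L.rinp (s.reg 6 + (4 * i + 2 * j + 1)) = (U i j).im) :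
    L.Holds acc ⟨c.str, rotation U p t * c.w, c.digits⟩ (rotate.sem s) := by
  have bit : ∀ b : Fin 2, (if (b : ℕ) ≠ 0 then (1 : ℝ) else 0) = (b : ℕ) := by
    intro b
    fin_cases b <;> simp

  -- The state before the last assignment is made opaque, so that the large matrix expression is
  -- evaluated only through `eval_rotationExpr`.
  obtain ⟨s', hs', hreg, hmem, hrmem, r0, r1, r2, r3, r4, r5⟩ : ∃ s' : State,
      rotate.sem s = (Stmt.rset 1 (.mul rotationExpr (.v 1))).sem s' ∧ s'.reg = s.reg ∧
        s'.mem = s.mem ∧ s'.rmem = s.rmem ∧ s'.rreg 0 = s.rreg 0 ∧ s'.rreg 1 = s.rreg 1 ∧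
        s'.rreg 2 = (p.1 : ℕ) ∧ s'.rreg 3 = (p.2 : ℕ) ∧ s'.rreg 4 = (t.1 : ℕ) ∧
        s'.rreg 5 = (t.2 : ℕ) := by
    refine ⟨_, rfl, ?_, ?_, ?_, ?_, ?_, ?_, ?_, ?_, ?_⟩ <;>
      simp only [Stmt.sem_rsetIf, Stmt.sem, NExpr.eval, RExpr.eval, Function.update_apply,
        Nat.reduceEqDiff, if_true, if_false, h10, h11, h14, h15,
        Rat.cast_zero, Rat.cast_one, bit]
  rw [hs']
  have hrot := eval_rotationExpr s' U p t r2 r3 r4 r5 (by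
    rw [hreg, hrmem, h.rinp]; exact hU)
  refine h.frame ?_ ?_ ?_ ?_ ?_
  · intro i _
    rw [← hreg]; rfl
  · exact hmem
  · exact hrmem
  · rw [← r0]
    simp [Stmt.sem]
  · simp [Stmt.sem, hrot, r1, h.w]

end
end NoisyClifford

namespace NoisyClifford
noncomputable section

/-- The unitaries are read from the end, so the pointer goes down by eight reals first. This also
happens when the Pauli is trivial and nothing else is done. -/
theorem Layout.Holds.after_gateNoisy {n m : ℕ} {L : Layout n} {acc : ℝ} {c : Config n} {s : State}
    (h : L.Holds acc c s) (C : Circuit n m) (e : Fin 3 → ℝ) (y : PauliChoice m) (k : Fin m)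
    (ρ : ℕ) (hq : s.reg 13 = (C.gate k).qubit)
    (h12 : s.reg 12 = if (C.gate k).pauliFirst then 3 else 4) (h5 : s.reg 5 + 3 < L.B)
    (hy1 : L.inp (s.reg 5 + 2) = ((y k).1 : ℕ)) (hy2 : L.inp (s.reg 5 + 3) = ((y k).2 : ℕ))
    (he : ∀ i : Fin 3, L.rinp i = e i) (h6 : s.reg 6 = ρ + 8)
    (hU : ∀ i j : Fin 2, L.rinp (ρ + (4 * i + 2 * j)) = ((C.gate k).U.1 i j).re ∧
      L.rinp (ρ + (4 * i + 2 * j + 1)) = ((C.gate k).U.1 i j).im) :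
    L.Holds acc (C.stepConfig e y (.inr k) c) (gateNoisy.sem s) ∧
      (gateNoisy.sem s).reg 5 = s.reg 5 ∧ (gateNoisy.sem s).reg 6 = ρ ∧
      (gateNoisy.sem s).reg 7 = s.reg 7 := by
  set q := (C.gate k).qubit with hqdef
  obtain ⟨s₁, hs₁⟩ : ∃ s₁, s₁ = (Stmt.loadPauli 13 10 11).sem
    ((Stmt.nset 6 (.sub (.v 6) (.c 8))).sem s) := ⟨_, rfl⟩
  have H : gateNoisy.sem s = if s₁.reg 10 + s₁.reg 11 ≠ 0 then
      (Stmt.storePauli 13 (.v 14) (.v 15)).sem (rotate.sem (damp.sem (readDigit.sem s₁)))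
      else s₁ := by
    rw [hs₁]; rfl
  have hx := (h.str q).1
  have hz := (h.str q).2
  have a10 : s₁.reg 10 = ((c.str q).1 : ℕ) := by simp [hs₁, h.B, hq, hx]
  have a11 : s₁.reg 11 = ((c.str q).2 : ℕ) := by simp [hs₁, h.Z, hq, hz]
  have a5 : s₁.reg 5 = s.reg 5 := by simp [hs₁]
  have a6 : s₁.reg 6 = ρ := by simp [hs₁, h6]
  have a7 : s₁.reg 7 = s.reg 7 := by simp [hs₁]
  have a12 : s₁.reg 12 = s.reg 12 := by simp [hs₁]
  have a13 : s₁.reg 13 = q := by simp [hs₁, hq]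
  have hH₁ : L.Holds acc c s₁ := by
    refine h.frame (w' := c.w) (fun i hi => ?_) ?_ ?_ ?_ ?_
    · fin_cases hi <;> simp [hs₁]
    all_goals simp [hs₁, h.w]
  have key : ∀ p : Fin 2 × Fin 2, (p.1 : ℕ) + p.2 = 0 ↔ p = 0 := by decide
  clear_value q
  rw [H, a10, a11, Circuit.stepConfig, ← hqdef]
  by_cases hp : c.str q = 0
  · rw [if_pos hp, if_neg (not_not.2 ((key _).2 hp))]
    exact ⟨hH₁, a5, a6, a7⟩
  · rw [if_neg hp, if_pos (mt (key _).1 hp)]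
    obtain ⟨hH₂, b14, b15⟩ := hH₁.after_readDigit
    have f2 : ∀ i ∈ [5, 6, 7, 10, 11, 12, 13], (readDigit.sem s₁).reg i = s₁.reg i := by
      intro i hi
      fin_cases hi <;> simp [readDigit]
    have hH₃ := hH₂.after_damp (c.str q) (c.digits.headD 0) (y k) e (C.gate k).pauliFirst
      (by rw [f2 _ (by simp), a10]) (by rw [f2 _ (by simp), a11]) b14 b15
      (by rw [f2 _ (by simp), a12, h12]) (by rw [f2 _ (by simp), a5]; exact h5)
      (by rw [f2 _ (by simp), a5]; exact hy1) (by rw [f2 _ (by simp), a5]; exact hy2) he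
    have f3 : ∀ i ∈ [5, 6, 7, 10, 11, 13, 14, 15],
        (damp.sem (readDigit.sem s₁)).reg i = (readDigit.sem s₁).reg i := by
      intro i hi
      generalize readDigit.sem s₁ = s₂
      fin_cases hi <;> simp [damp]
    have hH₄ := hH₃.after_rotate (c.str q) (c.digits.headD 0) (C.gate k).U.1
      (by rw [f3 _ (by simp), f2 _ (by simp), a10]) (by rw [f3 _ (by simp), f2 _ (by simp), a11])
      (by rw [f3 _ (by simp), b14]) (by rw [f3 _ (by simp), b15])
      (by rw [f3 _ (by simp), f2 _ (by simp), a6]; exact hU)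
    have f4 : (rotate.sem (damp.sem (readDigit.sem s₁))).reg = (damp.sem (readDigit.sem s₁)).reg := by
      simp [rotate]
    generalize rotate.sem (damp.sem (readDigit.sem s₁)) = s₄ at hH₄ f4
    have c13 : s₄.reg 13 = q := by rw [f4, f3 _ (by simp), f2 _ (by simp), a13]
    have c14 : s₄.reg 14 = ((c.digits.headD 0).1 : ℕ) := by rw [f4, f3 _ (by simp), b14]
    have c15 : s₄.reg 15 = ((c.digits.headD 0).2 : ℕ) := by rw [f4, f3 _ (by simp), b15]
    refine ⟨?_, ?_, ?_, ?_⟩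
    · refine hH₄.store q (c.digits.headD 0) ?_ ?_ ?_ ?_ ?_
      · intro i _; rfl
      · simp [hH₄.B, hH₄.Z, c13, c14, c15]
      · rfl
      · rfl
      · simp only [Stmt.storePauli, Stmt.sem, hH₄.w, NoisyGate.coeff]
        ring
    · change s₄.reg 5 = _
      rw [f4, f3 _ (by simp), f2 _ (by simp), a5]
    · change s₄.reg 6 = _
      rw [f4, f3 _ (by simp), f2 _ (by simp), a6]
    · change s₄.reg 7 = _
      rw [f4, f3 _ (by simp), f2 _ (by simp), a7]

/-- The code of a step of the circuit. -/
def Circuit.encodeStep {n m : ℕ} (C : Circuit n m) (y : PauliChoice m) : Step n m → List ℕ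
  | .inl g => g.encode
  | .inr k => (C.gate k).encode (y k)

def Circuit.encodeRealStep {n m : ℕ} (C : Circuit n m) : Step n m → List ℝ
  | .inl _ => []
  | .inr k => (C.gate k).encodeReal

theorem Layout.Holds.after_gateStep {n m : ℕ} {L : Layout n} {acc : ℝ} {c : Config n} {s : State}
    (h : L.Holds acc c s) (C : Circuit n m) (e : Fin 3 → ℝ) (y : PauliChoice m) (x : Step n m)
    (a ρ : ℕ) (h5 : s.reg 5 = a + 4) (haB : a + 4 ≤ L.B)
    (hinp : ∀ i < 4, L.inp (a + i) = (C.encodeStep y x).getD i 0)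
    (he : ∀ i : Fin 3, L.rinp i = e i) (h6 : s.reg 6 = ρ + 8 * (noisyGates [x]).length)
    (hU : ∀ i < (C.encodeRealStep x).length, L.rinp (ρ + i) = (C.encodeRealStep x).getD i 0) :
    L.Holds acc (C.stepConfig e y x c) (gateStep.sem s) ∧ (gateStep.sem s).reg 5 = a ∧
      (gateStep.sem s).reg 6 = ρ ∧ (gateStep.sem s).reg 7 = s.reg 7 - 1 := by
  obtain ⟨s₁, hs₁⟩ : ∃ s₁, s₁ = (Stmt.block [
    .nset 7 (.sub (.v 7) (.c 1)), .nset 5 (.sub (.v 5) (.c 4)), .nset 12 (.ld (.v 5)),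
    .nset 13 (.ld (.add (.v 5) (.c 1)))]).sem s := ⟨_, rfl⟩
  have H : gateStep.sem s = if s₁.reg 12 ≠ 0 then if s₁.reg 12 - 1 ≠ 0 then
      if s₁.reg 12 - 2 ≠ 0 then gateNoisy.sem s₁ else gateCNOT.sem s₁ else gateS.sem s₁
      else gateH.sem s₁ := by
    rw [hs₁]; rfl
  have i0 : L.inp a = (C.encodeStep y x).getD 0 0 := hinp 0 (by omega)
  have i1 := hinp 1 (by omega)
  have i2 := hinp 2 (by omega)
  have i3 := hinp 3 (by omega)
  have a5 : s₁.reg 5 = a := by simp [hs₁, h5]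
  have a6 : s₁.reg 6 = s.reg 6 := by simp [hs₁]
  have a7 : s₁.reg 7 = s.reg 7 - 1 := by simp [hs₁]
  have a12 : s₁.reg 12 = L.inp a := by
    rw [← h.inp _ (by omega)]; simp [hs₁, h5]
  have a13 : s₁.reg 13 = L.inp (a + 1) := by
    rw [← h.inp _ (by omega)]; simp [hs₁, h5]
  have hH₁ : L.Holds acc c s₁ := by
    refine h.frame (w' := c.w) (fun i hi => ?_) ?_ ?_ ?_ ?_
    · fin_cases hi <;> simp [hs₁]
    all_goals simp [hs₁, h.w]
  rw [H, a12, i0]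
  rw [i1] at a13
  cases x with
  | inl g =>
    cases g with
    | H q =>
      simp only [Circuit.encodeStep, CliffordGate.encode, List.getD_cons_zero, ne_eq,
        not_true_eq_false, if_false]
      refine ⟨hH₁.after_gateH q (by rw [a13]; rfl), ?_, ?_, ?_⟩
      · simp [gateH, a5]
      · have e6 : (gateH.sem s₁).reg 6 = s₁.reg 6 := by simp [gateH]
        rw [e6, a6]; exact h6
      · simp [gateH, a7]
    | S q =>
      simp only [Circuit.encodeStep, CliffordGate.encode, List.getD_cons_zero, ne_eq, one_ne_zero,
        not_false_eq_true, not_true_eq_false, if_false, if_true, Nat.sub_self]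
      refine ⟨hH₁.after_gateS q (by rw [a13]; rfl), ?_, ?_, ?_⟩
      · simp [gateS, a5]
      · have e6 : (gateS.sem s₁).reg 6 = s₁.reg 6 := by simp [gateS]
        rw [e6, a6]; exact h6
      · simp [gateS, a7]
    | CNOT q t hqt =>
      have e : (C.encodeStep y (.inl (.CNOT q t hqt))).getD 0 0 = 2 := rfl
      rw [e, if_pos (by decide), if_pos (by decide), if_neg (by decide)]
      refine ⟨hH₁.after_gateCNOT q t hqt (by rw [a13]; rfl) (by omega) (by rw [a5, i2]; rfl),
        ?_, ?_, ?_⟩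
      · simp [gateCNOT, a5]
      · have e6 : (gateCNOT.sem s₁).reg 6 = s₁.reg 6 := by simp [gateCNOT]
        rw [e6, a6]; exact h6
      · simp [gateCNOT, a7]
  | inr k =>
    have e0 : (C.encodeStep y (.inr k)).getD 0 0 = if (C.gate k).pauliFirst then 3 else 4 := rfl
    rw [e0] at i0
    rw [e0, if_pos (by split_ifs <;> decide), if_pos (by split_ifs <;> decide),
      if_pos (by split_ifs <;> decide)]
    have key := hH₁.after_gateNoisy C e y k ρ (by rw [a13]; rfl) (by rw [a12, i0]) (by omega)
      (by rw [a5, i2]; rfl) (by rw [a5, i3]; rfl) he (by rw [a6, h6]; rfl) (by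
        intro i j
        have hi := hU (4 * i + 2 * j) (by
          have := i.isLt; have := j.isLt
          simp only [Circuit.encodeRealStep, NoisyGate.encodeReal, List.length_cons,
            List.length_nil]
          omega)
        have hi' := hU (4 * i + 2 * j + 1) (by
          have := i.isLt; have := j.isLt
          simp only [Circuit.encodeRealStep, NoisyGate.encodeReal, List.length_cons,
            List.length_nil]
          omega)
        rw [hi, hi']
        fin_cases i <;> fin_cases j <;> exact ⟨rfl, rfl⟩)
    rwa [a5, a7] at key

end
end NoisyClifford

namespace NoisyClifford
noncomputable section

/-! ### The code for a single path -/

def zeroBody : Stmt := .block [.nset 7 (.sub (.v 7) (.c 1)), .st (.add (.v 1) (.v 7)) (.c 0),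
  .st (.add (.v 2) (.v 7)) (.c 0)]

/-- The end mark is put behind the room for `k` digits, which are then written downwards in front of
it. -/
def pathStart (r k : ℕ) : Stmt := .block [.rset 1 (.c ((1 / 2) ^ r)), .nset 4 (.add (.v 3) (.c k)),
  .st (.v 4) (.c 0)]

/-- The mode `a` is fixed when the program is written, so its case distinction costs nothing. The
outcome bit is input and is tested at run time. -/
def measureStmt {r : ℕ} (a : Basis r) (j : Fin r) : Stmt :=
  if a j = 1 then .block [.nset 13 (.ld (.c (4 + 2 * j))), .storePauli 13 (.c 0) (.c 1),
    .rsetIf (.ld (.c (5 + 2 * j))) 1 negate] else .skip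

def digitStmt (d : Fin 2 × Fin 2) : Stmt :=
  .block [.nset 4 (.sub (.v 4) (.c 1)), .st (.v 4) (.c (digitCode d))]

def gatesStart : Stmt := .block [.nset 5 (.v 1), .nset 6 (.v 9), .nset 7 (.v 8)]

def finishBody : Stmt := .block [.nset 7 (.sub (.v 7) (.c 1)),
  .rsetIf (.ld (.add (.v 1) (.v 7))) 1 (.c 0)]

def pathFinish : Stmt := .block [.rsetIf (.ld (.v 4)) 1 (.c 0), .rset 0 (.add (.v 0) (.v 1))]

/-- Add the contribution of the path with the digits `d` that starts at the Fourier mode `a`. -/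
def pathProgram (r : ℕ) (a : Basis r) (d : List (Fin 2 × Fin 2)) : Program :=
  .seq (Stmt.nset 7 (.v 0)).compile <| .seq (.loop (2 * 7) zeroBody.compile) <|
  .seq (pathStart r d.length).compile <|
  .seq (.seqList ((List.finRange r).map fun j => (measureStmt a j).compile)) <|
  .seq (.seqList (d.reverse.map fun b => (digitStmt b).compile)) <|
  .seq gatesStart.compile <| .seq (.loop (2 * 7) gateStep.compile) <|
  .seq (Stmt.nset 7 (.v 0)).compile <| .seq (.loop (2 * 7) finishBody.compile) pathFinish.compile

/-- The input that the machine sees describes the circuit. -/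
structure Layout.Describes {n m r : ℕ} (L : Layout n) (C : Circuit n m) (e : Fin 3 → ℝ)
    (y : PauliChoice m) (μ : Fin r ↪ Fin n) (x : Basis r) : Prop where
  B : L.B = 4 + 2 * r + 4 * C.steps.length
  N : L.N = C.steps.length
  R : L.R = 3 + 8 * m
  measured : ∀ j : Fin r, L.inp (4 + 2 * j) = μ j ∧ L.inp (5 + 2 * j) = x j
  code : ∀ l t l', C.steps = l ++ t :: l' → ∀ i < 4,
    L.inp (4 + 2 * r + 4 * l.length + i) = (C.encodeStep y t).getD i 0
  rates : ∀ i : Fin 3, L.rinp i = e i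
  realCode : ∀ l t l', C.steps = l ++ t :: l' → ∀ i < (C.encodeRealStep t).length,
    L.rinp (3 + 8 * (noisyGates l).length + i) = (C.encodeRealStep t).getD i 0

theorem triple_zero {n : ℕ} (L : Layout n) (acc : ℝ) :
    Triple (fun s => L.Base acc s ∧ s.reg 7 = n) (.loop (2 * 7) zeroBody.compile)
      (fun s => L.Base acc s ∧ ∀ i : Fin n, s.mem (L.B + i) = 0 ∧ s.mem (L.B + n + i) = 0)
      (n * (zeroBody.cost + 1) + 1) := by
  -- The counter runs down, and the cells with index at least `j` have been cleared.
  refine (Triple.loop (I := fun j s => L.Base acc s ∧ s.reg 7 = j ∧ j ≤ n ∧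
    ∀ i : Fin n, j ≤ (i : ℕ) → s.mem (L.B + i) = 0 ∧ s.mem (L.B + n + i) = 0)
    (fun j s h => h.2.1) (fun j => Triple.stmt ?_) n).mono ?_ ?_ le_rfl
  · rintro s ⟨h, h7, hj, hz⟩
    have hmem : (zeroBody.sem s).mem =
        Function.update (Function.update s.mem (L.B + j) 0) (L.B + n + j) 0 := by
      simp [zeroBody, h.B, h.Z, h7]
    refine ⟨h.frame (fun i hi => ?_) (fun i hi => ?_) ?_ ?_, ?_, by omega, ?_⟩
    · fin_cases hi <;> simp [zeroBody]
    · rw [hmem, Function.update_of_ne (by omega), Function.update_of_ne (by omega)]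
    · simp [zeroBody]
    · simp [zeroBody]
    · simp [zeroBody, h7]
    · intro i hi
      have := i.isLt
      rw [hmem]
      by_cases hij : (i : ℕ) = j
      · rw [hij, Function.update_self, Function.update_of_ne (by omega), Function.update_self]
        exact ⟨rfl, rfl⟩
      · rw [Function.update_of_ne (by omega), Function.update_of_ne (by omega),
          Function.update_of_ne (by omega), Function.update_of_ne (by omega)]
        exact hz i (by omega)
  · rintro s ⟨h, h7⟩
    exact ⟨h, h7, le_rfl, fun i hi => absurd i.isLt (by omega)⟩
  · rintro s ⟨h, _, _, hz⟩
    exact ⟨h, fun i => hz i (Nat.zero_le _)⟩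

theorem triple_pathStart {n : ℕ} (L : Layout n) (acc : ℝ) (r k : ℕ) :
    Triple (fun s => L.Base acc s ∧ ∀ i : Fin n, s.mem (L.B + i) = 0 ∧ s.mem (L.B + n + i) = 0)
      (pathStart r k).compile
      (fun s => L.Holds acc ⟨0, (1 / 2) ^ r, []⟩ s ∧ s.reg 4 = L.B + n + n + k)
      (pathStart r k).cost := by
  refine Triple.stmt ?_
  rintro s ⟨h, hz⟩
  have hmem : ((pathStart r k).sem s).mem = Function.update s.mem (L.B + n + n + k) 0 := by
    simp [pathStart, h.D]
  have h4 : ((pathStart r k).sem s).reg 4 = L.B + n + n + k := by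
    simp [pathStart, h.D]
  refine ⟨⟨h.frame (fun i hi => ?_) (fun i hi => ?_) ?_ ?_, ?_, ?_, ?_, ?_, ?_⟩, h4⟩
  · fin_cases hi <;> simp [pathStart]
  · rw [hmem, Function.update_of_ne (by omega)]
  · simp [pathStart]
  · simp [pathStart]
  · simp [pathStart]
  · intro j
    have := j.isLt
    rw [hmem, Function.update_of_ne (by omega), Function.update_of_ne (by omega)]
    exact hz j
  · omega
  · intro j hj
    obtain rfl : j = 0 := by simpa using hj
    rw [h4, hmem, add_zero, Function.update_self]
    rfl
  · simp

theorem triple_measure {n m r : ℕ} {L : Layout n} {C : Circuit n m} {e : Fin 3 → ℝ}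
    {y : PauliChoice m} {μ : Fin r ↪ Fin n} {x : Basis r} (hL : L.Describes C e y μ x) (acc : ℝ)
    (a : Basis r) (k : ℕ) :
    Triple (fun s => L.Holds acc ⟨0, (1 / 2) ^ r, []⟩ s ∧ s.reg 4 = k)
      (.seqList ((List.finRange r).map fun j => (measureStmt a j).compile))
      (fun s => L.Holds acc ⟨(measured μ x a).1, (measured μ x a).2, []⟩ s ∧ s.reg 4 = k)
      (r * 30 + 1) := by
  have key := Triple.seqList (K := 30) (f := fun j => (measureStmt a j).compile)
    -- The list `l` holds the measured qubits still to be treated; folding over them completes the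
    -- string.
    (I := fun l s => ∃ P w, l.foldl (measureStep μ x a) (P, w) = measured μ x a ∧
      L.Holds acc ⟨P, w, []⟩ s ∧ s.reg 4 = k) (List.finRange r) (by
    intro j _ l
    refine (Triple.stmt (P := measureStmt a j) (B := fun s => ∃ P w,
      l.foldl (measureStep μ x a) (P, w) = measured μ x a ∧ L.Holds acc ⟨P, w, []⟩ s ∧
        s.reg 4 = k) ?_).mono (fun _ h => h) (fun _ h => h) ?_
    · rintro s ⟨P, w, hfold, h, h4⟩
      rw [List.foldl_cons, measureStep] at hfold
      by_cases ha : a j = 1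
      · rw [if_pos ha] at hfold
        have hj : 5 + 2 * (j : ℕ) < L.B := by
          have := j.isLt
          rw [hL.B]
          omega
        have h1 : s.mem (4 + 2 * j) = μ j := by rw [h.inp _ (by omega), (hL.measured j).1]
        have h2 : L.inp (5 + 2 * j) = x j := (hL.measured j).2
        have h3 : ∀ u : ℕ, L.B + u ≠ 5 + 2 * j := by intro u; omega
        have h3' : ∀ u : ℕ, 5 + 2 * (j : ℕ) ≠ L.B + u := by intro u; omega
        have h3'' : ∀ u v : ℕ, 5 + 2 * (j : ℕ) ≠ L.B + u + v := by intro u v; omega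
        refine ⟨_, _, hfold, ?_, ?_⟩
        · refine h.store (μ j) (0, 1) (fun i hi => ?_) ?_ ?_ ?_ ?_
          · fin_cases hi <;> simp [measureStmt, ha]
          · simp [measureStmt, ha, h1, h.B, h.Z]
          · simp [measureStmt, ha]
          · simp [measureStmt, ha]
          · have hx : (x j : ℕ) = 0 ↔ ¬ x j = 1 := by omega
            simp [measureStmt, ha, h.B, h.Z, h1, h3', h3'', h.inp _ hj, h2, hx, h.w]
        · simp [measureStmt, ha, h4]
      · rw [if_neg ha] at hfold
        refine ⟨P, w, hfold, ?_, ?_⟩ <;> simpa [measureStmt, ha]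
    · rw [measureStmt]
      split_ifs <;> simp [Stmt.block, Stmt.cost, Stmt.rsetIf, NExpr.cost, RExpr.cost])
  refine key.mono ?_ ?_ (by simp)
  · rintro s ⟨h, h4⟩
    exact ⟨_, _, rfl, h, h4⟩
  · rintro s ⟨P, w, hfold, h, h4⟩
    rw [List.foldl_nil] at hfold
    rw [← hfold]
    exact ⟨h, h4⟩

theorem triple_digits {n : ℕ} (L : Layout n) (acc : ℝ) (P : Fin n → Fin 2 × Fin 2) (w : ℝ)
    (d : List (Fin 2 × Fin 2)) (hd : ∀ b ∈ d, b ≠ 0) :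
    Triple (fun s => L.Holds acc ⟨P, w, []⟩ s ∧ s.reg 4 = L.B + n + n + d.length)
      (.seqList (d.reverse.map fun b => (digitStmt b).compile)) (L.Holds acc ⟨P, w, d⟩)
      (d.length * 12 + 1) := by
  have key := Triple.seqList (K := 12) (f := fun b => (digitStmt b).compile)
    -- The suffix `d'` of the digits is in memory; `l` is the unwritten rest, last digit first.
    (I := fun l s => ∃ d', d = l.reverse ++ d' ∧ L.Holds acc ⟨P, w, d'⟩ s ∧
      s.reg 4 = L.B + n + n + l.length) d.reverse (by
    intro b hb l
    refine (Triple.stmt (P := digitStmt b) (B := fun s => ∃ d', d = l.reverse ++ d' ∧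
      L.Holds acc ⟨P, w, d'⟩ s ∧ s.reg 4 = L.B + n + n + l.length) ?_).mono
      (fun _ h => h) (fun _ h => h) ?_
    · rintro s ⟨d', hdd', h, h4⟩
      rw [List.length_cons] at h4
      have hmem : ((digitStmt b).sem s).mem =
          Function.update s.mem (L.B + n + n + l.length) (digitCode b) := by
        simp only [digitStmt, Stmt.sem_block_cons, Stmt.sem_block_nil, Stmt.sem, NExpr.eval,
          Function.update_self, h4]
        rfl
      have h4' : ((digitStmt b).sem s).reg 4 = L.B + n + n + l.length := by
        simp only [digitStmt, Stmt.sem_block_cons, Stmt.sem_block_nil, Stmt.sem, NExpr.eval,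
          Function.update_self, h4]
        rfl
      refine ⟨b :: d', by rw [hdd']; simp, ?_, h4'⟩
      exact {
        toBase := h.toBase.frame (fun i hi => by fin_cases hi <;> simp [digitStmt])
          (fun i hi => by rw [hmem, Function.update_of_ne (by omega)]) (by simp [digitStmt])
          (by simp [digitStmt])
        w := by simp [digitStmt, h.w]
        str := by
          intro j
          have := j.isLt
          rw [hmem, Function.update_of_ne (by omega), Function.update_of_ne (by omega)]
          exact h.str j
        dptr := by omega
        dig := by
          intro j hj
          rw [hmem, h4']
          cases j with
          | zero => rw [add_zero, Function.update_self]; rfl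
          | succ j =>
            rw [Function.update_of_ne (by omega)]
            have := h.dig j (by simpa using hj)
            rw [h4] at this
            rw [add_comm j 1, ← add_assoc, add_assoc _ l.length 1, this, add_comm 1 j]
            rfl
        nz := by
          intro c hc
          rcases List.mem_cons.1 hc with rfl | hc
          · exact hd _ (List.mem_reverse.1 hb)
          · exact h.nz c hc }
    · simp [digitStmt, Stmt.block, Stmt.cost, NExpr.cost])
  refine key.mono ?_ ?_ (by simp)
  · rintro s ⟨h, h4⟩
    exact ⟨[], by simp, h, by simpa using h4⟩
  · rintro s ⟨d', hdd', h, _⟩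
    rw [hdd']
    exact h

/-- The loop keeps the rest `l` of the reversed circuit. Its length determines the gate pointer, and
its number of noisy gates determines the pointer to the unitaries. -/
theorem triple_gates {n m r : ℕ} {L : Layout n} {C : Circuit n m} {e : Fin 3 → ℝ}
    {y : PauliChoice m} {μ : Fin r ↪ Fin n} {x : Basis r} (hL : L.Describes C e y μ x) (acc : ℝ)
    (c : Config n) :
    Triple (fun s => L.Holds acc c s ∧ s.reg 5 = L.B ∧ s.reg 6 = L.R ∧ s.reg 7 = L.N)
      (.loop (2 * 7) gateStep.compile) (L.Holds acc (C.runConfig e y C.steps.reverse c))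
      (C.steps.length * (gateStep.cost + 1) + 1) := by
  refine (Triple.loop (I := fun j s => ∃ l l' c', l.length = j ∧ C.steps.reverse = l' ++ l ∧
    L.Holds acc c' s ∧ C.runConfig e y l c' = C.runConfig e y C.steps.reverse c ∧
    s.reg 5 = 4 + 2 * r + 4 * j ∧ s.reg 6 = 3 + 8 * (noisyGates l).length ∧ s.reg 7 = j)
    (fun j s h => ?_) (fun j => Triple.stmt ?_) C.steps.length).mono ?_ ?_ le_rfl
  · obtain ⟨_, _, _, _, _, _, _, _, _, h⟩ := h
    exact h
  · rintro s ⟨l, l', c', hl, hll', h, hrun, h5, h6, h7⟩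
    obtain ⟨t, l, rfl⟩ := List.exists_cons_of_length_eq_add_one hl
    have hlen : l.length = j := by simpa using hl
    have hsteps : C.steps = l.reverse ++ t :: l'.reverse := by
      rw [← List.reverse_reverse C.steps, hll']
      simp
    have hn : (noisyGates l.reverse).length = (noisyGates l).length := by
      rw [noisyGates, List.filterMap_reverse, List.length_reverse, noisyGates]
    have hn' : (noisyGates (t :: l)).length =
        (noisyGates l).length + (noisyGates [t]).length := by
      have h1 : noisyGates (t :: l) = noisyGates [t] ++ noisyGates l := by
        simp only [noisyGates, ← List.filterMap_append]
        rfl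
      rw [h1, List.length_append, add_comm]
    have hB : 4 + 2 * r + 4 * j + 4 ≤ L.B := by
      rw [hL.B, hsteps]
      simp only [List.length_append, List.length_reverse, List.length_cons, hlen]
      omega
    have hcode := hL.code _ _ _ hsteps
    have hreal := hL.realCode _ _ _ hsteps
    rw [List.length_reverse, hlen] at hcode
    rw [hn] at hreal
    obtain ⟨g1, g2, g3, g4⟩ := h.after_gateStep C e y t (4 + 2 * r + 4 * j)
      (3 + 8 * (noisyGates l).length) (by omega) hB hcode hL.rates (by rw [h6, hn']; ring) hreal
    exact ⟨l, l' ++ [t], _, hlen, by simpa using hll', g1, hrun, g2, g3, by omega⟩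
  · rintro s ⟨h, h5, h6, h7⟩
    refine ⟨C.steps.reverse, [], c, by simp, by simp, h, rfl, ?_, ?_, ?_⟩
    · rw [h5, hL.B]
    · rw [h6, hL.R, noisyGates, List.filterMap_reverse, List.length_reverse, ← noisyGates,
        noisyGates_steps, List.length_finRange]
    · rw [h7, hL.N]
  · rintro s ⟨l, l', c', hl, _, h, hrun, _⟩
    obtain rfl := List.length_eq_zero_iff.1 hl
    rw [← hrun]
    exact h

theorem triple_finish {n : ℕ} (L : Layout n) (acc : ℝ) (c : Config n) :
    Triple (fun s => L.Holds acc c s ∧ s.reg 7 = n) (.loop (2 * 7) finishBody.compile)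
      (L.Holds acc ⟨c.str, if ∀ j, (c.str j).1 = 0 then c.w else 0, c.digits⟩)
      (n * (finishBody.cost + 1) + 1) := by
  refine (Triple.loop (I := fun j s => s.reg 7 = j ∧ j ≤ n ∧
    L.Holds acc ⟨c.str, if ∀ i : Fin n, j ≤ (i : ℕ) → (c.str i).1 = 0 then c.w else 0, c.digits⟩ s)
    (fun j s h => h.1) (fun j => Triple.stmt ?_) n).mono ?_ ?_ le_rfl
  · rintro s ⟨h7, hj, h⟩
    refine ⟨by simp [finishBody, h7], by omega, ?_⟩
    have hs := (h.str ⟨j, by omega⟩).1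
    simp only at hs
    have hv : ∀ u : Fin 2, (u : ℕ) = 0 ↔ u = 0 := by decide
    refine h.frame (fun i hi => ?_) ?_ ?_ ?_ ?_
    · fin_cases hi <;> simp [finishBody]
    · simp [finishBody]
    · simp [finishBody]
    · simp [finishBody]
    · have hiff : (∀ i : Fin n, j ≤ (i : ℕ) → (c.str i).1 = 0) ↔
          (c.str ⟨j, by omega⟩).1 = 0 ∧ ∀ i : Fin n, j + 1 ≤ (i : ℕ) → (c.str i).1 = 0 := by
        constructor
        · exact fun H => ⟨H _ le_rfl, fun i hi => H i (by omega)⟩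
        · rintro ⟨H1, H2⟩ i hi
          by_cases hij : (i : ℕ) = j
          · have : i = ⟨j, by omega⟩ := Fin.ext hij
            rw [this]; exact H1
          · exact H2 i (by omega)
      rw [if_congr hiff rfl rfl]
      by_cases hz : (c.str ⟨j, by omega⟩).1 = 0
      · simp [finishBody, h7, h.B, hs, hz, h.w]
      · simp [finishBody, h7, h.B, hs, hz]
  · rintro s ⟨h, h7⟩
    refine ⟨h7, le_rfl, ?_⟩
    rw [if_pos fun i hi => absurd i.isLt (by omega)]
    exact h
  · rintro s ⟨_, _, h⟩
    simpa using h

theorem triple_pathFinish {n : ℕ} (L : Layout n) (acc : ℝ) (c : Config n) :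
    Triple (L.Holds acc ⟨c.str, if ∀ j, (c.str j).1 = 0 then c.w else 0, c.digits⟩)
      pathFinish.compile (L.Base (acc + c.value)) pathFinish.cost := by
  refine Triple.stmt ?_
  intro s h
  have hd := h.dig 0 (Nat.zero_le _)
  rw [add_zero] at hd
  have hcode : ∀ p : Fin 2 × Fin 2, digitCode p = 0 ↔ p = 0 := by decide
  -- Digits are nonzero, so reading the end mark means that all have been used.
  have hz : s.mem (s.reg 4) = 0 ↔ c.digits = [] := by
    rw [hd, hcode]
    have hnz := h.nz
    revert hnz
    cases c.digits with
    | nil => simp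
    | cons b l => intro hnz; simpa using hnz b List.mem_cons_self
  refine {
    size := by simp [pathFinish, h.size]
    B := by simp [pathFinish, h.B]
    Z := by simp [pathFinish, h.Z]
    D := by simp [pathFinish, h.D]
    N := by simp [pathFinish, h.N]
    R := by simp [pathFinish, h.R]
    inp := by simpa [pathFinish] using h.inp
    rinp := by simp [pathFinish, h.rinp]
    acc := ?_ }
  simp only [pathFinish, Stmt.sem_block_cons, Stmt.sem_block_nil, Stmt.sem_rsetIf, Stmt.sem,
    RExpr.eval, NExpr.eval, Function.update_self, Config.value, h.w, ne_eq, hz, Rat.cast_zero]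
  rw [Function.update_of_ne (by decide), h.acc]
  congr 1
  by_cases h1 : c.digits = [] <;> simp [h1]

/-- Bounds the time for a path, per qubit, digit and gate. -/
def pathConst : ℕ := zeroBody.cost + finishBody.cost + gateStep.cost + gatesStart.cost +
  pathFinish.cost + 60

theorem triple_path {n m r : ℕ} {L : Layout n} {C : Circuit n m} {e : Fin 3 → ℝ}
    {y : PauliChoice m} {μ : Fin r ↪ Fin n} {x : Basis r} (hL : L.Describes C e y μ x) (acc : ℝ)
    (a : Basis r) (d : List (Fin 2 × Fin 2)) (hd : ∀ b ∈ d, b ≠ 0) :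
    Triple (L.Base acc) (pathProgram r a d)
      (L.Base (acc + (C.runConfig e y C.steps.reverse
        ⟨(measured μ x a).1, (measured μ x a).2, d⟩).value))
      (pathConst * (2 * n + r + d.length + C.steps.length + 1)) := by
  have h1 : Triple (L.Base acc) (Stmt.nset 7 (.v 0)).compile
      (fun s => L.Base acc s ∧ s.reg 7 = n) 4 := by
    refine Triple.stmt (P := .nset 7 (.v 0)) fun s h => ⟨h.frame (fun i hi => ?_) ?_ ?_ ?_, ?_⟩
    · fin_cases hi <;> simp
    all_goals simp [h.size]
  have h6 : Triple (L.Holds acc ⟨(measured μ x a).1, (measured μ x a).2, d⟩) gatesStart.compile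
      (fun s => L.Holds acc ⟨(measured μ x a).1, (measured μ x a).2, d⟩ s ∧ s.reg 5 = L.B ∧
        s.reg 6 = L.R ∧ s.reg 7 = L.N) gatesStart.cost := by
    refine Triple.stmt fun s h => ⟨h.frame (fun i hi => ?_) ?_ ?_ ?_ ?_, ?_, ?_, ?_⟩
    · fin_cases hi <;> simp [gatesStart]
    all_goals simp [gatesStart, h.B, h.R, h.N, h.w]
  have h8 : ∀ c, Triple (L.Holds acc c) (Stmt.nset 7 (.v 0)).compile
      (fun s => L.Holds acc c s ∧ s.reg 7 = n) 4 := by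
    intro c
    refine Triple.stmt (P := .nset 7 (.v 0)) fun s h => ⟨h.frame (fun i hi => ?_) ?_ ?_ ?_ ?_, ?_⟩
    · fin_cases hi <;> simp
    all_goals simp [h.size, h.w]
  have hstart : (pathStart r d.length).cost = 14 := by
    simp [pathStart, Stmt.block, Stmt.cost, NExpr.cost, RExpr.cost]
  refine (h1.seq <| (triple_zero L acc).seq <| (triple_pathStart L acc r d.length).seq <|
    (triple_measure hL acc a _).seq <| (triple_digits L acc _ _ d hd).seq <| h6.seq <|
    (triple_gates hL acc _).seq <| (h8 _).seq <| (triple_finish L acc _).seq <|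
    triple_pathFinish L acc _).mono (fun _ h => h) (fun _ h => h) ?_
  rw [hstart, pathConst]
  generalize zeroBody.cost = k1
  generalize finishBody.cost = k2
  generalize gateStep.cost = k3
  generalize gatesStart.cost = k4
  generalize pathFinish.cost = k5
  generalize C.steps.length = N
  generalize d.length = D
  zify
  have a1 : (0 : ℤ) ≤ n := by positivity
  nlinarith [Nat.zero_le (k1 * n), Nat.zero_le (k1 * r), Nat.zero_le (k1 * D), Nat.zero_le (k1 * N),
    Nat.zero_le (k2 * n), Nat.zero_le (k2 * r), Nat.zero_le (k2 * D), Nat.zero_le (k2 * N),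
    Nat.zero_le (k3 * n), Nat.zero_le (k3 * r), Nat.zero_le (k3 * D), Nat.zero_le (k3 * N),
    Nat.zero_le (k4 * n), Nat.zero_le (k4 * r), Nat.zero_le (k4 * D), Nat.zero_le (k4 * N),
    Nat.zero_le (k5 * n), Nat.zero_le (k5 * r), Nat.zero_le (k5 * D), Nat.zero_le (k5 * N)]

end
end NoisyClifford

namespace NoisyClifford
noncomputable section

/-! ### The input -/

/-- The layout of the memory for a given input. -/
def Circuit.layout {n m r : ℕ} (C : Circuit n m) (e : Fin 3 → ℝ) (y : PauliChoice m)
    (μ : Fin r ↪ Fin n) (x : Basis r) : Layout n where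
  B := 4 + 2 * r + 4 * C.steps.length
  N := C.steps.length
  R := 3 + 8 * m
  inp := (inputState C e y μ x).mem
  rinp := (inputState C e y μ x).rmem

theorem Circuit.encode_eq {n m : ℕ} (C : Circuit n m) (y : PauliChoice m) :
    C.encode y = C.steps.flatMap (C.encodeStep y) := by
  have h : ∀ B : List (CliffordGate n),
      (B.map Sum.inl).flatMap (C.encodeStep y) = B.flatMap CliffordGate.encode := by
    intro B
    rw [List.flatMap_map]
    rfl
  rw [Circuit.encode, Circuit.steps, List.flatMap_append, h, List.flatMap_assoc]
  congr 1
  refine List.flatMap_congr fun k _ => ?_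
  rw [List.flatMap_cons, h]
  rfl

theorem Circuit.encodeReal_eq {n m : ℕ} (C : Circuit n m) (e : Fin 3 → ℝ) :
    C.encodeReal e = [e 0, e 1, e 2] ++ C.steps.flatMap C.encodeRealStep := by
  have h : ∀ B : List (CliffordGate n),
      (B.map (Sum.inl : _ → Step n m)).flatMap C.encodeRealStep = [] := by
    intro B
    rw [List.flatMap_map]
    simp [Circuit.encodeRealStep]
  rw [Circuit.encodeReal, Circuit.steps, List.flatMap_append, h, List.flatMap_assoc, List.nil_append]
  congr 1
  refine List.flatMap_congr fun k _ => ?_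
  rw [List.flatMap_cons, h, List.append_nil]
  rfl

theorem getD_flatMap_append {α β : Type*} (f : α → List β) (l l' : List α) (t : α) (i : ℕ) (b : β)
    (hi : i < (f t).length) :
    ((l ++ t :: l').flatMap f).getD ((l.flatMap f).length + i) b = (f t).getD i b := by
  rw [List.flatMap_append, List.getD_append_right _ _ _ _ (by omega), Nat.add_sub_cancel_left,
    List.flatMap_cons, List.getD_append _ _ _ _ hi]

theorem length_flatMap_const {α β : Type*} (f : α → List β) (k : ℕ) (hf : ∀ t, (f t).length = k)
    (l : List α) : (l.flatMap f).length = k * l.length := by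
  induction l with
  | nil => simp
  | cons t l ih => rw [List.flatMap_cons, List.length_append, ih, hf, List.length_cons]; ring

theorem Circuit.length_encodeStep {n m : ℕ} (C : Circuit n m) (y : PauliChoice m) (t : Step n m) :
    (C.encodeStep y t).length = 4 := by
  rcases t with (_ | _ | _) | _ <;> rfl

theorem Circuit.length_flatMap_encodeRealStep {n m : ℕ} (C : Circuit n m) (l : List (Step n m)) :
    (l.flatMap C.encodeRealStep).length = 8 * (noisyGates l).length := by
  induction l with
  | nil => rfl
  | cons t l ih =>
    rw [List.flatMap_cons, List.length_append, ih]
    cases t with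
    | inl g =>
      simp only [Circuit.encodeRealStep, List.length_nil, zero_add]
      rfl
    | inr k =>
      simp [Circuit.encodeRealStep, noisyGates, NoisyGate.encodeReal]
      ring

theorem Circuit.length_steps {n m : ℕ} (C : Circuit n m) :
    C.steps.length = m + C.numClifford := by
  have h : ∀ l : List (Fin m), (l.flatMap fun k =>
      (Sum.inr k :: (C.block k.succ).map Sum.inl : List (Step n m))).length =
      l.length + (l.map fun k => (C.block k.succ).length).sum := by
    intro l
    induction l with
    | nil => rfl
    | cons k l ih =>
      rw [List.flatMap_cons, List.length_append, ih]
      simp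
      ring
  rw [Circuit.steps, List.length_append, h, Circuit.numClifford, Fin.sum_univ_succ,
    List.length_finRange, List.length_map, ← List.ofFn_eq_map, List.sum_ofFn]
  ring

theorem Circuit.layout_describes {n m r : ℕ} (C : Circuit n m) (e : Fin 3 → ℝ) (y : PauliChoice m)
    (μ : Fin r ↪ Fin n) (x : Basis r) : (C.layout e y μ x).Describes C e y μ x where
  B := rfl
  N := rfl
  R := rfl
  measured := by
    intro j
    have hlen : ∀ j : Fin r, [(μ j : ℕ), (x j : ℕ)].length = 2 := fun _ => rfl
    obtain ⟨l, l', hl⟩ := List.append_of_mem (List.mem_finRange j)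
    have hj : l.length = j := by
      have h1 : (List.finRange r)[l.length]'(by rw [hl]; simp) = j := by
        simp only [hl, List.getElem_append_right le_rfl, Nat.sub_self, List.getElem_cons_zero]
      rw [List.getElem_finRange] at h1
      simpa using congrArg Fin.val h1
    have hl2 : (l.flatMap fun j => [(μ j : ℕ), (x j : ℕ)]).length = 2 * j := by
      rw [length_flatMap_const _ 2 hlen, hj]
    have key : ∀ i < 2, (C.layout e y μ x).inp (4 + 2 * j + i) = [(μ j : ℕ), (x j : ℕ)].getD i 0 := by
      intro i hi
      have hlt : 2 * (j : ℕ) + i < ((List.finRange r).flatMap fun j =>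
          [(μ j : ℕ), (x j : ℕ)]).length := by
        rw [length_flatMap_const _ 2 hlen, List.length_finRange]
        have := j.isLt
        omega
      change (_ ++ _ ++ _ : List ℕ).getD _ 0 = _
      rw [List.append_assoc, List.getD_append_right _ _ _ _ (by simp; omega)]
      have h4 : 4 + 2 * (j : ℕ) + i - [n, m, C.numClifford, r].length = 2 * j + i := by
        simp; omega
      rw [h4, List.getD_append _ _ _ _ hlt, hl, ← hl2]
      exact getD_flatMap_append _ l l' j i 0 hi
    refine ⟨key 0 (by omega), ?_⟩
    have := key 1 (by omega)
    rw [add_right_comm] at this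
    exact this
  code := by
    intro l t l' hs i hi
    have h1 : (List.finRange r |>.flatMap fun j => [(μ j : ℕ), (x j : ℕ)]).length = 2 * r := by
      rw [length_flatMap_const _ 2 fun _ => rfl, List.length_finRange]
    change (_ ++ _ ++ _ : List ℕ).getD _ 0 = _
    rw [List.getD_append_right _ _ _ _ (by rw [List.length_append, h1]; simp; omega),
      List.length_append, h1, C.encode_eq, hs]
    have h4 : 4 + 2 * r + 4 * l.length + i - ([n, m, C.numClifford, r].length + 2 * r) =
        (l.flatMap (C.encodeStep y)).length + i := by
      rw [length_flatMap_const _ 4 (C.length_encodeStep y)]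
      simp; omega
    rw [h4]
    exact getD_flatMap_append _ l l' t i 0 (by rw [C.length_encodeStep]; exact hi)
  rates := by
    intro i
    change (C.encodeReal e).getD i 0 = e i
    rw [Circuit.encodeReal]
    fin_cases i <;> rfl
  realCode := by
    intro l t l' hs i hi
    change (C.encodeReal e).getD _ 0 = _
    rw [C.encodeReal_eq, List.getD_append_right _ _ _ _ (by simp; omega), hs]
    have h3 : 3 + 8 * (noisyGates l).length + i - [e 0, e 1, e 2].length =
        (l.flatMap C.encodeRealStep).length + i := by
      rw [C.length_flatMap_encodeRealStep]
      simp; omega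
    rw [h3]
    exact getD_flatMap_append _ l l' t i 0 hi

/-! ### The whole program -/

def NExpr.double (d : NExpr) : NExpr := .add d d

@[simp] theorem NExpr.eval_double (d : NExpr) (s : State) : d.double.eval s = 2 * d.eval s :=
  (two_mul _).symm

/-- Natural numbers cannot be multiplied by the machine; the factors 4 and 8 in the addresses come
from repeated doubling. -/
def setup (r : ℕ) : Stmt := .block [.nset 0 (.ld (.c 0)), .nset 18 (.ld (.c 1)),
  .nset 8 (.add (.v 18) (.ld (.c 2))),
  .nset 1 (.add (.c (4 + 2 * r)) (NExpr.v 8).double.double), .nset 2 (.add (.v 1) (.v 0)),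
  .nset 3 (.add (.v 2) (.v 0)), .nset 9 (.add (.c 3) (NExpr.v 18).double.double.double)]

/-- All pairs of a Fourier mode and a list of at most `b` digits. -/
def paths (r b : ℕ) : List (Basis r × List (Fin 2 × Fin 2)) :=
  (Finset.univ : Finset (Basis r)).toList.flatMap fun a => (digitLists b).map fun d => (a, d)

theorem length_paths (r b : ℕ) : (paths r b).length = 2 ^ r * (digitLists b).length := by
  rw [paths, length_flatMap_const _ (digitLists b).length fun _ => by simp]
  simp [mul_comm]

/-- The list of paths depends on `r` and `b` only, so it can be unrolled into the code. -/
def pathsProgram (r b : ℕ) : Program :=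
  .seqList ((paths r b).map fun p => pathProgram r p.1 p.2)

/-- The program that computes the truncated output probabilities. For a single noisy gate, one digit
is enough. -/
def mainProgram (r b : ℕ) : Program :=
  .seq (setup r).compile (.seq ((NExpr.sub (.v 18) (.c 1)).compile 0)
    (.cond 1 (pathsProgram r b) (pathsProgram r (min 1 b))))

theorem triple_setup {n m r : ℕ} (C : Circuit n m) (e : Fin 3 → ℝ) (y : PauliChoice m)
    (μ : Fin r ↪ Fin n) (x : Basis r) :
    Triple (fun s => s = inputState C e y μ x) (setup r).compile
      (fun s => (C.layout e y μ x).Base 0 s ∧ s.reg 18 = m) (setup r).cost := by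
  refine Triple.stmt ?_
  rintro s rfl
  have m0 : (inputState C e y μ x).mem 0 = n := rfl
  have m1 : (inputState C e y μ x).mem 1 = m := rfl
  have m2 : (inputState C e y μ x).mem 2 = C.numClifford := rfl
  refine ⟨{
    size := by simp [setup, m0]
    B := by simp [setup, m1, m2, Circuit.layout, C.length_steps]; ring
    Z := by simp [setup, m0, m1, m2, Circuit.layout, C.length_steps]; ring
    D := by simp [setup, m0, m1, m2, Circuit.layout, C.length_steps]; ring
    N := by simp [setup, m1, m2, Circuit.layout, C.length_steps]
    R := by simp [setup, m1, Circuit.layout]; ring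
    inp := fun i _ => by simp [setup, Circuit.layout]
    rinp := by simp [setup, Circuit.layout]
    acc := by simp [setup, inputState] }, by simp [setup, m1]⟩

theorem ne_zero_of_mem_digitLists : ∀ (b : ℕ) (d : List (Fin 2 × Fin 2)), d ∈ digitLists b →
    ∀ p ∈ d, p ≠ 0 := by
  intro b
  induction b with
  | zero => simp [digitLists]
  | succ b ih =>
    intro d hd
    simp only [digitLists, List.mem_cons, List.mem_append, List.mem_map] at hd
    rcases hd with rfl | ⟨d, h, rfl⟩ | ⟨d, h, rfl⟩ | ⟨d, h, rfl⟩
    · simp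
    all_goals
      intro p hp
      rcases List.mem_cons.1 hp with rfl | hp
      · decide
      · exact ih d h p hp

theorem triple_pathsProgram {n m r : ℕ} {L : Layout n} {C : Circuit n m} {e : Fin 3 → ℝ}
    {y : PauliChoice m} {μ : Fin r ↪ Fin n} {x : Basis r} (hL : L.Describes C e y μ x) (b : ℕ) :
    Triple (L.Base 0) (pathsProgram r b)
      (L.Base (C.trunc e y C.steps.reverse b (outcomeProjector μ x)))
      (2 ^ r * (digitLists b).length *
        (pathConst * (2 * n + r + b + C.steps.length + 1)) + 1) := by
  set f : Basis r × List (Fin 2 × Fin 2) → ℝ := fun p => (C.runConfig e y C.steps.reverse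
    ⟨(measured μ x p.1).1, (measured μ x p.1).2, p.2⟩).value with hf
  have hsum : ((paths r b).map f).sum =
      C.trunc e y C.steps.reverse b (outcomeProjector μ x) := by
    rw [outcomeProjector_eq_sum, C.trunc_sum]
    simp only [C.trunc_smul]
    rw [paths, List.map_flatMap, List.flatMap, List.sum_flatten, List.map_map,
      ← Finset.sum_map_toList]
    congr 1
    refine List.map_congr_left fun a _ => ?_
    simp only [Function.comp_apply, List.map_map]
    exact C.sum_value_runConfig e y C.steps.reverse b (measured μ x a).1 (measured μ x a).2
  have key := Triple.seqList (K := pathConst * (2 * n + r + b + C.steps.length + 1))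
    (f := fun p : Basis r × List (Fin 2 × Fin 2) => pathProgram r p.1 p.2)
    -- The accumulator plus the contributions of the remaining paths is constant.
    (I := fun l s => ∃ acc, L.Base acc s ∧ acc + (l.map f).sum =
      C.trunc e y C.steps.reverse b (outcomeProjector μ x)) (paths r b) (by
    rintro ⟨a, d⟩ hp l s ⟨acc, h, hacc⟩
    have hd : d ∈ digitLists b := by
      simp only [paths, List.mem_flatMap, List.mem_map, Prod.mk.injEq] at hp
      obtain ⟨_, _, _, hd, _, rfl⟩ := hp
      exact hd
    obtain ⟨s', t, h1, h2, h3⟩ := triple_path hL acc a d (ne_zero_of_mem_digitLists b d hd) s h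
    refine ⟨s', t, h1, h2.trans ?_, _, h3, ?_⟩
    · have := length_le_of_mem_digitLists b d hd
      exact Nat.mul_le_mul_left _ (by omega)
    · rw [← hacc, List.map_cons, List.sum_cons, add_assoc])
  rw [length_paths] at key
  refine key.mono (fun s h => ⟨0, h, by rw [zero_add, hsum]⟩) ?_ le_rfl
  rintro s ⟨acc, h, hacc⟩
  rw [List.map_nil, List.sum_nil, add_zero] at hacc
  rwa [← hacc]

/-- Bounds the time outside of the paths. -/
def setupConst : ℕ := 100

theorem cost_setup_le (r : ℕ) : (setup r).cost + (NExpr.sub (.v 18) (.c 1)).cost + 2 ≤ setupConst := by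
  simp [setup, Stmt.block, Stmt.cost, NExpr.cost, NExpr.double, setupConst]

theorem mainProgram_computes {n m r : ℕ} (C : Circuit n m) (e : Fin 3 → ℝ) (μ : Fin r ↪ Fin n)
    (b T : ℕ) (hm : 0 < m)
    (h2 : 2 ≤ m → 2 ^ r * (digitLists b).length *
      (pathConst * (2 * n + r + b + C.steps.length + 1)) ≤ T)
    (h1 : m = 1 → 2 ^ r * (digitLists (min 1 b)).length *
      (pathConst * (2 * n + r + min 1 b + C.steps.length + 1)) ≤ T) :
    Computes (mainProgram r b) C e μ
      (fun y x => C.trunc e y C.steps.reverse b (outcomeProjector μ x)) (setupConst + T) := by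
  intro y x
  have hL := C.layout_describes e y μ x
  have hm18 : ∀ s : State, s.reg 18 = m → ((NExpr.sub (.v 18) (.c 1)).eval s ≠ 0 ↔ 2 ≤ m) := by
    intro s hs
    simp only [NExpr.eval, hs]
    omega
  have hP : Triple (fun s => ((C.layout e y μ x).Base 0 s ∧ s.reg 18 = m) ∧
      (NExpr.sub (.v 18) (.c 1)).eval s ≠ 0) (pathsProgram r b) ((C.layout e y μ x).Base
        (C.trunc e y C.steps.reverse b (outcomeProjector μ x))) (T + 1) := by
    by_cases h : 2 ≤ m
    · exact (triple_pathsProgram hL b).mono (fun s hs => hs.1.1) (fun _ h => h)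
        (Nat.add_le_add_right (h2 h) 1)
    · exact fun s hs => absurd ((hm18 _ hs.1.2).1 hs.2) h
  have hQ : Triple (fun s => ((C.layout e y μ x).Base 0 s ∧ s.reg 18 = m) ∧
      (NExpr.sub (.v 18) (.c 1)).eval s = 0) (pathsProgram r (min 1 b)) ((C.layout e y μ x).Base
        (C.trunc e y C.steps.reverse b (outcomeProjector μ x))) (T + 1) := by
    by_cases h : 2 ≤ m
    · exact fun s hs => absurd hs.2 ((hm18 _ hs.1.2).2 h)
    · have hm1 : m = 1 := by omega
      have hlen : (noisyGates C.steps.reverse).length = 1 := by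
        rw [noisyGates, List.filterMap_reverse, List.length_reverse, ← noisyGates,
          noisyGates_steps, List.length_finRange, hm1]
      -- A single noisy gate has at most one nontrivial component, so budgets above one change
      -- nothing.
      have htrunc : C.trunc e y C.steps.reverse b (outcomeProjector μ x) =
          C.trunc e y C.steps.reverse (min 1 b) (outcomeProjector μ x) := by
        rcases Nat.eq_zero_or_pos b with rfl | hb
        · rfl
        · exact C.trunc_eq_of_length_le e y _ _ _ _ (by omega) (by omega)
      rw [htrunc]
      exact (triple_pathsProgram hL (min 1 b)).mono (fun s hs => hs.1.1) (fun _ h => h)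
        (Nat.add_le_add_right (h1 hm1) 1)
  obtain ⟨s', t, g1, g2, g3⟩ := ((triple_setup C e y μ x).seq (Triple.ite hP hQ))
    (inputState C e y μ x) rfl
  refine ⟨s', t, g1, g2.trans ?_, g3.acc⟩
  have := cost_setup_le r
  omega

/-! ### Running time and error -/

/-- Modes and digit lists are each bounded in number by 3^l, and the length of a path contributes l
+ 1. Passing from 9 to 16 absorbs that factor. -/
theorem nine_pow_mul_le (l : ℕ) : 9 ^ l * (l + 1) ≤ 2 * 16 ^ l := by
  induction l with
  | zero => norm_num
  | succ l ih =>
    rcases Nat.eq_zero_or_pos l with rfl | hl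
    · norm_num
    · calc 9 ^ (l + 1) * (l + 1 + 1) = 9 ^ l * (9 * (l + 2)) := by ring
        _ ≤ 9 ^ l * (16 * (l + 1)) := Nat.mul_le_mul_left _ (by omega)
        _ = 16 * (9 ^ l * (l + 1)) := by ring
        _ ≤ 16 * (2 * 16 ^ l) := Nat.mul_le_mul_left _ ih
        _ = _ := by ring

/-- One factor `8 * m` of the power absorbs `m`; the others are at least 16. -/
theorem sixteen_pow_mul_le (l m : ℕ) (hl : 0 < l) (hm : 2 ≤ m) : 16 ^ l * m ≤ 2 * (8 * m) ^ l := by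
  obtain ⟨k, rfl⟩ : ∃ k, l = k + 1 := ⟨l - 1, by omega⟩
  have h : (16 : ℕ) ^ k ≤ (8 * m) ^ k := Nat.pow_le_pow_left (by omega) k
  calc 16 ^ (k + 1) * m = 2 * (16 ^ k * (8 * m)) := by ring
    _ ≤ 2 * ((8 * m) ^ k * (8 * m)) := by gcongr
    _ = _ := by ring

theorem time_le_of_two_le {r l m n N g K : ℕ} (hl : 0 < l) (hm : 2 ≤ m) (hr : 2 ^ r ≤ 3 ^ l)
    (hrn : r ≤ n) (hN : N = m + g) :
    2 ^ r * (digitLists (l - 1)).length * (K * (2 * n + r + (l - 1) + N + 1)) ≤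
      24 * K * (n + g + 1) * (8 * m) ^ l := by
  have hd : (digitLists (l - 1)).length ≤ 3 ^ l := by
    have := length_digitLists (l - 1)
    rw [Nat.sub_add_cancel hl] at this
    omega
  have h1 : 2 * n + r + (l - 1) + N + 1 ≤ 3 * (n + g + 1) * ((l + 1) * m) := by
    obtain ⟨k, rfl⟩ : ∃ k, l = k + 1 := ⟨l - 1, by omega⟩
    obtain ⟨j, rfl⟩ : ∃ j, m = j + 2 := ⟨m - 2, by omega⟩
    subst hN
    rw [Nat.add_sub_cancel]
    nlinarith [Nat.zero_le (n * k), Nat.zero_le (n * j), Nat.zero_le (n * (k * j)),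
      Nat.zero_le (g * k), Nat.zero_le (g * j), Nat.zero_le (g * (k * j)), Nat.zero_le (k * j)]
  calc _ ≤ 3 ^ l * 3 ^ l * (K * (3 * (n + g + 1) * ((l + 1) * m))) := by gcongr
    _ = 3 * K * (n + g + 1) * ((9 ^ l * (l + 1)) * m) := by
        rw [← mul_pow]; norm_num; ring
    _ ≤ 3 * K * (n + g + 1) * ((2 * 16 ^ l) * m) :=
        Nat.mul_le_mul_left _ (Nat.mul_le_mul_right _ (nine_pow_mul_le l))
    _ = 6 * K * (n + g + 1) * (16 ^ l * m) := by ring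
    _ ≤ 6 * K * (n + g + 1) * (2 * (8 * m) ^ l) :=
        Nat.mul_le_mul_left _ (sixteen_pow_mul_le l m hl hm)
    _ = 12 * K * (n + g + 1) * (8 * m) ^ l := by ring
    _ ≤ _ := by gcongr; omega

/-- Here (8m)^l is only 8^l, below 9^l. With at most one digit there are at most four lists, and the
modes alone are bounded by 3^l. -/
theorem time_le_of_eq_one {r l m n N g b K : ℕ} (hm : m = 1) (hr : 2 ^ r ≤ 3 ^ l)
    (hrn : r ≤ n) (hN : N = m + g) :
    2 ^ r * (digitLists (min 1 b)).length * (K * (2 * n + r + min 1 b + N + 1)) ≤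
      24 * K * (n + g + 1) * (8 * m) ^ l := by
  subst hm
  have hb : min 1 b ≤ 1 := min_le_left _ _
  have hd : (digitLists (min 1 b)).length ≤ 4 := by
    have h := length_digitLists (min 1 b)
    have : 3 ^ (min 1 b + 1) ≤ 3 ^ 2 := Nat.pow_le_pow_right (by norm_num) (by omega)
    omega
  have h1 : 2 * n + r + min 1 b + N + 1 ≤ 3 * (n + g + 1) := by omega
  have h8 : 2 ^ r ≤ (8 * 1) ^ l := hr.trans (Nat.pow_le_pow_left (by norm_num) l)
  calc _ ≤ (8 * 1) ^ l * 4 * (K * (3 * (n + g + 1))) := by gcongr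
    _ = 12 * K * (n + g + 1) * (8 * 1) ^ l := by ring
    _ ≤ _ := by gcongr; omega

/-- This makes the logarithm positive, and it bounds the number of modes in terms of the truncation
order. -/
theorem argument_gt {r : ℕ} {δ η : ℝ} (hδ : 0 < δ) (hδ1 : δ < 1) :
    2 ^ r < 2 ^ r * δ⁻¹ * (1 + √η⁻¹) := by
  have h1 : 1 < δ⁻¹ := (one_lt_inv₀ hδ).2 hδ1
  have h2 : (0 : ℝ) < 2 ^ r := by positivity
  have h3 : 0 ≤ √η⁻¹ := Real.sqrt_nonneg _
  have h4 : (2 : ℝ) ^ r < 2 ^ r * δ⁻¹ := lt_mul_of_one_lt_right h2 h1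
  nlinarith

theorem argument_le_exp (r : ℕ) {ε δ η : ℝ} (hε : 0 < ε) (hδ : 0 < δ) :
    2 ^ r * δ⁻¹ * (1 + √η⁻¹) ≤ Real.exp (2 * ε * truncationOrder r ε δ η) := by
  have hpos : 0 < 2 ^ r * δ⁻¹ * (1 + √η⁻¹) := by positivity
  rw [← Real.log_le_iff_le_exp hpos]
  have := Nat.le_ceil (Real.log (2 ^ r * δ⁻¹ * (1 + √η⁻¹)) / (2 * ε))
  rw [div_le_iff₀ (by positivity)] at this
  rw [truncationOrder]
  linarith

/-- With Q the argument of the logarithm, (1 - 2ε)^l ≤ exp (-2εl) ≤ 1/Q. As Q² is at least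
4^r/(δ²η), the bound holds even with 2^(-r) to spare. -/
theorem error_le (r : ℕ) {ε δ η : ℝ} (hε : 0 < ε) (hε2 : ε ≤ 1 / 2) (hδ : 0 < δ) (hη : 0 < η) :
    2 ^ r * (1 - 2 * ε) ^ (2 * truncationOrder r ε δ η) ≤ δ ^ 2 * η := by
  set l := truncationOrder r ε δ η with hl
  set Q := 2 ^ r * δ⁻¹ * (1 + √η⁻¹) with hQ
  have hQpos : 0 < Q := by positivity
  have h1 : Q ≤ Real.exp (2 * ε * l) := argument_le_exp r hε hδ
  have h2 : (1 - 2 * ε) ^ l ≤ Q⁻¹ := by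
    calc (1 - 2 * ε) ^ l ≤ (Real.exp (-(2 * ε))) ^ l := by
          refine pow_le_pow_left₀ (by linarith) ?_ l
          have := Real.add_one_le_exp (-(2 * ε))
          linarith
      _ = (Real.exp (2 * ε * l))⁻¹ := by
          rw [← Real.exp_nat_mul, ← Real.exp_neg]
          congr 1
          ring
      _ ≤ Q⁻¹ := inv_anti₀ hQpos h1
  have h3 : (1 - 2 * ε) ^ (2 * l) ≤ (Q⁻¹) ^ 2 := by
    rw [mul_comm 2 l, pow_mul]
    exact pow_le_pow_left₀ (pow_nonneg (by linarith) l) h2 2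
  have h4 : η⁻¹ ≤ (1 + √η⁻¹) ^ 2 := by
    have h5 : √η⁻¹ ^ 2 = η⁻¹ := Real.sq_sqrt (by positivity)
    have h6 : 0 ≤ √η⁻¹ := Real.sqrt_nonneg _
    nlinarith
  have h7 : 1 ≤ η * (1 + √η⁻¹) ^ 2 := by
    calc 1 = η * η⁻¹ := (mul_inv_cancel₀ hη.ne').symm
      _ ≤ _ := by gcongr
  have h8 : (1 : ℝ) ≤ 2 ^ r := one_le_pow₀ (by norm_num)
  calc 2 ^ r * (1 - 2 * ε) ^ (2 * l) ≤ 2 ^ r * (Q⁻¹) ^ 2 := by gcongr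
    _ ≤ δ ^ 2 * η := by
      rw [inv_pow, ← div_eq_mul_inv, div_le_iff₀ (by positivity)]
      have e1 : δ ^ 2 * η * Q ^ 2 = 2 ^ r * (2 ^ r * (η * (1 + √η⁻¹) ^ 2)) := by
        rw [hQ]
        field_simp
      rw [e1]
      have : (1 : ℝ) ≤ 2 ^ r * (η * (1 + √η⁻¹) ^ 2) := one_le_mul_of_one_le_of_one_le h8 h7
      exact le_mul_of_one_le_right (by positivity) this

end
end NoisyClifford

/-! ### The theorem -/

theorem theorem2 :
    ∃ p : Polynomial ℕ,
      ∀ (r : ℕ) (ε δ η : ℝ), 0 < ε → 0 < δ → 0 < η →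
        ∃ P : Program,
          ∀ (n m : ℕ) (C : Circuit n m) (μ : Fin r ↪ Fin n) (e : Fin 3 → ℝ),
            0 < m → (∀ i, 0 ≤ e i ∧ e i ≤ 1 / 2) → secondLargest e = ε →
              ∃ out : PauliChoice m → Basis r → ℝ,
                Computes P C e μ out
                  (p.eval (n + C.numClifford) * (8 * m) ^ truncationOrder r ε δ η) ∧
                (1 - η) * (Nat.card (PauliChoice m) : ℝ) ≤
                  (Nat.card {y : PauliChoice m //
                    ∑ x, |out y x - C.outputProb e y μ x| ≤ δ} : ℝ) := by
  refine ⟨Polynomial.C setupConst + Polynomial.C (24 * pathConst) * (Polynomial.X + 1), ?_⟩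
  intro r ε δ η hε hδ hη
  have heval : ∀ A : ℕ, (Polynomial.C setupConst + Polynomial.C (24 * pathConst) *
      (Polynomial.X + 1) : Polynomial ℕ).eval A = setupConst + 24 * pathConst * (A + 1) := by
    intro A
    simp only [Polynomial.eval_add, Polynomial.eval_mul, Polynomial.eval_C, Polynomial.eval_X,
      Polynomial.eval_one]
  -- If δ ≥ 1, the answer 0 has error 1 ≤ δ; if η ≥ 1, nothing is required of the answer. Afterwards
  -- δ < 1, so that l is positive.
  by_cases htriv : 1 ≤ δ ∨ 1 ≤ η
  · refine ⟨.skip, fun n m C μ e hm he _ => ⟨fun _ _ => 0, ?_, ?_⟩⟩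
    · intro y x
      refine ⟨_, 1, Runs.skip _, ?_, rfl⟩
      rw [heval]
      have h1 : 0 < (8 * m) ^ truncationOrder r ε δ η := by positivity
      have h2 : 1 ≤ setupConst := by decide
      exact Nat.mul_pos (by omega) h1
    · rcases htriv with h | h
      · have hall : ∀ y : PauliChoice m, ∑ x, |(0 : ℝ) - C.outputProb e y μ x| ≤ δ := by
          intro y
          simp only [zero_sub, abs_neg]
          rw [C.sum_outputProb (fun i => ⟨(he i).1, (he i).2.trans (by norm_num)⟩) y μ]
          exact h
        rw [Nat.card_congr (Equiv.subtypeUnivEquiv hall)]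
        have : (0 : ℝ) ≤ Nat.card (PauliChoice m) := Nat.cast_nonneg _
        nlinarith
      · have h1 : (0 : ℝ) ≤ Nat.card (PauliChoice m) := Nat.cast_nonneg _
        exact (mul_nonpos_of_nonpos_of_nonneg (by linarith) h1).trans (Nat.cast_nonneg _)
  · push Not at htriv
    obtain ⟨hδ1, hη1⟩ := htriv
    set l := truncationOrder r ε δ η with hl
    have hQ := argument_gt (r := r) (η := η) hδ hδ1
    have hle := argument_le_exp (η := η) r hε hδ
    rw [← hl] at hle
    -- For l = 0 the argument of the logarithm would be at most 1, but it exceeds 2^r.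
    have hl0 : 0 < l := by
      rcases Nat.eq_zero_or_pos l with h | h
      · rw [h, Nat.cast_zero, mul_zero, Real.exp_zero] at hle
        have : (1 : ℝ) ≤ 2 ^ r := one_le_pow₀ (by norm_num)
        linarith
      · exact h
    -- Budget l - 1: the neglected part then has at least l nontrivial components, and there are
    -- fewer than 3^l digit lists.
    refine ⟨mainProgram r (l - 1), fun n m C μ e hm he hsec =>
      ⟨fun y x => C.trunc e y C.steps.reverse (l - 1) (outcomeProjector μ x), ?_, ?_⟩⟩
    · have hε2 : ε ≤ 1 / 2 := hsec ▸ secondLargest_le fun i => (he i).2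
      -- From 2ε ≤ 1 and e < 3. Without this the factor 2^r would enter the polynomial.
      have hr : 2 ^ r ≤ 3 ^ l := by
        have h1 : (2 : ℝ) ^ r ≤ 3 ^ l := by
          calc (2 : ℝ) ^ r ≤ Real.exp (2 * ε * l) := hQ.le.trans hle
            _ ≤ Real.exp ((l : ℝ) * 1) := by
                refine Real.exp_le_exp.2 ?_
                have : (0 : ℝ) ≤ l := Nat.cast_nonneg l
                nlinarith
            _ = Real.exp 1 ^ l := Real.exp_nat_mul 1 l
            _ ≤ 3 ^ l := by
                refine pow_le_pow_left₀ (Real.exp_pos 1).le ?_ l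
                have := Real.exp_one_lt_d9
                linarith
        exact_mod_cast h1
      have hrn : r ≤ n := by simpa using Fintype.card_le_of_embedding μ
      have key := mainProgram_computes C e μ (l - 1)
        (24 * pathConst * (n + C.numClifford + 1) * (8 * m) ^ l) hm
        (fun h2 => time_le_of_two_le hl0 h2 hr hrn C.length_steps)
        (fun h1 => time_le_of_eq_one h1 hr hrn C.length_steps)
      intro y x
      obtain ⟨s, t, h1, h2, h3⟩ := key y x
      refine ⟨s, t, h1, h2.trans ?_, h3⟩
      rw [heval, add_mul]
      have h8 : 1 ≤ (8 * m) ^ l := Nat.one_le_pow _ _ (by omega)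
      exact Nat.add_le_add_right (Nat.le_mul_of_pos_right _ h8) _
    · refine card_le_of_sum_sq_le _ hδ ?_
      refine (C.sum_sq_error_le he μ (l - 1)).trans ?_
      rw [hsec, Nat.sub_add_cancel hl0]
      exact mul_le_mul_of_nonneg_right
        (error_le r hε (hsec ▸ secondLargest_le fun i => (he i).2) hδ hη) (Nat.cast_nonneg _)
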